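/- Let $g\ge 2$, let $\Sigma$ be a closed connected oriented surface of genus $g$, and let $\Gamma=\langle a_1,b_1,\dots,a_g,b_g\mid [a_1,b_1]\cdots[a_g,b_g]=1\rangle$ be its fundamental group. Let $\mathrm{Aut}^+(\Gamma)\subset\mathrm{Aut}(\Gamma)$ be the group of orientation-preserving automorphisms, that is, of those automorphisms that act as the identity on $H_2(\Gamma,\mathbb Z)=H_2(\Sigma,\mathbb Z)\cong\mathbb Z$. For a group $G$, it acts by precomposition on the set of surjective homomorphisms $\Gamma\to G$. Write $\mathbb Z_n=\mathbb Z/n\mathbb Z$, and let $D_n$ be the dihedral group of order $2n$. 1. If $G=\mathbb Z_n$ with $n\ge 1$, or $G=D_n$ with $n\ge 1$ odd, then surjective homomorphisms $\Gamma\to G$ exist and $\mathrm{Aut}^+(\Gamma)$ acts transitively on the set of them. 2. If $G$ is $\mathfrak A_4$, $\mathfrak S_4$, $\mathfrak A_5$, or $D_n$ with $n\ge 2$ even, then $\mathrm{Aut}^+(\Gamma)$ has exactly two orbits on the set of surjective homomorphisms $\Gamma\to G$. The two orbits are distinguished by liftability to $\mathrm{SL}_2(\mathbb C)$: for every injective homomorphism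 $\iota:G\to\mathrm{PSL}_2(\mathbb C)$, two surjective homomorphisms $\rho_1,\rho_2:\Gamma\to G$ lie in the same orbit if and only if $\iota\circ\rho_1$ and $\iota\circ\rho_2$ either both lift to homomorphisms $\Gamma\to\mathrm{SL}_2(\mathbb C)$ or both do not. -/

import Mathlib

open CategoryTheory

/-- The product `[a₁, b₁] ⋯ [a_g, b_g]` (in this order, `[a, b] = a b a⁻¹ b⁻¹`) in the free group on
`a₁, …, a_g` (`Sum.inl`) and `b₁, …, b_g` (`Sum.inr`). -/
def surfaceRelator (g : ℕ) : FreeGroup (Fin g ⊕ Fin g) :=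
  (List.ofFn fun i : Fin g =>
    FreeGroup.of (Sum.inl i : Fin g ⊕ Fin g) * FreeGroup.of (Sum.inr i) *
      (FreeGroup.of (Sum.inl i))⁻¹ * (FreeGroup.of (Sum.inr i))⁻¹).prod

/-- The fundamental group `⟨a₁, b₁, …, a_g, b_g ∣ [a₁, b₁] ⋯ [a_g, b_g] = 1⟩` of a closed
connected oriented surface of genus `g`. -/
abbrev SurfaceGroup (g : ℕ) : Type :=
  PresentedGroup ({surfaceRelator g} : Set (FreeGroup (Fin g ⊕ Fin g)))

/-- The endomorphism of `H₂(G; ℤ)` (group homology, trivial coefficients) induced by an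
automorphism of `G`. -/
noncomputable def homologyTwoMap {G : Type} [Group G] (σ : MulAut G) :
    groupHomology (Rep.trivial ℤ G ℤ) 2 ⟶ groupHomology (Rep.trivial ℤ G ℤ) 2 :=
  groupHomology.map (A := Rep.trivial ℤ G ℤ) (B := Rep.trivial ℤ G ℤ)
    σ.toMonoidHom (𝟙 (Rep.trivial ℤ G ℤ)) 2

theorem homologyTwoMap_one {G : Type} [Group G] :
    homologyTwoMap (1 : MulAut G) = 𝟙 (groupHomology (Rep.trivial ℤ G ℤ) 2) :=
  groupHomology.map_id 2

theorem homologyTwoMap_mul {G : Type} [Group G] (σ τ : MulAut G) :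
    homologyTwoMap (σ * τ) = homologyTwoMap τ ≫ homologyTwoMap σ :=
  groupHomology.map_comp (A := Rep.trivial ℤ G ℤ) (B := Rep.trivial ℤ G ℤ)
    (C := Rep.trivial ℤ G ℤ) τ.toMonoidHom σ.toMonoidHom (𝟙 (Rep.trivial ℤ G ℤ))
    (𝟙 (Rep.trivial ℤ G ℤ)) 2

/-- The group `Aut⁺(Γ)` of positive automorphisms of the surface group. For `g ≥ 1` the surface
is aspherical, so `H₂(Γ; ℤ) = H₂(Σ; ℤ) ≅ ℤ` is generated by the fundamental class `[Σ]`, and a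
based self-map of `Σ` inducing `σ` preserves the orientation exactly when it has degree `1`, that
is, when `σ` acts as the identity on `H₂(Γ; ℤ)`. -/
def AutPlus (g : ℕ) : Subgroup (MulAut (SurfaceGroup g)) where
  carrier := {σ | homologyTwoMap σ = 𝟙 _}
  one_mem' := homologyTwoMap_one
  mul_mem' {σ τ} hσ hτ := by
    simp only [Set.mem_ofPred_eq] at hσ hτ ⊢
    rw [homologyTwoMap_mul, hσ, hτ, Category.comp_id]
  inv_mem' {σ} hσ := by
    simp only [Set.mem_ofPred_eq] at hσ ⊢
    have h := homologyTwoMap_mul σ σ⁻¹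
    rw [mul_inv_cancel, homologyTwoMap_one, hσ, Category.comp_id] at h
    exact h.symm

/-- The set of surjective homomorphisms `Γ → G`. -/
abbrev SurjHom (g : ℕ) (G : Type) [Group G] : Type :=
  {ρ : SurfaceGroup g →* G // Function.Surjective ρ}

/-- `Aut⁺(Γ)` acts on surjective homomorphisms by precomposition, written as a left action
`σ • ρ = ρ ∘ σ⁻¹`. -/
instance instMulActionSurjHom (g : ℕ) (G : Type) [Group G] :
    MulAction (AutPlus g) (SurjHom g G) where
  smul σ ρ := ⟨ρ.1.comp (σ⁻¹ : AutPlus g).1.toMonoidHom,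
    ρ.2.comp (σ⁻¹ : AutPlus g).1.surjective⟩
  one_smul _ := Subtype.ext (MonoidHom.ext fun _ => rfl)
  mul_smul σ τ ρ := Subtype.ext (MonoidHom.ext fun x => congrArg ρ.1
    (show (σ * τ)⁻¹.1 x = τ⁻¹.1 (σ⁻¹.1 x) by rw [mul_inv_rev]; rfl))

/-- A representation `Γ → PSL₂(ℂ)` lifts to `SL₂(ℂ)`. -/
def LiftsToSL {g : ℕ}
    (ρ : SurfaceGroup g →* Matrix.ProjectiveSpecialLinearGroup (Fin 2) ℂ) : Prop :=
  ∃ ρ' : SurfaceGroup g →* Matrix.SpecialLinearGroup (Fin 2) ℂ,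
    (QuotientGroup.mk' (Subgroup.center (Matrix.SpecialLinearGroup (Fin 2) ℂ))).comp ρ' = ρ

/-- There is a surjective homomorphism `Γ → G`, and `Aut⁺(Γ)` acts transitively on these. -/
def ActsTransitively (g : ℕ) (G : Type) [Group G] : Prop :=
  Nonempty (SurjHom g G) ∧ MulAction.IsPretransitive (AutPlus g) (SurjHom g G)

/-- `Aut⁺(Γ)` has exactly two orbits on surjective homomorphisms `Γ → G`. Moreover, for every
realisation `ι` of `G` as a subgroup of `PSL₂(ℂ)`, two surjective homomorphisms lie in the same
orbit if and only if both or neither of them lift to `SL₂(ℂ)`. -/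
def HasTwoOrbitsByLifting (g : ℕ) (G : Type) [Group G] : Prop :=
  Nat.card (MulAction.orbitRel.Quotient (AutPlus g) (SurjHom g G)) = 2 ∧
  ∀ ι : G →* Matrix.ProjectiveSpecialLinearGroup (Fin 2) ℂ, Function.Injective ι →
    ∀ ρ₁ ρ₂ : SurjHom g G,
      ρ₁ ∈ MulAction.orbit (AutPlus g) ρ₂ ↔
        (LiftsToSL (ι.comp ρ₁.1) ↔ LiftsToSL (ι.comp ρ₂.1))

/-! A homomorphism from the surface group to `G` is a list of `g` pairs ("handles") in `G` whose
commutators multiply to 1. Dehn twists and exchanges of neighbouring handles are given by words in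
the entries. Applied to the free generators, these words define automorphisms of the free group that
fix the relator. Such automorphisms descend to the surface group and act trivially on its second
homology (`homologyTwoMap_eq_id_of_conj_relator`), and the same holds for inner automorphisms. Hence
lists that differ by moves and a simultaneous conjugation belong to one orbit
(`mem_orbit_of_conjEquiv`), and it remains to bring generating lists to normal forms. The main tool
is `HandleEquiv.slide`: the entry `a` of a handle `(a, 1)` may be multiplied by any element of the
group that the other handles generate.

Two normal forms occur. In `(x, 1), (y, 1), (1, 1), …` every second entry is trivial, so the
homomorphism lifts through every surjection. In `(a, 1), (u, v), (1, 1), …` the elements `u`, `v`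
are distinct commuting involutions. A lift to a central extension would force lifts of `u` and `v`
to commute, whereas in `SL₂` such lifts anticommute. Liftability is constant on orbits, so it
separates the two forms (`hasTwoOrbitsByLifting_of_normalForms`). To count orbits without an
embedding into `PSL₂(ℂ)`, other central extensions serve the same purpose: generalised quaternion
groups for `D_n`, and `GL₂(𝔽₅) → PGL₂(𝔽₅)` for the other groups.

For cyclic groups the normal form comes from the Euclidean algorithm. For dihedral groups all
reflections are collected in one entry `sr p` of a handle `(sr p, r i)`, and the surface relation
becomes `2i = 0`. This leaves `i = 0` if `n` is odd, and `i = 0` or `i = n/2` if `n` is even. For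
the three remaining groups, `exists_normalForm_of_representatives` reduces every genus to statements
about at most three handles. Slides and conjugations make these finite, and they are checked by
evaluation on permutations coded as numbers. -/

/-! ### Central extensions and the action on second homology of a one-relator group -/

/-- A 2-cocycle of a group with values in an abelian group with trivial action. -/
structure TrivialTwoCocycle (G A : Type*) [Group G] [AddCommGroup A] where
  toFun : G → G → A
  cocycle : ∀ g h k, toFun (g * h) k + toFun g h = toFun h k + toFun g (h * k)

namespace TrivialTwoCocycle

variable {G A B : Type*} [Group G] [AddCommGroup A] [AddCommGroup B]

theorem one_left (c : TrivialTwoCocycle G A) (g : G) : c.toFun 1 g = c.toFun 1 1 := by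
  have h := c.cocycle 1 1 g
  simp only [one_mul] at h
  exact (add_left_cancel h).symm

theorem one_right (c : TrivialTwoCocycle G A) (g : G) : c.toFun g 1 = c.toFun 1 1 := by
  have h := c.cocycle g 1 1
  simp only [mul_one] at h
  exact add_right_cancel h

/-- Push a cocycle forward along a homomorphism of coefficients. -/
def map (c : TrivialTwoCocycle G A) (q : A →+ B) : TrivialTwoCocycle G B where
  toFun g h := q (c.toFun g h)
  cocycle g h k := by rw [← map_add, ← map_add, c.cocycle]

/-- The central extension of `G` by `A` defined by a 2-cocycle. -/
@[ext] structure Extension (c : TrivialTwoCocycle G A) where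
  fiber : A
  base : G

namespace Extension

variable {c : TrivialTwoCocycle G A}

instance : Mul c.Extension := ⟨fun x y => ⟨x.fiber + y.fiber + c.toFun x.base y.base, x.base * y.base⟩⟩
-- Cocycles are not assumed to be normalised, which is why `c.toFun 1 1` enters the unit and the
-- inverse.
instance : One c.Extension := ⟨⟨-c.toFun 1 1, 1⟩⟩
instance : Inv c.Extension :=
  ⟨fun x => ⟨-x.fiber - c.toFun x.base⁻¹ x.base - c.toFun 1 1, x.base⁻¹⟩⟩

@[simp] theorem mul_fiber (x y : c.Extension) :
    (x * y).fiber = x.fiber + y.fiber + c.toFun x.base y.base := rfl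
@[simp] theorem mul_base (x y : c.Extension) : (x * y).base = x.base * y.base := rfl
@[simp] theorem one_fiber : (1 : c.Extension).fiber = -c.toFun 1 1 := rfl
@[simp] theorem one_base : (1 : c.Extension).base = 1 := rfl
@[simp] theorem inv_fiber (x : c.Extension) :
    x⁻¹.fiber = -x.fiber - c.toFun x.base⁻¹ x.base - c.toFun 1 1 := rfl
@[simp] theorem inv_base (x : c.Extension) : x⁻¹.base = x.base⁻¹ := rfl

instance : Group c.Extension :=
  Group.ofLeftAxioms
    (fun x y z => by
      ext
      · have h := c.cocycle x.base y.base z.base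
        simp only [mul_fiber, mul_base]
        rw [show x.fiber + y.fiber + c.toFun x.base y.base + z.fiber +
          c.toFun (x.base * y.base) z.base = x.fiber + y.fiber + z.fiber +
          (c.toFun (x.base * y.base) z.base + c.toFun x.base y.base) by abel, h]
        abel
      · simp [mul_assoc])
    (fun x => by ext <;> simp [c.one_left])
    (fun x => by
      ext
      · simp only [mul_fiber, inv_fiber, inv_base, one_fiber]
        abel
      · simp)

theorem comm_of_base_eq_one {x : c.Extension} (hx : x.base = 1) (y : c.Extension) :
    y * x = x * y := by
  ext
  · simp [hx, c.one_left, c.one_right, add_comm]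
  · simp [hx]

/-- The projection of the extension to its base. -/
def proj (c : TrivialTwoCocycle G A) : c.Extension →* G where
  toFun := base
  map_one' := rfl
  map_mul' _ _ := rfl

end Extension

end TrivialTwoCocycle

open TrivialTwoCocycle in
/-- Let `Γ = ⟨X ∣ r⟩` with `r` a product of commutators, and let `σ` be an endomorphism of `Γ`
covered by an endomorphism `φ` of the free group that maps `r` to a conjugate. Then, up to a
coboundary, every 2-cocycle takes values in a cyclic subgroup fixed by `σ`. -/
theorem exists_fixed_generator {X : Type*} {A : Type*} [AddCommGroup A] {r : FreeGroup X}
    (hr : r ∈ commutator (FreeGroup X))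
    (c : TrivialTwoCocycle (PresentedGroup {r}) A)
    (σ : PresentedGroup {r} →* PresentedGroup {r}) (φ : FreeGroup X →* FreeGroup X)
    (hφ : ∀ x, PresentedGroup.mk {r} (φ x) = σ (PresentedGroup.mk {r} x))
    (w : FreeGroup X) (hw : φ r = w * r * w⁻¹)
    (τ : A →+ A) (hτ : ∀ g h, τ (c.toFun g h) = c.toFun (σ g) (σ h)) :
    ∃ α : A, τ α = α ∧ ∃ f : PresentedGroup {r} → A ⧸ AddSubgroup.zmultiples α, ∀ g h,
      (QuotientAddGroup.mk (c.toFun g h) : A ⧸ AddSubgroup.zmultiples α) =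
        f (g * h) - f g - f h := by
  have hmk : PresentedGroup.mk {r} r = 1 :=
    PresentedGroup.one_of_mem rfl
  -- The free group lifts to the extension. Since `r` is trivial in the base, `s r` lies in the
  -- central copy of `A`.
  let s : FreeGroup X →* c.Extension := FreeGroup.lift fun x => ⟨0, PresentedGroup.of x⟩
  have hs : ∀ x, (s x).base = PresentedGroup.mk {r} x := by
    intro x
    have : (Extension.proj c).comp s = PresentedGroup.mk {r} := by
      ext x; simp [s, Extension.proj, PresentedGroup.of]
    exact DFunLike.congr_fun this x
  -- The fibres of `s x` under `τ` and of `s (φ x)` both fail to be additive by the cocycle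
  -- evaluated at the images under `σ`. Their difference is therefore a homomorphism to an abelian
  -- group and vanishes on the product of commutators `r`.
  let δ : FreeGroup X →* Multiplicative A :=
    { toFun := fun x => Multiplicative.ofAdd (τ (s x).fiber - (s (φ x)).fiber)
      map_one' := by
        have h1 := hτ 1 1
        rw [map_one] at h1
        simp [h1]
      map_mul' := fun x y => by
        rw [← ofAdd_add]
        simp only [map_mul, Extension.mul_fiber, map_add, hs, hφ, hτ]
        congr 1; abel }
  have hδ : δ r = 1 := by
    have : commutator (FreeGroup X) ≤ δ.ker := Abelianization.commutator_subset_ker δ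
    exact this hr
  have hfix : τ (s r).fiber = (s r).fiber := by
    have h1 : τ (s r).fiber - (s (φ r)).fiber = 0 := hδ
    rw [sub_eq_zero] at h1
    have h2 : s (φ r) = s r := by
      have hb : (s r).base = 1 := by rw [hs, hmk]
      rw [hw, map_mul, map_mul, Extension.comm_of_base_eq_one hb, mul_assoc, ← map_mul,
        mul_inv_cancel, map_one, mul_one]
    rw [h1, h2]
  -- The unit has fibre `-c.toFun 1 1`, so this element measures how far `s r` is from the unit.
  refine ⟨(s r).fiber + c.toFun 1 1, ?_, ?_⟩
  · rw [map_add, hfix, hτ, map_one]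
  set α := (s r).fiber + c.toFun 1 1 with hα
  let q : A →+ A ⧸ AddSubgroup.zmultiples α := QuotientAddGroup.mk' _
  let s' : FreeGroup X →* (c.map q).Extension := FreeGroup.lift fun x => ⟨0, PresentedGroup.of x⟩
  let p : c.Extension →* (c.map q).Extension :=
    { toFun := fun x => ⟨q x.fiber, x.base⟩
      map_one' := by ext <;> simp [TrivialTwoCocycle.map]
      map_mul' := fun x y => by
        ext
        · exact (map_add q _ _).trans (congrArg (· + _) (map_add q _ _))
        · rfl }
  have hps : p.comp s = s' := by
    ext x
    · simp [p, s, s']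
    · rfl
  have hr' : s' r = 1 := by
    rw [← hps]
    ext
    · have : q ((s r).fiber + c.toFun 1 1) = 0 := by
        rw [← hα]
        exact (QuotientAddGroup.eq_zero_iff _).2 (AddSubgroup.mem_zmultiples α)
      rw [map_add] at this
      exact eq_neg_of_add_eq_zero_left this
    · simp [p, hs, hmk]
  -- Modulo `α` the lift kills the relator, so it descends to a splitting of the extension. The
  -- fibre of the splitting is a cochain with the required coboundary.
  let t : PresentedGroup {r} →* (c.map q).Extension := PresentedGroup.toGroup
    (f := fun x => ⟨0, PresentedGroup.of x⟩) (by rintro _ rfl; exact hr')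
  have ht : ∀ g, (t g).base = g := by
    intro g
    have : (Extension.proj (c.map q)).comp t = MonoidHom.id _ := by
      ext x; simp [t, Extension.proj]
    exact DFunLike.congr_fun this g
  refine ⟨fun g => (t g).fiber, fun g h => ?_⟩
  simp only [map_mul, Extension.mul_fiber, ht]
  change q (c.toFun g h) = _ + q (c.toFun g h) - _ - _
  abel

open groupHomology in
/-- The universal 2-cocycle of a group, with values in 2-chains modulo boundaries. -/
noncomputable def universalCocycle (G : Type) [Group G] :
    TrivialTwoCocycle G ((G × G →₀ ℤ) ⧸ boundaries₂ (Rep.trivial ℤ G ℤ)) where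
  toFun g h := Submodule.Quotient.mk (Finsupp.single (g, h) 1)
  cocycle g h k := by
    rw [← Submodule.Quotient.mk_add, ← Submodule.Quotient.mk_add]
    rw [eq_comm, Submodule.Quotient.eq]
    refine ⟨Finsupp.single (g, h, k) (1 : ℤ), ?_⟩
    erw [d₃₂_single]
    simp only [Rep.trivial]
    simp
    abel

open groupHomology in
theorem homologyTwoMap_eq_id_of_sub_mem {G : Type} [Group G] (σ : MulAut G)
    (h : ∀ x ∈ cycles₂ (Rep.trivial ℤ G ℤ),
      (Finsupp.mapDomain (Prod.map σ σ) x : G × G →₀ ℤ) - x ∈ boundaries₂ (Rep.trivial ℤ G ℤ)) :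
    homologyTwoMap σ = 𝟙 _ := by
  rw [← cancel_epi (H2π (Rep.trivial ℤ G ℤ))]
  refine (H2π_comp_map (A := Rep.trivial ℤ G ℤ) (B := Rep.trivial ℤ G ℤ) σ.toMonoidHom
    (𝟙 (Rep.trivial ℤ G ℤ))).trans ?_
  rw [Category.comp_id]
  ext x
  simp only [ModuleCat.hom_comp, LinearMap.comp_apply]
  refine (H2π_eq_iff _ _).2 ?_
  convert h x.1 x.2 using 1
  refine congrArg (· - x.1) ?_
  exact Finsupp.mapRange_id _

-- This is Hopf's description of the homology of a one-relator group: modulo boundaries, every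
-- 2-cycle is a multiple of a single class determined by the relator, and a conjugate of the relator
-- determines the same class. The argument applies `exists_fixed_generator` to the universal
-- cocycle.
open groupHomology in
theorem homologyTwoMap_eq_id_of_conj_relator {X : Type} {r : FreeGroup X}
    (hr : r ∈ commutator (FreeGroup X)) (σ : MulAut (PresentedGroup {r}))
    (φ : FreeGroup X →* FreeGroup X)
    (hφ : ∀ x, PresentedGroup.mk {r} (φ x) = σ (PresentedGroup.mk {r} x))
    (w : FreeGroup X) (hw : φ r = w * r * w⁻¹) :
    homologyTwoMap σ = 𝟙 _ := by
  refine homologyTwoMap_eq_id_of_sub_mem σ fun x hx => ?_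
  let Γ := PresentedGroup {r}
  let B₂ := boundaries₂ (Rep.trivial ℤ Γ ℤ)
  let m : (Γ × Γ →₀ ℤ) →ₗ[ℤ] (Γ × Γ →₀ ℤ) := Finsupp.lmapDomain ℤ ℤ (Prod.map σ σ)
  have hm : B₂ ≤ B₂.comap m := by
    rintro _ ⟨y, rfl⟩
    refine ⟨Finsupp.mapDomain (Prod.map σ (Prod.map σ σ)) y, ?_⟩
    induction y using Finsupp.induction_linear with
    | zero => simp
    | add y z hy hz => rw [Finsupp.mapDomain_add, map_add, map_add, map_add, hy, hz]
    | single p n =>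
      rw [Finsupp.mapDomain_single]
      refine (d₃₂_single (A := Rep.trivial ℤ Γ ℤ) _ n).trans
        (Eq.trans ?_ (congrArg m (d₃₂_single (A := Rep.trivial ℤ Γ ℤ) p n)).symm)
      simp only [map_sub, map_add, m, Finsupp.lmapDomain_apply]
      erw [Finsupp.mapDomain_single, Finsupp.mapDomain_single, Finsupp.mapDomain_single,
        Finsupp.mapDomain_single]
      simp [Prod.map]
  let τ : (Γ × Γ →₀ ℤ) ⧸ B₂ →ₗ[ℤ] (Γ × Γ →₀ ℤ) ⧸ B₂ := B₂.mapQ B₂ m hm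
  have hτ : ∀ g h, τ ((universalCocycle Γ).toFun g h) =
      (universalCocycle Γ).toFun (σ g) (σ h) := by
    intro g h
    simp only [universalCocycle, τ, Submodule.mapQ_apply, m, Finsupp.lmapDomain_apply]
    rw [Finsupp.mapDomain_single]
    rfl
  obtain ⟨α, hα, f, hf⟩ := exists_fixed_generator hr (universalCocycle Γ) σ.toMonoidHom φ hφ w hw
    τ.toAddMonoidHom hτ
  -- Modulo `α` the universal cocycle is the coboundary of `f`. The quotient map on 2-chains thus
  -- factors through the boundary operator `d₂₁`, which vanishes on the cycle `x`.
  have key : (Submodule.Quotient.mk x : (Γ × Γ →₀ ℤ) ⧸ B₂) ∈ AddSubgroup.zmultiples α := by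
    rw [← QuotientAddGroup.eq_zero_iff]
    let F : (Γ →₀ ℤ) →+ ((Γ × Γ →₀ ℤ) ⧸ B₂) ⧸ AddSubgroup.zmultiples α :=
      Finsupp.liftAddHom fun g => (zmultiplesHom _) (f g)
    let q : (Γ × Γ →₀ ℤ) →+ ((Γ × Γ →₀ ℤ) ⧸ B₂) ⧸ AddSubgroup.zmultiples α :=
      (QuotientAddGroup.mk' _).comp B₂.mkQ.toAddMonoidHom
    have hq : q = -(F.comp (d₂₁ (Rep.trivial ℤ Γ ℤ)).hom.toAddMonoidHom) := by
      ext p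
      have h1 : q (Finsupp.single p 1) = f (p.1 * p.2) - f p.1 - f p.2 := hf p.1 p.2
      have h2 : (d₂₁ (Rep.trivial ℤ Γ ℤ)).hom (Finsupp.single p (1 : ℤ)) =
          (Finsupp.single p.2 1 - Finsupp.single (p.1 * p.2) 1 + Finsupp.single p.1 1 : Γ →₀ ℤ) :=
        (d₂₁_single (A := Rep.trivial ℤ Γ ℤ) p 1)
      have h3 : ∀ g : Γ, F (Finsupp.single g 1) = f g := fun g => by simp [F]
      refine h1.trans ?_
      change _ = -(F ((d₂₁ (Rep.trivial ℤ Γ ℤ)).hom (Finsupp.single p (1 : ℤ))))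
      rw [h2, map_add, map_sub, h3, h3, h3]
      abel
    have h0 : q x = 0 := by
      rw [hq]
      have : (d₂₁ (Rep.trivial ℤ Γ ℤ)).hom x = 0 := hx
      simp [this]
    exact h0
  obtain ⟨n, hn⟩ := AddSubgroup.mem_zmultiples_iff.1 key
  have h1 : τ (Submodule.Quotient.mk x) = Submodule.Quotient.mk x := by
    rw [← hn, map_zsmul]
    exact congrArg _ hα
  exact (Submodule.Quotient.eq _).1 h1

/-! ### Elementary moves on lists of handles -/

/-- The product of the commutators of a list of pairs ("handles"). -/
def commProd {G : Type*} [Group G] (L : List (G × G)) : G :=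
  (L.map fun p => p.1 * p.2 * p.1⁻¹ * p.2⁻¹).prod

/-- Elementary moves on lists of handles: the Dehn twists of one handle, a twist that mixes two
consecutive handles, and the exchange of two consecutive handles, with their inverses. -/
inductive HandleMove
  | A | A' | B | B' | Z | Z' | S | S'

namespace HandleMove

/-- The effect of a move on the first handles of a list. -/
def act {α : Type*} [Mul α] [Inv α] : HandleMove → List (α × α) → List (α × α)
  | A, (a, b) :: t => (a, b * a) :: t
  | A', (a, b) :: t => (a, b * a⁻¹) :: t
  | B, (a, b) :: t => (a * b, b) :: t
  | B', (a, b) :: t => (a * b⁻¹, b) :: t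
  | Z, (a, b) :: (c, d) :: t =>
    let z := b⁻¹ * (c * d * c⁻¹)
    (a * z⁻¹, z * b * z⁻¹) :: (z * c, d) :: t
  | Z', (a, b) :: (c, d) :: t =>
    let z := b⁻¹ * (c * d * c⁻¹)
    (a * z, z⁻¹ * b * z) :: (z⁻¹ * c, d) :: t
  | S, (a, b) :: (c, d) :: t =>
    let k := c * d * c⁻¹ * d⁻¹
    (c, d) :: (k⁻¹ * a * k, k⁻¹ * b * k) :: t
  | S', (a, b) :: (c, d) :: t =>
    let k := a * b * a⁻¹ * b⁻¹
    (k * c * k⁻¹, k * d * k⁻¹) :: (a, b) :: t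
  | _, L => L

/-- The effect of a move at a given position. -/
def actAt {α : Type*} [Mul α] [Inv α] (m : HandleMove) : ℕ → List (α × α) → List (α × α)
  | 0, L => m.act L
  | _ + 1, [] => []
  | k + 1, p :: t => p :: m.actAt k t

/-- The inverse move. -/
def inv : HandleMove → HandleMove
  | A => A' | A' => A | B => B' | B' => B | Z => Z' | Z' => Z | S => S' | S' => S

theorem inv_inv (m : HandleMove) : m.inv.inv = m := by cases m <;> rfl

/-- Only compatibility with products and inverses is required, because the lemma is also applied to
permutation codes, which carry no group structure. -/
theorem act_map {α β : Type*} [Mul α] [Inv α] [Mul β] [Inv β] (f : α → β)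
    (hmul : ∀ x y, f (x * y) = f x * f y) (hinv : ∀ x, f x⁻¹ = (f x)⁻¹)
    (m : HandleMove) (L : List (α × α)) :
    m.act (L.map (Prod.map f f)) = (m.act L).map (Prod.map f f) := by
  rcases L with _ | ⟨⟨a, b⟩, _ | ⟨⟨c, d⟩, t⟩⟩ <;> cases m <;> simp [act, hmul, hinv]

theorem actAt_map {α β : Type*} [Mul α] [Inv α] [Mul β] [Inv β] (f : α → β)
    (hmul : ∀ x y, f (x * y) = f x * f y) (hinv : ∀ x, f x⁻¹ = (f x)⁻¹)
    (m : HandleMove) (k : ℕ) (L : List (α × α)) :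
    m.actAt k (L.map (Prod.map f f)) = (m.actAt k L).map (Prod.map f f) := by
  induction k generalizing L with
  | zero => exact act_map f hmul hinv m L
  | succ k ih => cases L with
    | nil => rfl
    | cons p t => simp [actAt, ih]

theorem length_act {α : Type*} [Mul α] [Inv α] (m : HandleMove) (L : List (α × α)) :
    (m.act L).length = L.length := by
  rcases L with _ | ⟨⟨a, b⟩, _ | ⟨⟨c, d⟩, t⟩⟩ <;> cases m <;> simp [act]

theorem length_actAt {α : Type*} [Mul α] [Inv α] (m : HandleMove) (k : ℕ) (L : List (α × α)) :
    (m.actAt k L).length = L.length := by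
  induction k generalizing L with
  | zero => exact length_act m L
  | succ k ih => cases L with
    | nil => rfl
    | cons p t => simp [actAt, ih]

variable {G : Type*} [Group G]

/-- The auxiliary word of a mixed move can be recovered afterwards. In `Z`, both `b` and `c * d *
c⁻¹` are conjugated by `z`, so the new `z` equals the old one; in `S`, the commutator `k` becomes
that of the first handle. -/
theorem act_inv_act (m : HandleMove) (L : List (G × G)) : m.inv.act (m.act L) = L := by
  rcases L with _ | ⟨⟨a, b⟩, _ | ⟨⟨c, d⟩, t⟩⟩ <;> cases m <;> simp [act, inv, mul_assoc]

theorem actAt_inv_actAt (m : HandleMove) (k : ℕ) (L : List (G × G)) :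
    m.inv.actAt k (m.actAt k L) = L := by
  induction k generalizing L with
  | zero => exact act_inv_act m L
  | succ k ih => cases L with
    | nil => rfl
    | cons p t => simp [actAt, ih]

theorem commProd_act (m : HandleMove) (L : List (G × G)) : commProd (m.act L) = commProd L := by
  rcases L with _ | ⟨⟨a, b⟩, _ | ⟨⟨c, d⟩, t⟩⟩ <;> cases m <;> simp [act, commProd, mul_assoc]

theorem commProd_actAt (m : HandleMove) (k : ℕ) (L : List (G × G)) :
    commProd (m.actAt k L) = commProd L := by
  induction k generalizing L with
  | zero => exact commProd_act m L
  | succ k ih => cases L with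
    | nil => rfl
    | cons p t =>
      have := ih t
      simp only [commProd] at this
      simp [actAt, commProd, this]

end HandleMove

/-- Apply a sequence of moves. -/
def runMoves {α : Type*} [Mul α] [Inv α] (w : List (ℕ × HandleMove)) (L : List (α × α)) :
    List (α × α) :=
  w.foldl (fun L p => p.2.actAt p.1 L) L

/-- The inverse sequence of moves. -/
def invMoves (w : List (ℕ × HandleMove)) : List (ℕ × HandleMove) :=
  (w.map fun p => (p.1, p.2.inv)).reverse

theorem runMoves_map {α β : Type*} [Mul α] [Inv α] [Mul β] [Inv β] (f : α → β)
    (hmul : ∀ x y, f (x * y) = f x * f y) (hinv : ∀ x, f x⁻¹ = (f x)⁻¹)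
    (w : List (ℕ × HandleMove)) (L : List (α × α)) :
    runMoves w (L.map (Prod.map f f)) = (runMoves w L).map (Prod.map f f) := by
  induction w generalizing L with
  | nil => rfl
  | cons m w ih =>
    change runMoves w (m.2.actAt m.1 _) = (runMoves w (m.2.actAt m.1 L)).map _
    rw [HandleMove.actAt_map f hmul hinv, ih]

theorem runMoves_map_hom {G H : Type*} [Group G] [Group H] (f : G →* H)
    (w : List (ℕ × HandleMove)) (L : List (G × G)) :
    runMoves w (L.map (Prod.map f f)) = (runMoves w L).map (Prod.map f f) :=
  runMoves_map f (map_mul f) (map_inv f) w L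

theorem runMoves_append {α : Type*} [Mul α] [Inv α] (w w' : List (ℕ × HandleMove))
    (L : List (α × α)) : runMoves (w ++ w') L = runMoves w' (runMoves w L) :=
  List.foldl_append

theorem length_runMoves {α : Type*} [Mul α] [Inv α] (w : List (ℕ × HandleMove))
    (L : List (α × α)) : (runMoves w L).length = L.length := by
  induction w generalizing L with
  | nil => rfl
  | cons m w ih => exact (ih _).trans (HandleMove.length_actAt _ _ _)

theorem commProd_runMoves {G : Type*} [Group G] (w : List (ℕ × HandleMove))
    (L : List (G × G)) : commProd (runMoves w L) = commProd L := by
  induction w generalizing L with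
  | nil => rfl
  | cons m w ih => exact (ih _).trans (HandleMove.commProd_actAt _ _ _)

theorem runMoves_invMoves {G : Type*} [Group G] (w : List (ℕ × HandleMove))
    (L : List (G × G)) : runMoves (invMoves w) (runMoves w L) = L := by
  induction w generalizing L with
  | nil => rfl
  | cons m w ih =>
    have : invMoves (m :: w) = invMoves w ++ [(m.1, m.2.inv)] := by simp [invMoves]
    rw [this, runMoves_append]
    change runMoves _ (runMoves (invMoves w) (runMoves w (m.2.actAt m.1 L))) = L
    rw [ih]
    exact HandleMove.actAt_inv_actAt _ _ _

theorem invMoves_invMoves (w : List (ℕ × HandleMove)) : invMoves (invMoves w) = w := by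
  simp [invMoves, Function.comp_def, HandleMove.inv_inv]

/-! ### From moves to positive automorphisms -/

/-- The standard generators of the free group, as a list of handles. -/
def freeHandles (g : ℕ) : List (FreeGroup (Fin g ⊕ Fin g) × FreeGroup (Fin g ⊕ Fin g)) :=
  List.ofFn fun i => (FreeGroup.of (Sum.inl i), FreeGroup.of (Sum.inr i))

theorem length_freeHandles (g : ℕ) : (freeHandles g).length = g := by simp [freeHandles]

theorem commProd_freeHandles (g : ℕ) : commProd (freeHandles g) = surfaceRelator g := by
  simp [commProd, freeHandles, surfaceRelator, List.map_ofFn, Function.comp_def]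

theorem map_commProd {G H : Type*} [Group G] [Group H] (f : G →* H) (L : List (G × G)) :
    f (commProd L) = commProd (L.map (Prod.map f f)) := by
  simp [commProd, map_list_prod, List.map_map, Function.comp_def]

/-- The homomorphism from the free group that takes given values on the standard handles. -/
def freeHomOfHandles {g : ℕ} {H : Type*} [Group H] (L : List (H × H)) (hL : L.length = g) :
    FreeGroup (Fin g ⊕ Fin g) →* H :=
  FreeGroup.lift (Sum.elim (fun i => (L.get (i.cast hL.symm)).1)
    fun i => (L.get (i.cast hL.symm)).2)

theorem map_freeHomOfHandles {g : ℕ} {H : Type*} [Group H] (L : List (H × H))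
    (hL : L.length = g) :
    (freeHandles g).map (Prod.map (freeHomOfHandles L hL) (freeHomOfHandles L hL)) = L := by
  subst hL
  simp [freeHandles, List.map_ofFn, Function.comp_def, freeHomOfHandles]

theorem freeHom_ext {g : ℕ} {H : Type*} [Group H] {f f' : FreeGroup (Fin g ⊕ Fin g) →* H}
    (h : (freeHandles g).map (Prod.map f f) = (freeHandles g).map (Prod.map f' f')) :
    f = f' := by
  simp only [freeHandles, List.map_ofFn, List.ofFn_inj] at h
  ext x
  rcases x with i | i
  · exact congrArg Prod.fst (congrFun h i)
  · exact congrArg Prod.snd (congrFun h i)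

theorem surfaceRelator_mem_commutator (g : ℕ) :
    surfaceRelator g ∈ commutator (FreeGroup (Fin g ⊕ Fin g)) := by
  refine Subgroup.list_prod_mem _ fun x hx => ?_
  obtain ⟨i, rfl⟩ := (List.mem_ofFn' _ _).1 hx
  exact Subgroup.commutator_mem_commutator (Subgroup.mem_top _) (Subgroup.mem_top _)

/-- The values of a homomorphism on the standard handles of the surface group. -/
def handles {g : ℕ} {G : Type*} [Group G] (ρ : SurfaceGroup g →* G) : List (G × G) :=
  (freeHandles g).map
    (Prod.map (ρ.comp (PresentedGroup.mk _)) (ρ.comp (PresentedGroup.mk _)))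

section handles

variable {g : ℕ} {G : Type*} [Group G]

theorem length_handles (ρ : SurfaceGroup g →* G) : (handles ρ).length = g := by
  simp [handles, length_freeHandles]

theorem handles_comp {H : Type*} [Group H] (ρ : SurfaceGroup g →* G) (f : G →* H) :
    handles (f.comp ρ) = (handles ρ).map (Prod.map f f) := by
  simp [handles, Function.comp_def]

theorem commProd_handles (ρ : SurfaceGroup g →* G) : commProd (handles ρ) = 1 := by
  rw [handles, ← map_commProd, commProd_freeHandles, MonoidHom.comp_apply,
    PresentedGroup.one_of_mem (Set.mem_singleton _), map_one]

theorem handles_injective : Function.Injective (handles : (SurfaceGroup g →* G) → _) := by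
  intro ρ ρ' h
  have := freeHom_ext h
  ext x
  exact DFunLike.congr_fun this (FreeGroup.of x)

theorem exists_hom_of_handles (L : List (G × G)) (hL : L.length = g) (h1 : commProd L = 1) :
    ∃ ρ : SurfaceGroup g →* G, handles ρ = L := by
  have hr : freeHomOfHandles L hL (surfaceRelator g) = 1 := by
    rw [← commProd_freeHandles, map_commProd, map_freeHomOfHandles, h1]
  refine ⟨PresentedGroup.toGroup (f := Sum.elim (fun i => (L.get (i.cast hL.symm)).1)
    fun i => (L.get (i.cast hL.symm)).2) (by rintro _ rfl; exact hr), ?_⟩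
  refine Eq.trans ?_ (map_freeHomOfHandles L hL)
  rw [handles]
  congr 2

/-- The subgroup generated by the entries of a list of handles. -/
def handleClosure (L : List (G × G)) : Subgroup G :=
  Subgroup.closure {x | ∃ p ∈ L, x = p.1 ∨ x = p.2}

theorem handleClosure_handles (ρ : SurfaceGroup g →* G) :
    handleClosure (handles ρ) = ρ.range := by
  have hset : {x | ∃ p ∈ handles ρ, x = p.1 ∨ x = p.2} =
      Set.range (ρ ∘ (PresentedGroup.of : Fin g ⊕ Fin g → SurfaceGroup g)) := by
    ext x
    simp only [handles, freeHandles, List.map_ofFn, List.mem_ofFn', Set.mem_ofPred_eq,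
      Set.mem_range]
    constructor
    · rintro ⟨p, ⟨i, rfl⟩, h | h⟩
      · exact ⟨Sum.inl i, h.symm⟩
      · exact ⟨Sum.inr i, h.symm⟩
    · rintro ⟨i | i, rfl⟩
      · exact ⟨_, ⟨i, rfl⟩, Or.inl rfl⟩
      · exact ⟨_, ⟨i, rfl⟩, Or.inr rfl⟩
  rw [handleClosure, hset, Set.range_comp, ← MonoidHom.map_closure,
    PresentedGroup.closure_range_of, ← MonoidHom.range_eq_map]

end handles

/-- Automorphism of the surface group induced by a free automorphism fixing the relator up to
conjugation. -/
theorem exists_autPlus {g : ℕ} (φ ψ : FreeGroup (Fin g ⊕ Fin g) →* FreeGroup (Fin g ⊕ Fin g))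
    (h₁ : ∀ x, φ (ψ x) = x) (h₂ : ∀ x, ψ (φ x) = x) (w w' : FreeGroup (Fin g ⊕ Fin g))
    (hφ : φ (surfaceRelator g) = w * surfaceRelator g * w⁻¹)
    (hψ : ψ (surfaceRelator g) = w' * surfaceRelator g * w'⁻¹) :
    ∃ σ ∈ AutPlus g, ∀ x, σ (PresentedGroup.mk {surfaceRelator g} x) =
      PresentedGroup.mk {surfaceRelator g} (φ x) := by
  have key : ∀ (θ : FreeGroup (Fin g ⊕ Fin g) →* FreeGroup (Fin g ⊕ Fin g))
      (v : FreeGroup (Fin g ⊕ Fin g)), θ (surfaceRelator g) = v * surfaceRelator g * v⁻¹ →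
      ∃ s : SurfaceGroup g →* SurfaceGroup g, ∀ x, s (PresentedGroup.mk {surfaceRelator g} x) =
      PresentedGroup.mk {surfaceRelator g} (θ x) := by
    intro θ v hv
    have hrel : ∀ r ∈ ({surfaceRelator g} : Set (FreeGroup (Fin g ⊕ Fin g))),
        FreeGroup.lift (fun x => PresentedGroup.mk {surfaceRelator g} (θ (FreeGroup.of x))) r
          = 1 := by
      rintro _ rfl
      have : FreeGroup.lift (fun x => PresentedGroup.mk {surfaceRelator g} (θ (FreeGroup.of x))) =
          (PresentedGroup.mk {surfaceRelator g}).comp θ := by ext x; simp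
      rw [this, MonoidHom.comp_apply, hv, map_mul, map_mul, PresentedGroup.one_of_mem (Set.mem_singleton _), mul_one,
        ← map_mul, mul_inv_cancel, map_one]
    refine ⟨PresentedGroup.toGroup hrel, fun x => ?_⟩
    have : (PresentedGroup.toGroup hrel).comp (PresentedGroup.mk {surfaceRelator g}) =
        (PresentedGroup.mk {surfaceRelator g}).comp θ := by
      ext x
      exact PresentedGroup.toGroup.of hrel
    exact DFunLike.congr_fun this x
  obtain ⟨s, hs⟩ := key φ w hφ
  obtain ⟨t, ht⟩ := key ψ w' hψ
  have hst : s.comp t = MonoidHom.id _ := by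
    ext x
    change s (t (PresentedGroup.mk _ (FreeGroup.of x))) = PresentedGroup.mk _ (FreeGroup.of x)
    rw [ht, hs, h₁]
  have hts : t.comp s = MonoidHom.id _ := by
    ext x
    change t (s (PresentedGroup.mk _ (FreeGroup.of x))) = PresentedGroup.mk _ (FreeGroup.of x)
    rw [hs, ht, h₂]
  refine ⟨s.toMulEquiv t hts hst, ?_, hs⟩
  exact homologyTwoMap_eq_id_of_conj_relator (surfaceRelator_mem_commutator g) _ φ
    (fun x => (hs x).symm) w hφ

section orbits

variable {g : ℕ} {G : Type} [Group G]

theorem mem_orbit_of_precomp {ρ ρ' : SurjHom g G} {σ : MulAut (SurfaceGroup g)}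
    (hσ : σ ∈ AutPlus g) (h : ∀ x, ρ'.1 x = ρ.1 (σ x)) :
    ρ' ∈ MulAction.orbit (AutPlus g) ρ := by
  refine ⟨(⟨σ, hσ⟩ : AutPlus g)⁻¹, Subtype.ext (MonoidHom.ext fun x => ?_)⟩
  rw [h]
  change ρ.1 ((((⟨σ, hσ⟩ : AutPlus g)⁻¹)⁻¹).1 x) = _
  rw [_root_.inv_inv]

/-- Moves commute with homomorphisms. Running `w` on the free handles gives an endomorphism of the
free group that fixes the relator and is inverted by `invMoves w`; composing `ρ` with the induced
automorphism has the same effect as running `w` on the handles of `ρ`. -/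
theorem mem_orbit_of_runMoves {ρ ρ' : SurjHom g G} (w : List (ℕ × HandleMove))
    (h : handles ρ'.1 = runMoves w (handles ρ.1)) : ρ' ∈ MulAction.orbit (AutPlus g) ρ := by
  have hlen : ∀ v, (runMoves v (freeHandles g)).length = g := fun v => by
    rw [length_runMoves, length_freeHandles]
  have hfix : ∀ v, freeHomOfHandles (runMoves v (freeHandles g)) (hlen v) (surfaceRelator g) =
      surfaceRelator g := fun v => by
    rw [← commProd_freeHandles, map_commProd, map_freeHomOfHandles, commProd_runMoves]
  have hinv : ∀ v, (freeHomOfHandles (runMoves v (freeHandles g)) (hlen v)).comp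
      (freeHomOfHandles (runMoves (invMoves v) (freeHandles g)) (hlen (invMoves v))) =
      MonoidHom.id _ := fun v => by
    refine freeHom_ext ?_
    have : ∀ (f f' : FreeGroup (Fin g ⊕ Fin g) →* FreeGroup (Fin g ⊕ Fin g)),
        (freeHandles g).map (Prod.map (f.comp f') (f.comp f')) =
        ((freeHandles g).map (Prod.map f' f')).map (Prod.map f f) := by
      intro f f'; simp [Function.comp_def]
    rw [this, map_freeHomOfHandles, ← runMoves_map_hom, map_freeHomOfHandles,
      runMoves_invMoves]
    simp
  obtain ⟨σ, hσ, h'⟩ := exists_autPlus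
    (freeHomOfHandles (runMoves w (freeHandles g)) (hlen w))
    (freeHomOfHandles (runMoves (invMoves w) (freeHandles g)) (hlen (invMoves w)))
    (fun x => DFunLike.congr_fun (hinv w) x)
    (fun x => by
      have := hinv (invMoves w)
      simp only [invMoves_invMoves] at this
      exact DFunLike.congr_fun this x) 1 1
    (by rw [hfix]; simp) (by rw [hfix]; simp)
  refine mem_orbit_of_precomp hσ ?_
  have : ρ'.1 = ρ.1.comp σ.toMonoidHom := by
    apply handles_injective
    rw [h]
    have e : (ρ.1.comp σ.toMonoidHom).comp (PresentedGroup.mk _) =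
        (ρ.1.comp (PresentedGroup.mk _)).comp
          (freeHomOfHandles (runMoves w (freeHandles g)) (hlen w)) :=
      MonoidHom.ext fun x => congrArg ρ.1 (h' x)
    rw [handles, handles, e, runMoves_map_hom]
    conv_lhs => rw [← map_freeHomOfHandles (runMoves w (freeHandles g)) (hlen w)]
    simp [Function.comp_def]
  intro x
  rw [this]
  rfl

/-- By surjectivity `x` is the image of some `y`, so the conjugation comes from an inner
automorphism of the surface group. It is covered by a conjugation of the free group, which sends the
relator to a conjugate. -/
theorem mem_orbit_of_conj {ρ ρ' : SurjHom g G} (x : G)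
    (h : handles ρ'.1 = (handles ρ.1).map (Prod.map (MulAut.conj x) (MulAut.conj x))) :
    ρ' ∈ MulAction.orbit (AutPlus g) ρ := by
  obtain ⟨y, rfl⟩ := ρ.2 x
  obtain ⟨y, rfl⟩ := PresentedGroup.mk_surjective _ y
  obtain ⟨σ, hσ, h'⟩ := exists_autPlus (g := g) (MulAut.conj y).toMonoidHom
    (MulAut.conj y⁻¹).toMonoidHom (fun x => by simp [mul_assoc]) (fun x => by simp [mul_assoc])
    y y⁻¹ (by simp) (by simp)
  refine mem_orbit_of_precomp hσ fun z => ?_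
  have e : ρ'.1 = (MulAut.conj (ρ.1 (PresentedGroup.mk _ y))).toMonoidHom.comp ρ.1 := by
    apply handles_injective
    rw [h, handles_comp]
    rfl
  obtain ⟨z, rfl⟩ := PresentedGroup.mk_surjective _ z
  rw [e, h']
  simp

end orbits

/-! ### Equivalence of lists of handles -/

/-- Two lists of handles are equivalent if a sequence of moves transforms one into the other. -/
def HandleEquiv {G : Type*} [Group G] (L L' : List (G × G)) : Prop :=
  ∃ w, runMoves w L = L'

infix:50 " ∼ₕ " => HandleEquiv

namespace HandleEquiv

variable {G : Type*} [Group G] {L L' L'' T : List (G × G)}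

theorem refl (L : List (G × G)) : L ∼ₕ L := ⟨[], rfl⟩

theorem symm (h : L ∼ₕ L') : L' ∼ₕ L := by
  obtain ⟨w, rfl⟩ := h
  exact ⟨invMoves w, runMoves_invMoves w L⟩

theorem trans (h : L ∼ₕ L') (h' : L' ∼ₕ L'') : L ∼ₕ L'' := by
  obtain ⟨w, rfl⟩ := h
  obtain ⟨w', rfl⟩ := h'
  exact ⟨w ++ w', runMoves_append w w' L⟩

theorem of_run (w : List (ℕ × HandleMove)) (L : List (G × G)) : L ∼ₕ runMoves w L := ⟨w, rfl⟩

theorem cons (p : G × G) (h : L ∼ₕ L') : p :: L ∼ₕ p :: L' := by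
  obtain ⟨w, rfl⟩ := h
  refine ⟨w.map fun m => (m.1 + 1, m.2), ?_⟩
  induction w generalizing L with
  | nil => rfl
  | cons m w ih => exact ih

theorem append_left (T : List (G × G)) (h : L ∼ₕ L') : T ++ L ∼ₕ T ++ L' := by
  induction T with
  | nil => exact h
  | cons p T ih => exact ih.cons p

/-- The same word cannot simply be reused: a move that does nothing because the list is too short
may act on the longer list. Each move is therefore translated separately, possibly to the empty
word. -/
theorem append_right (T : List (G × G)) (h : L ∼ₕ L') : L ++ T ∼ₕ L' ++ T := by
  have act : ∀ (m : HandleMove) (L : List (G × G)), L ++ T ∼ₕ m.act L ++ T := by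
    intro m L
    rcases L with _ | ⟨⟨a, b⟩, _ | ⟨⟨c, d⟩, t⟩⟩ <;> cases m <;>
      first
      | exact refl _
      | exact ⟨[(0, .A)], rfl⟩
      | exact ⟨[(0, .A')], rfl⟩
      | exact ⟨[(0, .B)], rfl⟩
      | exact ⟨[(0, .B')], rfl⟩
      | exact ⟨[(0, .Z)], rfl⟩
      | exact ⟨[(0, .Z')], rfl⟩
      | exact ⟨[(0, .S)], rfl⟩
      | exact ⟨[(0, .S')], rfl⟩
  have actAt : ∀ (m : HandleMove) (k : ℕ) (L : List (G × G)), L ++ T ∼ₕ m.actAt k L ++ T := by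
    intro m k
    induction k with
    | zero => exact act m
    | succ k ih =>
      intro L
      cases L with
      | nil => exact refl _
      | cons p L => exact (ih L).cons p
  obtain ⟨w, rfl⟩ := h
  induction w generalizing L with
  | nil => exact refl _
  | cons m w ih => exact (actAt m.2 m.1 L).trans ih

theorem map {H : Type*} [Group H] (f : G →* H) (h : L ∼ₕ L') :
    L.map (Prod.map f f) ∼ₕ L'.map (Prod.map f f) := by
  obtain ⟨w, rfl⟩ := h
  exact ⟨w, runMoves_map_hom f w L⟩

theorem commProd_eq (h : L ∼ₕ L') : commProd L' = commProd L := by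
  obtain ⟨w, rfl⟩ := h
  exact commProd_runMoves w L

theorem handleClosure_le (h : L ∼ₕ L') : handleClosure L' ≤ handleClosure L := by
  obtain ⟨w, rfl⟩ := h
  let K := handleClosure L
  have hK : ∀ p ∈ L, p.1 ∈ K ∧ p.2 ∈ K := fun p hp =>
    ⟨Subgroup.subset_closure ⟨p, hp, Or.inl rfl⟩, Subgroup.subset_closure ⟨p, hp, Or.inr rfl⟩⟩
  let L₀ : List (K × K) := L.attach.map fun p =>
    (⟨p.1.1, (hK p.1 p.2).1⟩, ⟨p.1.2, (hK p.1 p.2).2⟩)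
  have hL₀ : L₀.map (Prod.map K.subtype K.subtype) = L := by
    simp only [L₀, List.map_map]
    exact List.attach_map_subtype_val L
  rw [← hL₀, runMoves_map_hom, hL₀]
  refine (Subgroup.closure_le _).2 ?_
  rintro x ⟨p, hp, hx⟩
  obtain ⟨q, -, rfl⟩ := List.mem_map.1 hp
  rcases hx with rfl | rfl
  · exact q.1.2
  · exact q.2.2

theorem handleClosure_eq (h : L ∼ₕ L') : handleClosure L' = handleClosure L :=
  le_antisymm h.handleClosure_le h.symm.handleClosure_le

theorem twistA (a b : G) (T : List (G × G)) : (a, b) :: T ∼ₕ (a, b * a) :: T := ⟨[(0, .A)], rfl⟩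

theorem twistB (a b : G) (T : List (G × G)) : (a, b) :: T ∼ₕ (a * b, b) :: T := ⟨[(0, .B)], rfl⟩

/-- This is the quarter turn of the handle, the element of order four in `SL₂(ℤ)` as a product of
three twists. -/
theorem rotate (a b : G) (T : List (G × G)) : (a, b) :: T ∼ₕ (a * b * a⁻¹, a⁻¹) :: T :=
  ⟨[(0, .B), (0, .A'), (0, .B)], by simp [runMoves, HandleMove.actAt, HandleMove.act]⟩

theorem rotate_inv (a b : G) (T : List (G × G)) : (a, b) :: T ∼ₕ (b⁻¹, b * a * b⁻¹) :: T := by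
  have h := (rotate b⁻¹ (b * a * b⁻¹) T).symm
  simpa [mul_assoc] using h

theorem one_left (b : G) (T : List (G × G)) : (1, b) :: T ∼ₕ (b⁻¹, 1) :: T := by
  simpa using rotate_inv 1 b T

theorem inv_left (a : G) (T : List (G × G)) : (a, 1) :: T ∼ₕ (a⁻¹, 1) :: T := by
  have h := (rotate a 1 T).trans (rotate (a * 1 * a⁻¹) a⁻¹ T)
  simpa using h

theorem swap_of_comm {a b : G} (h : a * b = b * a) (p : G × G) (T : List (G × G)) :
    (a, b) :: p :: T ∼ₕ p :: (a, b) :: T :=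
  ⟨[(0, .S')], by simp [runMoves, HandleMove.actAt, HandleMove.act, h]⟩

theorem swap (a : G) (p : G × G) (T : List (G × G)) :
    (a, 1) :: p :: T ∼ₕ p :: (a, 1) :: T := swap_of_comm (by simp) p T

theorem move_append {a b : G} (h : a * b = b * a) (L T : List (G × G)) :
    (a, b) :: (L ++ T) ∼ₕ L ++ (a, b) :: T := by
  induction L with
  | nil => exact refl _
  | cons p L ih => exact (swap_of_comm h p _).trans (ih.cons p)

/-- The multipliers `h` that are possible for all `a` form a subgroup, so generators suffice. The
handle `(a, 1)` commutes past its neighbours to stand directly before the handle containing the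
generator, and it returns afterwards. -/
theorem slide (a : G) {h : G} (hh : h ∈ handleClosure L) : (a, 1) :: L ∼ₕ (a * h, 1) :: L := by
  -- With second entry 1 the multiplier of `Z` is `c * d * c⁻¹`. It changes the next handle to `(c *
  -- d, d)`, which a twist restores.
  have base : ∀ a c d (T : List (G × G)),
      (a, 1) :: (c, d) :: T ∼ₕ (a * (c * d * c⁻¹)⁻¹, 1) :: (c, d) :: T := fun a c d T =>
    ⟨[(0, .Z), (1, .B')], by simp [runMoves, HandleMove.actAt, HandleMove.act, mul_assoc]⟩
  let K : Subgroup G :=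
    { carrier := {h | ∀ a, (a, 1) :: L ∼ₕ (a * h, 1) :: L}
      one_mem' := fun a => by rw [mul_one]; exact refl _
      mul_mem' := fun {x y} hx hy a => by
        rw [← mul_assoc]
        exact (hx a).trans (hy _)
      inv_mem' := fun {x} hx a => by simpa using (hx (a * x⁻¹)).symm }
  have conj : ∀ {L₁ L₂ : List (G × G)} {p : G × G} {x : G}, L = L₁ ++ p :: L₂ →
      (∀ a, (a, 1) :: p :: L₂ ∼ₕ (a * x, 1) :: p :: L₂) → x ∈ K := by
    rintro L₁ L₂ p x rfl hx a
    exact (move_append (by simp) L₁ _).trans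
      (((hx a).append_left L₁).trans (move_append (by simp) L₁ _).symm)
  have hK : handleClosure L ≤ K := by
    refine (Subgroup.closure_le _).2 ?_
    rintro x ⟨⟨c, d⟩, hp, hx⟩
    obtain ⟨L₁, L₂, hL⟩ := List.append_of_mem hp
    have h1 : (c * d * c⁻¹)⁻¹ ∈ K := conj hL fun a => base a c d L₂
    -- A quarter turn of `(c, d)` changes the multiplier to `c⁻¹`; `d` is then obtained from both
    -- multipliers.
    have h2 : c⁻¹ ∈ K := conj hL fun a => by
      have e := (((rotate_inv c d L₂).cons (a, 1)).trans (base a _ _ L₂)).trans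
        ((rotate_inv c d L₂).symm.cons _)
      simpa [mul_assoc] using e
    rcases hx with rfl | rfl
    · exact (Subgroup.inv_mem_iff K).1 h2
    · have h3 := K.mul_mem (K.mul_mem h2 (K.inv_mem h1)) (K.inv_mem h2)
      simpa [mul_assoc] using h3
  exact hK hh a

theorem slide_left (a : G) {h : G} (hh : h ∈ handleClosure L) :
    (a, 1) :: L ∼ₕ (h * a, 1) :: L := by
  have e := ((inv_left a L).trans (slide a⁻¹ (inv_mem hh))).trans (inv_left _ L)
  simpa using e

theorem slide_to_one {a : G} (ha : a ∈ handleClosure L) : (a, 1) :: L ∼ₕ (1, 1) :: L := by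
  simpa using slide a (inv_mem ha)

theorem exists_one_of_mul_eq_one (a c : G) {b d : G} (h : b * d = 1) (T : List (G × G)) :
    ∃ x p, (a, b) :: (c, d) :: T ∼ₕ (x, 1) :: p :: T := by
  obtain rfl : d = b⁻¹ := eq_inv_of_mul_eq_one_right h
  -- The twists turn the second handle into `(b, b⁻¹ * c)`, and `Z` turns it into `(b⁻¹ * c, b⁻¹ *
  -- c)`, so that a last twist makes its second entry trivial.
  refine ⟨b⁻¹ * c, (a * b * c⁻¹ * b, b⁻¹ * c * b * c⁻¹ * b), ?_⟩
  refine trans (L' := (a * b * c⁻¹ * b, b⁻¹ * c * b * c⁻¹ * b) :: (b⁻¹ * c, 1) :: T)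
    ⟨[(1, .A), (1, .B'), (0, .Z), (1, .A')], ?_⟩ (swap _ _ _).symm
  simp [runMoves, HandleMove.actAt, HandleMove.act, mul_assoc]

theorem exists_one_of_entry (T : List (G × G)) {a b c d : G}
    (h : a = 1 ∨ b = 1 ∨ c = 1 ∨ d = 1 ∨ b * d = 1) :
    ∃ x p, (a, b) :: (c, d) :: T ∼ₕ (x, 1) :: p :: T := by
  rcases h with rfl | rfl | rfl | rfl | h
  · exact ⟨_, _, one_left b _⟩
  · exact ⟨_, _, refl _⟩
  · exact ⟨_, _, ((one_left d T).cons _).trans (swap _ _ _).symm⟩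
  · exact ⟨_, _, (swap _ _ _).symm⟩
  · exact exists_one_of_mul_eq_one a c h T

theorem nielsenB (a b : G) (T : List (G × G)) :
    (a, 1) :: (b, 1) :: T ∼ₕ (a * b, 1) :: (b, 1) :: T :=
  slide a (Subgroup.subset_closure ⟨(b, 1), by simp, Or.inl rfl⟩)

theorem nielsenA (a b : G) (T : List (G × G)) :
    (a, 1) :: (b, 1) :: T ∼ₕ (a, 1) :: (b * a, 1) :: T :=
  ((swap a _ T).trans (nielsenB b a T)).trans (swap _ _ T)

end HandleEquiv

/-- The Euclidean algorithm for pairs of powers of one element. -/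
theorem exists_pow_one_of_twists {G : Type*} [Group G] (R : G × G → G × G → Prop)
    (hrefl : ∀ p, R p p) (hsymm : ∀ p q, R p q → R q p)
    (htrans : ∀ p q r, R p q → R q r → R p r)
    (hA : ∀ a b, R (a, b) (a, b * a)) (hB : ∀ a b, R (a, b) (a * b, b)) (t : G) (i j : ℕ) :
    ∃ d : ℕ, R (t ^ i, t ^ j) (t ^ d, 1) := by
  induction hn : i + j using Nat.strong_induction_on generalizing i j with
  | _ n ih =>
    subst hn
    rcases Nat.eq_zero_or_pos j with rfl | hj
    · exact ⟨i, by simpa using hrefl _⟩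
    rcases Nat.eq_zero_or_pos i with rfl | hi
    · refine ⟨j, htrans _ (t ^ j, t ^ j) _ (by simpa using hB 1 (t ^ j)) ?_⟩
      exact hsymm _ _ (by simpa using hA (t ^ j) 1)
    rcases le_total i j with h | h
    · obtain ⟨d, hd⟩ := ih (i + (j - i)) (by omega) i (j - i) rfl
      refine ⟨d, htrans _ _ _ (hsymm _ _ ?_) hd⟩
      simpa [← pow_add, h] using hA (t ^ i) (t ^ (j - i))
    · obtain ⟨d, hd⟩ := ih (i - j + j) (by omega) (i - j) j rfl
      refine ⟨d, htrans _ _ _ (hsymm _ _ ?_) hd⟩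
      simpa [← pow_add, h] using hB (t ^ (i - j)) (t ^ j)

namespace HandleEquiv

variable {G : Type*} [Group G]

theorem exists_pow_one (t : G) (i j : ℕ) (T : List (G × G)) :
    ∃ d : ℕ, (t ^ i, t ^ j) :: T ∼ₕ (t ^ d, 1) :: T :=
  exists_pow_one_of_twists (fun p q => p :: T ∼ₕ q :: T) (fun _ => refl _)
    (fun _ _ => symm) (fun _ _ _ => trans) (fun a b => twistA a b T) (fun a b => twistB a b T) t i j

theorem exists_pow_one_pair (t : G) (i j : ℕ) (T : List (G × G)) :
    ∃ d : ℕ, (t ^ i, 1) :: (t ^ j, 1) :: T ∼ₕ (t ^ d, 1) :: (1, 1) :: T :=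
  exists_pow_one_of_twists (fun p q => (p.1, 1) :: (p.2, 1) :: T ∼ₕ (q.1, 1) :: (q.2, 1) :: T)
    (fun _ => refl _) (fun _ _ => symm) (fun _ _ _ => trans)
    (fun a b => nielsenA a b T) (fun a b => nielsenB a b T) t i j

theorem twistA_pow (n : ℕ) (a b : G) (T : List (G × G)) :
    (a, b) :: T ∼ₕ (a, b * a ^ n) :: T := by
  induction n with
  | zero => simpa using refl _
  | succ n ih => simpa [pow_succ, mul_assoc] using ih.trans (twistA _ _ T)

theorem twistB_pow (n : ℕ) (a b : G) (T : List (G × G)) :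
    (a, b) :: T ∼ₕ (a * b ^ n, b) :: T := by
  induction n with
  | zero => simpa using refl _
  | succ n ih => simpa [pow_succ, mul_assoc] using ih.trans (twistB _ _ T)

/-- A handle `(t ^ k, 1)` with `k` invertible modulo the order of `t` may be replaced by
`(t, 1)`. -/
theorem generator_handle (t : G) {k m : ℕ} (h : (t ^ k) ^ m = t) (T : List (G × G)) :
    (t ^ k, 1) :: T ∼ₕ (t, 1) :: T := by
  -- The second entry, being trivial, can be turned into `t`. Then `t` clears the first entry, and
  -- quarter turns bring `(1, t)` to `(t, 1)`.
  have h1 := twistA_pow m (t ^ k) 1 T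
  rw [h, one_mul] at h1
  have h2 := (twistB_pow k 1 t T).symm
  rw [one_mul] at h2
  exact (h1.trans h2).trans ((one_left t T).trans (by simpa using inv_left t⁻¹ T))

end HandleEquiv

/-! ### Lifting homomorphisms to central extensions -/

section lifting

variable {g : ℕ} {G E K : Type*} [Group G] [Group E] [Group K]

theorem commProd_eq_one_of_snd_mem_center {L : List (G × G)} (h : ∀ p ∈ L, p.2 ∈ Subgroup.center G) :
    commProd L = 1 := by
  refine List.prod_eq_one fun x hx => ?_
  obtain ⟨p, hp, rfl⟩ := List.mem_map.1 hx
  rw [(Subgroup.mem_center_iff.1 (h p hp) p.1)]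
  simp

/-- Lift the first entries arbitrarily and the second entries by 1: all commutators upstairs are
trivial. -/
theorem exists_lift_of_snd_eq_one {π : E →* K} (hπ : Function.Surjective π)
    (ρ : SurfaceGroup g →* K) (h : ∀ p ∈ handles ρ, p.2 = 1) :
    ∃ ρ' : SurfaceGroup g →* E, π.comp ρ' = ρ := by
  let L : List (E × E) := (handles ρ).map fun p => (Function.surjInv hπ p.1, 1)
  have hL : ∀ p ∈ L, p.2 ∈ Subgroup.center E := by
    intro p hp
    obtain ⟨q, -, rfl⟩ := List.mem_map.1 hp
    exact one_mem _
  obtain ⟨ρ', hρ'⟩ := exists_hom_of_handles (g := g) L (by simp [L, length_handles]) (commProd_eq_one_of_snd_mem_center hL)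
  refine ⟨ρ', handles_injective ?_⟩
  rw [handles_comp, hρ', List.map_map]
  conv_rhs => rw [← List.map_id (handles ρ)]
  refine List.map_congr_left fun p hp => ?_
  simp [Function.surjInv_eq hπ, Prod.map, ← h p hp]

/-- In a lift, every handle other than the second has a central second entry and hence a trivial
commutator. The surface relation then says that the lifts of `u` and `v` commute. -/
theorem not_exists_lift {π : E →* K} (hπ : π.ker ≤ Subgroup.center E)
    (ρ : SurfaceGroup g →* K) {a u v : K} {k : ℕ}
    (h : handles ρ = (a, 1) :: (u, v) :: List.replicate k (1, 1))
    (huv : ∀ U V, π U = u → π V = v → U * V ≠ V * U) :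
    ¬ ∃ ρ' : SurfaceGroup g →* E, π.comp ρ' = ρ := by
  rintro ⟨ρ', rfl⟩
  rw [handles_comp] at h
  have h1 := commProd_handles ρ'
  rcases hL : handles ρ' with _ | ⟨⟨A, B⟩, _ | ⟨⟨U, V⟩, T⟩⟩
  · simp [hL] at h
  · simp [hL] at h
  rw [hL] at h h1
  simp only [List.map_cons, Prod.map_apply, List.cons.injEq, Prod.mk.injEq] at h
  obtain ⟨⟨-, hB⟩, ⟨hU, hV⟩, hT⟩ := h
  have hBc := Subgroup.mem_center_iff.1 (hπ hB) A
  have hTc : commProd T = 1 := by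
    refine commProd_eq_one_of_snd_mem_center fun p hp => hπ ?_
    have : Prod.map π π p ∈ List.replicate k ((1 : K), (1 : K)) := hT ▸ List.mem_map_of_mem hp
    exact congrArg Prod.snd (List.eq_of_mem_replicate this)
  apply huv U V hU hV
  simp only [commProd, List.map_cons, List.prod_cons] at h1 hTc
  rw [hTc, mul_one, hBc] at h1
  simp only [mul_inv_cancel_right, mul_inv_cancel, one_mul] at h1
  exact (mul_inv_eq_iff_eq_mul.1 (mul_inv_eq_one.1 h1))

end lifting

theorem exists_lift_iff_of_mem_orbit {g : ℕ} {G : Type} [Group G] {E K : Type*} [Group E] [Group K]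
    (π : E →* K) (ψ : G →* K) {ρ₁ ρ₂ : SurjHom g G} (h : ρ₁ ∈ MulAction.orbit (AutPlus g) ρ₂) :
    (∃ ρ' : SurfaceGroup g →* E, π.comp ρ' = ψ.comp ρ₁.1) ↔
      ∃ ρ' : SurfaceGroup g →* E, π.comp ρ' = ψ.comp ρ₂.1 := by
  have key : ∀ {ρ₁ ρ₂ : SurjHom g G}, ρ₁ ∈ MulAction.orbit (AutPlus g) ρ₂ →
      (∃ ρ' : SurfaceGroup g →* E, π.comp ρ' = ψ.comp ρ₂.1) →
      ∃ ρ' : SurfaceGroup g →* E, π.comp ρ' = ψ.comp ρ₁.1 := by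
    rintro _ ρ₂ ⟨σ, rfl⟩ ⟨ρ', h⟩
    exact ⟨ρ'.comp (σ⁻¹ : AutPlus g).1.toMonoidHom,
      MonoidHom.ext fun x => DFunLike.congr_fun h ((σ⁻¹ : AutPlus g).1 x)⟩
  exact ⟨key (MulAction.orbit_eq_iff.2 h ▸ MulAction.mem_orbit_self ρ₂), key h⟩

-- By Cayley–Hamilton, `W² = (tr W) W - 1`. If `W²` is scalar and `W` is not, the trace must vanish.
-- The proof carries this out on matrix entries.
open Matrix in
theorem SpecialLinearGroup.sq_eq_neg_one {F : Type*} [Field F] (W : SpecialLinearGroup (Fin 2) F)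
    (h1 : W ∉ Subgroup.center (SpecialLinearGroup (Fin 2) F))
    (h2 : W * W ∈ Subgroup.center (SpecialLinearGroup (Fin 2) F)) : W * W = -1 := by
  rw [Matrix.SpecialLinearGroup.mem_center_iff] at h1 h2
  obtain ⟨c, -, hc⟩ := h2
  have e := fun i j => congrFun (congrFun hc i) j
  have e00 := e 0 0
  have e01 := e 0 1
  have e10 := e 1 0
  have e11 := e 1 1
  have hd := W.det_coe
  rw [det_fin_two] at hd
  simp [Matrix.mul_apply, Fin.sum_univ_two] at e00 e01 e10 e11
  have ht : W.1 0 0 + W.1 1 1 = 0 := by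
    by_contra ht
    have h01 : W.1 0 1 = 0 := by
      have : W.1 0 1 * (W.1 0 0 + W.1 1 1) = 0 := by linear_combination -e01
      exact (mul_eq_zero.1 this).resolve_right ht
    have h10 : W.1 1 0 = 0 := by
      have : W.1 1 0 * (W.1 0 0 + W.1 1 1) = 0 := by linear_combination -e10
      exact (mul_eq_zero.1 this).resolve_right ht
    have hdiag : W.1 0 0 = W.1 1 1 := by
      have : (W.1 0 0 - W.1 1 1) * (W.1 0 0 + W.1 1 1) = 0 := by linear_combination e11 - e00
      exact sub_eq_zero.1 ((mul_eq_zero.1 this).resolve_right ht)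
    refine h1 ⟨W.1 0 0, ?_, ?_⟩
    · rw [h01, ← hdiag] at hd
      simp [sq]
      linear_combination hd
    · ext i j
      fin_cases i <;> fin_cases j <;> simp [h01, h10, hdiag]
  ext i j
  fin_cases i <;> fin_cases j <;> simp [Matrix.mul_apply, Fin.sum_univ_two]
  · linear_combination -hd + W.1 0 0 * ht
  · linear_combination W.1 0 1 * ht
  · linear_combination W.1 1 0 * ht
  · linear_combination -hd + W.1 1 1 * ht

open Matrix in
/-- Lifts to `SL₂` of two distinct commuting involutions of `PSL₂` do not commute. -/
theorem SpecialLinearGroup.lifts_not_commute {F : Type*} [Field F] [NeZero (2 : F)]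
    {u v : ProjectiveSpecialLinearGroup (Fin 2) F} (hu : u * u = 1) (hv : v * v = 1)
    (huv : u * v = v * u) (hu1 : u ≠ 1) (hv1 : v ≠ 1) (hne : u ≠ v)
    (U V : SpecialLinearGroup (Fin 2) F) (hU : QuotientGroup.mk' (Subgroup.center _) U = u)
    (hV : QuotientGroup.mk' (Subgroup.center _) V = v) : U * V ≠ V * U := by
  intro hc
  have key : ∀ W : SpecialLinearGroup (Fin 2) F,
      QuotientGroup.mk' (Subgroup.center (SpecialLinearGroup (Fin 2) F)) W ≠ 1 →
      QuotientGroup.mk' (Subgroup.center (SpecialLinearGroup (Fin 2) F)) W *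
        QuotientGroup.mk' (Subgroup.center (SpecialLinearGroup (Fin 2) F)) W = 1 →
      W * W = -1 := by
    intro W h1 h2
    refine sq_eq_neg_one W (fun h => h1 ((QuotientGroup.eq_one_iff W).2 h)) ?_
    exact (QuotientGroup.eq_one_iff (W * W)).1 (by rw [← h2]; rfl)
  have hU2 := key U (hU ▸ hu1) (by rw [hU]; exact hu)
  have hV2 := key V (hV ▸ hv1) (by rw [hV]; exact hv)
  -- The product `u * v` is again a nontrivial involution, so `(U * V)² = -1`. If `U` and `V`
  -- commuted, this square would be `(-1) * (-1) = 1`.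
  have hUV := key (U * V)
    (by
      rw [map_mul, hU, hV]
      intro h
      exact hne ((eq_inv_of_mul_eq_one_left h).trans (eq_inv_of_mul_eq_one_left hv).symm))
    (by
      rw [map_mul, hU, hV]
      calc u * v * (u * v) = u * u * (v * v) := by
            rw [mul_assoc, ← mul_assoc v, ← huv]; simp only [mul_assoc]
        _ = 1 := by rw [hu, hv, mul_one])
  have h1 : U * V * (U * V) = U * U * (V * V) := by
    rw [mul_assoc, ← mul_assoc V, ← hc]; simp only [mul_assoc]
  rw [h1, hU2, hV2] at hUV
  have h2 := congrFun (congrFun (congrArg Subtype.val hUV) 0) 0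
  simp at h2
  have : (2 : F) = 0 := by linear_combination h2
  exact NeZero.ne _ this

/-! ### From normal forms to orbits -/

/-- Equivalence of lists of handles up to simultaneous conjugation. -/
def ConjEquiv {G : Type*} [Group G] (L L' : List (G × G)) : Prop :=
  ∃ c : G, L ∼ₕ L'.map (Prod.map (MulAut.conj c) (MulAut.conj c))

infix:50 " ∼ᶜ " => ConjEquiv

theorem handleClosure_map {G H : Type*} [Group G] [Group H] (f : G →* H) (L : List (G × G)) :
    handleClosure (L.map (Prod.map f f)) = (handleClosure L).map f := by
  rw [handleClosure, handleClosure, MonoidHom.map_closure]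
  congr 1
  ext x
  simp only [List.mem_map, Set.mem_ofPred_eq, Set.mem_image]
  constructor
  · rintro ⟨_, ⟨p, hp, rfl⟩, rfl | rfl⟩
    · exact ⟨p.1, ⟨p, hp, Or.inl rfl⟩, rfl⟩
    · exact ⟨p.2, ⟨p, hp, Or.inr rfl⟩, rfl⟩
  · rintro ⟨_, ⟨p, hp, rfl | rfl⟩, rfl⟩
    · exact ⟨_, ⟨p, hp, rfl⟩, Or.inl rfl⟩
    · exact ⟨_, ⟨p, hp, rfl⟩, Or.inr rfl⟩

theorem mem_orbit_of_conjEquiv {g : ℕ} {G : Type} [Group G] {ρ ρ' : SurjHom g G}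
    (h : handles ρ.1 ∼ᶜ handles ρ'.1) : ρ ∈ MulAction.orbit (AutPlus g) ρ' := by
  obtain ⟨c, w, hw⟩ := h
  let ρ'' : SurjHom g G := ⟨(MulAut.conj c).toMonoidHom.comp ρ'.1,
    (MulAut.conj c).surjective.comp ρ'.2⟩
  have h1 : handles ρ''.1 = (handles ρ'.1).map (Prod.map (MulAut.conj c) (MulAut.conj c)) :=
    handles_comp _ _
  have h2 : ρ'' ∈ MulAction.orbit (AutPlus g) ρ' := mem_orbit_of_conj c h1
  have h3 : ρ'' ∈ MulAction.orbit (AutPlus g) ρ := mem_orbit_of_runMoves w (by rw [h1, hw])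
  rw [← MulAction.orbit_eq_iff] at h2 h3
  rw [← h2, h3]
  exact MulAction.mem_orbit_self ρ

theorem exists_surjHom {g : ℕ} {G : Type} [Group G] (L : List (G × G)) (hL : L.length = g)
    (h1 : commProd L = 1) (hcl : handleClosure L = ⊤) : ∃ ρ : SurjHom g G, handles ρ.1 = L := by
  obtain ⟨ρ, hρ⟩ := exists_hom_of_handles L hL h1
  refine ⟨⟨ρ, ?_⟩, hρ⟩
  rw [← MonoidHom.range_eq_top, ← handleClosure_handles, hρ, hcl]

theorem handleClosure_handles_surjHom {g : ℕ} {G : Type} [Group G] (ρ : SurjHom g G) :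
    handleClosure (handles ρ.1) = ⊤ := by
  rw [handleClosure_handles, MonoidHom.range_eq_top]
  exact ρ.2

theorem actsTransitively_of_normalForm {g : ℕ} {G : Type} [Group G] (L₁ : List (G × G))
    (hL₁ : L₁.length = g) (hprod : commProd L₁ = 1) (hcl : handleClosure L₁ = ⊤)
    (hred : ∀ L : List (G × G), L.length = g → commProd L = 1 → handleClosure L = ⊤ →
      L ∼ᶜ L₁) : ActsTransitively g G := by
  obtain ⟨ρ₁, h₁⟩ := exists_surjHom L₁ hL₁ hprod hcl
  have key : ∀ ρ : SurjHom g G, ρ ∈ MulAction.orbit (AutPlus g) ρ₁ := fun ρ =>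
    mem_orbit_of_conjEquiv (h₁ ▸ hred _ (length_handles _) (commProd_handles _)
      (handleClosure_handles_surjHom ρ))
  refine ⟨⟨ρ₁⟩, ⟨fun ρ ρ' => ?_⟩⟩
  have h := MulAction.orbit_eq_iff.2 (key ρ)
  exact (h ▸ key ρ' : ρ' ∈ MulAction.orbit (AutPlus g) ρ)

/-- The handles of a homomorphism that factors through a free group on two generators. -/
def freeForm {G : Type*} [Group G] (g : ℕ) (x y : G) : List (G × G) :=
  (x, 1) :: (y, 1) :: List.replicate (g - 2) (1, 1)

/-- The handles `(a, 1), (u, v), (1, 1), …`. -/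
def kleinForm {G : Type*} [Group G] (g : ℕ) (a u v : G) : List (G × G) :=
  (a, 1) :: (u, v) :: List.replicate (g - 2) (1, 1)

/-- `ψ : G → K` and a central extension `π : E → K` in which the lifts of `u` and `v` do not
commute. -/
def HasNoncommutingLifts {G : Type} [Group G] (u v : G) : Prop :=
  ∃ (E K : Type) (_ : Group E) (_ : Group K) (π : E →* K) (ψ : G →* K), Function.Surjective π ∧
    π.ker ≤ Subgroup.center E ∧ ∀ U V, π U = ψ u → π V = ψ v → U * V ≠ V * U

/-- The reduction gives at most two orbits, and a lifting obstruction tells them apart. The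
obstruction is used twice: with `hspin` to prove that there are two orbits, since no embedding `ι`
is at hand there, and with `SL₂(ℂ)` for the criterion once `ι` is given. -/
theorem hasTwoOrbitsByLifting_of_normalForms {g : ℕ} (hg : 2 ≤ g) {G : Type} [Group G]
    (x y a u v : G) (hu : u * u = 1) (hv : v * v = 1) (huv : u * v = v * u) (hu1 : u ≠ 1)
    (hv1 : v ≠ 1) (hne : u ≠ v) (hfree : handleClosure (freeForm g x y) = ⊤)
    (hklein : handleClosure (kleinForm g a u v) = ⊤)
    (hred : ∀ L : List (G × G), L.length = g → commProd L = 1 → handleClosure L = ⊤ →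
      L ∼ᶜ freeForm g x y ∨ L ∼ᶜ kleinForm g a u v)
    (hspin : HasNoncommutingLifts u v) : HasTwoOrbitsByLifting g G := by
  have hlen : g - 2 + 1 + 1 = g := by omega
  obtain ⟨ρ₁, h₁⟩ := exists_surjHom (g := g) (freeForm g x y) (by simp [freeForm, hlen])
    (commProd_eq_one_of_snd_mem_center (by
      intro p hp
      simp only [freeForm, List.mem_cons, List.mem_replicate] at hp
      rcases hp with rfl | rfl | ⟨-, rfl⟩ <;> exact one_mem _)) hfree
  obtain ⟨ρ₂, h₂⟩ := exists_surjHom (g := g) (kleinForm g a u v) (by simp [kleinForm, hlen])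
    (by simp [kleinForm, commProd, huv]) hklein
  have cover : ∀ ρ : SurjHom g G, ρ ∈ MulAction.orbit (AutPlus g) ρ₁ ∨
      ρ ∈ MulAction.orbit (AutPlus g) ρ₂ := fun ρ =>
    (hred _ (length_handles _) (commProd_handles _) (handleClosure_handles_surjHom ρ)).imp
      (fun h => mem_orbit_of_conjEquiv (h₁ ▸ h)) (fun h => mem_orbit_of_conjEquiv (h₂ ▸ h))
  have lift₁ : ∀ {E K : Type} [Group E] [Group K] (π : E →* K) (ψ : G →* K),
      Function.Surjective π → ∃ ρ' : SurfaceGroup g →* E, π.comp ρ' = ψ.comp ρ₁.1 := by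
    intro E K _ _ π ψ hπ
    refine exists_lift_of_snd_eq_one hπ _ fun p hp => ?_
    rw [handles_comp, h₁] at hp
    simp only [freeForm, List.map_cons, List.map_replicate, Prod.map_apply, map_one, List.mem_cons,
      List.mem_replicate] at hp
    rcases hp with rfl | rfl | ⟨-, rfl⟩ <;> rfl
  have lift₂ : ∀ {E K : Type} [Group E] [Group K] (π : E →* K) (ψ : G →* K),
      π.ker ≤ Subgroup.center E → (∀ U V, π U = ψ u → π V = ψ v → U * V ≠ V * U) →
      ¬ ∃ ρ' : SurfaceGroup g →* E, π.comp ρ' = ψ.comp ρ₂.1 := by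
    intro E K _ _ π ψ hπ hUV
    refine not_exists_lift (a := ψ a) (u := ψ u) (v := ψ v) (k := g - 2) hπ _ ?_ hUV
    rw [handles_comp, h₂]
    simp [kleinForm]
  refine ⟨?_, fun ι hι ρ ρ' => ⟨fun h => exists_lift_iff_of_mem_orbit _ ι h, fun h => ?_⟩⟩
  · rw [Nat.card_eq_two_iff]
    refine ⟨Quotient.mk'' ρ₁, Quotient.mk'' ρ₂, fun h => ?_, ?_⟩
    · obtain ⟨E, K, _, _, π, ψ, hs, hker, hUV⟩ := hspin
      have h' : ρ₁ ∈ MulAction.orbit (AutPlus g) ρ₂ := Quotient.exact h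
      exact lift₂ π ψ hker hUV ((exists_lift_iff_of_mem_orbit π ψ h').1 (lift₁ π ψ hs))
    · refine Set.eq_univ_of_forall fun q => ?_
      induction q using Quotient.inductionOn' with
      | h ρ => exact (cover ρ).imp (fun h => Quotient.sound h) (fun h => Quotient.sound h)
  · have l₁ := lift₁ (QuotientGroup.mk' (Subgroup.center
      (Matrix.SpecialLinearGroup (Fin 2) ℂ))) ι (QuotientGroup.mk'_surjective _)
    have l₂ := lift₂ (QuotientGroup.mk' (Subgroup.center
      (Matrix.SpecialLinearGroup (Fin 2) ℂ))) ι (by rw [QuotientGroup.ker_mk'])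
      (SpecialLinearGroup.lifts_not_commute (by rw [← map_mul, hu, map_one])
        (by rw [← map_mul, hv, map_one]) (by rw [← map_mul, huv, map_mul])
        (fun h => hu1 (hι (h.trans (map_one ι).symm)))
        (fun h => hv1 (hι (h.trans (map_one ι).symm))) (fun h => hne (hι h)))
    have e₁ : ∀ {ρ : SurjHom g G}, ρ ∈ MulAction.orbit (AutPlus g) ρ₁ → LiftsToSL (ι.comp ρ.1) :=
      fun h => (exists_lift_iff_of_mem_orbit _ ι h).2 l₁
    have e₂ : ∀ {ρ : SurjHom g G}, ρ ∈ MulAction.orbit (AutPlus g) ρ₂ →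
        ¬ LiftsToSL (ι.comp ρ.1) :=
      fun h h' => l₂ ((exists_lift_iff_of_mem_orbit _ ι h).1 h')
    rcases cover ρ with c | c <;> rcases cover ρ' with c' | c'
    · rw [← MulAction.orbit_eq_iff] at c'
      rwa [c']
    · exact absurd (h.1 (e₁ c)) (e₂ c')
    · exact absurd (h.2 (e₁ c')) (e₂ c)
    · rw [← MulAction.orbit_eq_iff] at c'
      rwa [c']

/-! ### Cyclic groups -/

namespace HandleEquiv

variable {G : Type*} [Group G]

theorem conjEquiv {L L' : List (G × G)} (h : L ∼ₕ L') : L ∼ᶜ L' :=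
  ⟨1, by simpa using h⟩

/-- The Euclidean algorithm is used twice: inside a handle, and then between the first entries of
two handles with trivial second entry. -/
theorem cyclic_list (t : G) (h : G × G) (L : List (G × G))
    (hh : ∀ p ∈ h :: L, p.1 ∈ Submonoid.powers t ∧ p.2 ∈ Submonoid.powers t) :
    ∃ d : ℕ, h :: L ∼ₕ (t ^ d, 1) :: List.replicate L.length (1, 1) := by
  have one : ∀ (p : G × G) (T : List (G × G)), p.1 ∈ Submonoid.powers t →
      p.2 ∈ Submonoid.powers t → ∃ d : ℕ, p :: T ∼ₕ (t ^ d, 1) :: T := by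
    rintro ⟨_, _⟩ T ⟨i, rfl⟩ ⟨j, rfl⟩
    exact exists_pow_one t i j T
  induction L generalizing h with
  | nil =>
    exact one h [] (hh h (by simp)).1 (hh h (by simp)).2
  | cons q L ih =>
    obtain ⟨d, hd⟩ := ih q fun p hp => hh p (List.mem_cons_of_mem _ hp)
    obtain ⟨e, he⟩ := one h (q :: L) (hh h (by simp)).1 (hh h (by simp)).2
    obtain ⟨f, hf⟩ := exists_pow_one_pair t e d (List.replicate L.length (1, 1))
    exact ⟨f, he.trans ((hd.cons _).trans hf)⟩

end HandleEquiv

theorem mem_powers_ofAdd_one {n : ℕ} [NeZero n] (x : Multiplicative (ZMod n)) :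
    x ∈ Submonoid.powers (Multiplicative.ofAdd (1 : ZMod n)) := by
  refine ⟨(Multiplicative.toAdd x).val, ?_⟩
  change Multiplicative.ofAdd (1 : ZMod n) ^ (Multiplicative.toAdd x).val = x
  rw [← ofAdd_nsmul, nsmul_one, ZMod.natCast_zmod_val, ofAdd_toAdd]

theorem actsTransitively_zmod {g : ℕ} (hg : 1 ≤ g) (n : ℕ) (hn : 1 ≤ n) :
    ActsTransitively g (Multiplicative (ZMod n)) := by
  have : NeZero n := ⟨by omega⟩
  set t : Multiplicative (ZMod n) := Multiplicative.ofAdd 1 with ht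
  have hcl : ∀ x ∈ Submonoid.powers t, ∀ L : List (Multiplicative (ZMod n) × Multiplicative (ZMod n)),
      t ∈ handleClosure L → x ∈ handleClosure L := by
    rintro _ ⟨k, rfl⟩ L h
    exact pow_mem h k
  have htop : ∀ L : List (Multiplicative (ZMod n) × Multiplicative (ZMod n)),
      t ∈ handleClosure L → handleClosure L = ⊤ := fun L h =>
    eq_top_iff.2 fun x _ => hcl x (mem_powers_ofAdd_one x) L h
  refine actsTransitively_of_normalForm ((t, 1) :: List.replicate (g - 1) (1, 1)) (by simp; omega)
    (by simp [commProd]) (htop _ (Subgroup.subset_closure ⟨(t, 1), by simp, Or.inl rfl⟩)) ?_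
  rintro (_ | ⟨h, L⟩) hL - hgen
  · simp at hL; omega
  obtain ⟨d, hd⟩ := HandleEquiv.cyclic_list t h L
    fun p _ => ⟨mem_powers_ofAdd_one _, mem_powers_ofAdd_one _⟩
  have hlen : L.length = g - 1 := by simp at hL; omega
  rw [hlen] at hd
  have hmem : t ∈ Subgroup.zpowers (t ^ d) := by
    have h1 : t ∈ handleClosure ((t ^ d, 1) :: List.replicate (g - 1) (1, 1)) := by
      rw [hd.handleClosure_eq, hgen]; trivial
    refine (Subgroup.closure_le _).2 ?_ h1
    rintro x ⟨p, hp, hx⟩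
    simp only [List.mem_cons, List.mem_replicate] at hp
    rcases hp with rfl | ⟨-, rfl⟩ <;> rcases hx with rfl | rfl
    · exact Subgroup.mem_zpowers _
    all_goals exact one_mem _
  obtain ⟨m, hm⟩ := mem_powers_iff_mem_zpowers.2 hmem
  exact HandleEquiv.conjEquiv (hd.trans (HandleEquiv.generator_handle t hm _))

/-! ### Dihedral groups -/

namespace DihedralGroup

variable {n : ℕ}

theorem r_mem_powers [NeZero n] (i : ZMod n) : (r i : DihedralGroup n) ∈ Submonoid.powers (r 1) :=
  ⟨i.val, by simp⟩

/-- One of `a`, `b`, `b * a` is a rotation, and twists can put it in second place. -/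
theorem exists_rotation_snd (a b : DihedralGroup n) (T : List (DihedralGroup n × DihedralGroup n)) :
    ∃ x i, (a, b) :: T ∼ₕ (x, r i) :: T := by
  rcases b with j | j
  · exact ⟨a, j, HandleEquiv.refl _⟩
  rcases a with i | i
  · exact ⟨_, _, by simpa using HandleEquiv.rotate (r i) (sr j) T⟩
  · exact ⟨_, _, by simpa using HandleEquiv.twistA (sr i) (sr j) T⟩

/-- A quarter turn puts the reflection of the first handle in second place, so the multiplier `z` of
the mixing twist becomes a reflection. Then `z * sr q` is a rotation, and the final twist multiplies
two reflections to a rotation. -/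
theorem merge_reflections (p q i j : ZMod n) (T : List (DihedralGroup n × DihedralGroup n)) :
    ∃ x k l, (sr p, r j) :: (sr q, r i) :: T ∼ₕ (x, r k) :: (r l, r i) :: T := by
  have h := HandleEquiv.of_run [(0, .B), (0, .A'), (0, .B), (0, .Z), (0, .A)]
    ((sr p, r j) :: (sr q, r i) :: T)
  simp only [runMoves, List.foldl, HandleMove.actAt, HandleMove.act, inv_sr, r_mul_sr,
    sr_mul_r, sr_mul_sr] at h
  exact ⟨_, _, _, h⟩

theorem exists_one_reflection [NeZero n] (h : DihedralGroup n × DihedralGroup n)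
    (L : List (DihedralGroup n × DihedralGroup n)) :
    ∃ x i R, h :: L ∼ₕ (x, r i) :: R ∧ R.length = L.length ∧
      ∀ p ∈ R, p.1 ∈ Submonoid.powers (r 1) ∧ p.2 ∈ Submonoid.powers (r 1) := by
  induction L generalizing h with
  | nil =>
    obtain ⟨x, i, hx⟩ := exists_rotation_snd h.1 h.2 []
    exact ⟨x, i, [], hx, rfl, by simp⟩
  | cons q L ih =>
    obtain ⟨x, i, R, hR, hlen, hmem⟩ := ih q
    obtain ⟨y, j, hy⟩ := exists_rotation_snd h.1 h.2 ((x, r i) :: R)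
    have e := (hR.cons h).trans hy
    have hcons : ∀ k l : ZMod n, ∀ p ∈ ((r k, r l) : DihedralGroup n × DihedralGroup n) :: R,
        p.1 ∈ Submonoid.powers (r 1) ∧ p.2 ∈ Submonoid.powers (r 1) := by
      intro k l p hp
      rcases List.mem_cons.1 hp with rfl | hp
      · exact ⟨r_mem_powers _, r_mem_powers _⟩
      · exact hmem p hp
    rcases x with k | k
    · exact ⟨y, j, _, e, by simp [hlen], hcons k i⟩
    rcases y with l | l
    · exact ⟨_, _, _, e.trans (HandleEquiv.swap_of_comm (by simp [add_comm]) _ _),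
        by simp [hlen], hcons l j⟩
    · obtain ⟨x, a, b, hm⟩ := merge_reflections l k i j R
      exact ⟨_, _, _, e.trans hm, by simp [hlen], hcons b i⟩

/-- The subgroup generated by the rotations in `A` and the reflections in `p + A`. -/
def ofAddSubgroup (A : AddSubgroup (ZMod n)) (p : ZMod n) : Subgroup (DihedralGroup n) where
  carrier := {x | match x with
    | r z => z ∈ A
    | sr z => z - p ∈ A}
  one_mem' := A.zero_mem
  mul_mem' := by
    rintro (a | a) (b | b) ha hb
    · exact A.add_mem ha hb
    · change b - a - p ∈ A
      have := A.sub_mem hb ha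
      rwa [sub_right_comm] at this
    · change a + b - p ∈ A
      have := A.add_mem ha hb
      rwa [sub_add_eq_add_sub] at this
    · change b - a ∈ A
      have := A.sub_mem hb ha
      rwa [sub_sub_sub_cancel_right] at this
  inv_mem' := by
    rintro (a | a) ha
    · exact A.neg_mem ha
    · exact ha

theorem sr_mem_ofAddSubgroup {A : AddSubgroup (ZMod n)} {p z : ZMod n} :
    sr z ∈ ofAddSubgroup A p ↔ z - p ∈ A := Iff.rfl

/-- Once all other entries are rotations, the Euclidean algorithm collects them in one power of `r
1`. Generation forces the exceptional entry to be a reflection, and the relation then reads `[sr p,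
r i] = 1`. -/
theorem exists_normalForm [NeZero n] {g : ℕ} (hg : 2 ≤ g)
    (L : List (DihedralGroup n × DihedralGroup n)) (hL : L.length = g) (hprod : commProd L = 1)
    (hgen : handleClosure L = ⊤) :
    ∃ (p i : ZMod n) (k : ℕ), i + i = 0 ∧ 1 ∈ AddSubgroup.closure {i, (k : ZMod n)} ∧
      L ∼ₕ (sr p, r i) :: (r 1 ^ k, 1) :: List.replicate (g - 2) (1, 1) := by
  rcases L with _ | ⟨h, L⟩
  · simp at hL; omega
  obtain ⟨x, i, R, hR, hlen, hmem⟩ := exists_one_reflection h L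
  rcases R with _ | ⟨q, R⟩
  · simp at hlen hL; omega
  obtain ⟨k, hk⟩ := HandleEquiv.cyclic_list (r 1) q R hmem
  have hlenR : R.length = g - 2 := by simp at hlen hL; omega
  rw [hlenR] at hk
  have e := hR.trans (hk.cons _)
  have htop := e.handleClosure_eq.trans hgen
  -- A subgroup `ofAddSubgroup A p` that contains the entries is everything. With `A` generated by
  -- `i` and `k`, membership of `r 1` says that `1 ∈ A`.
  have sub : ∀ (A : AddSubgroup (ZMod n)) (p : ZMod n), i ∈ A → (k : ZMod n) ∈ A →
      x ∈ ofAddSubgroup A p → ∀ y, y ∈ ofAddSubgroup A p := by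
    intro A p hi hk' hx y
    have hy : y ∈ handleClosure ((x, r i) :: (r 1 ^ k, 1) :: List.replicate (g - 2) (1, 1)) := by
      rw [htop]; trivial
    refine (Subgroup.closure_le _).2 ?_ hy
    rintro z ⟨p, hp, hz⟩
    simp only [List.mem_cons, List.mem_replicate] at hp
    rcases hp with rfl | rfl | ⟨-, rfl⟩ <;> rcases hz with rfl | rfl
    · exact hx
    · exact hi
    · rw [r_one_pow]; exact hk'
    all_goals exact one_mem _
  rcases x with l | p
  · exfalso
    let A : Subgroup (DihedralGroup n) :=
      { carrier := {x | ∃ z, x = r z}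
        one_mem' := ⟨0, rfl⟩
        mul_mem' := by rintro _ _ ⟨a, rfl⟩ ⟨b, rfl⟩; exact ⟨a + b, rfl⟩
        inv_mem' := by rintro _ ⟨a, rfl⟩; exact ⟨-a, rfl⟩ }
    have hy : (sr 0 : DihedralGroup n) ∈
        handleClosure ((r l, r i) :: (r 1 ^ k, 1) :: List.replicate (g - 2) (1, 1)) := by
      rw [htop]; trivial
    have : (sr 0 : DihedralGroup n) ∈ A := by
      refine (Subgroup.closure_le _).2 ?_ hy
      rintro z ⟨p, hp, hz⟩
      simp only [List.mem_cons, List.mem_replicate] at hp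
      rcases hp with rfl | rfl | ⟨-, rfl⟩ <;> rcases hz with rfl | rfl
      · exact ⟨_, rfl⟩
      · exact ⟨_, rfl⟩
      · exact ⟨_, r_one_pow k⟩
      all_goals exact ⟨0, rfl⟩
    obtain ⟨z, hz⟩ := this
    cases hz
  · refine ⟨p, i, k, ?_, ?_, e⟩
    · have h1 := e.commProd_eq.trans hprod
      simp only [commProd, List.map_cons, List.map_replicate, List.prod_cons, List.prod_replicate,
        inv_one, mul_one, mul_inv_cancel, one_pow, inv_r, inv_sr, sr_mul_r, sr_mul_sr, r_mul_r] at h1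
      rw [one_def, r.injEq] at h1
      linear_combination -h1
    · exact sub _ p (AddSubgroup.subset_closure (by simp)) (AddSubgroup.subset_closure (by simp))
        (sr_mem_ofAddSubgroup.2 (by rw [sub_self]; exact zero_mem _)) (r 1)

theorem generator_handle [NeZero n] {k : ℕ} {z : ZMod n} (h : (k : ZMod n) * z = 1)
    (T : List (DihedralGroup n × DihedralGroup n)) :
    ((r 1 : DihedralGroup n) ^ k, 1) :: T ∼ₕ (r 1, 1) :: T := by
  refine HandleEquiv.generator_handle (r 1) (m := z.val) ?_ T
  simp [h]

theorem equiv_freeForm [NeZero n] {g : ℕ} (p : ZMod n) (k : ℕ)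
    (h : 1 ∈ AddSubgroup.closure {0, (k : ZMod n)}) :
    (sr p, r 0) :: ((r 1 : DihedralGroup n) ^ k, 1) :: List.replicate (g - 2) (1, 1) ∼ₕ
      freeForm g (sr 0) (r 1) := by
  obtain ⟨a, b, hab⟩ := AddSubgroup.mem_closure_pair.1 h
  have hb : (k : ZMod n) * (b : ZMod n) = 1 := by
    rw [← hab]; simp [mul_comm]
  refine ((generator_handle hb _).cons _).trans ?_
  have hmem : (r (-p) : DihedralGroup n) ∈
      handleClosure ((r 1, 1) :: List.replicate (g - 2) (1, 1)) := by
    have : (r 1 : DihedralGroup n) ∈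
        handleClosure ((r 1, 1) :: List.replicate (g - 2) (1, 1)) :=
      Subgroup.subset_closure ⟨(r 1, 1), by simp, Or.inl rfl⟩
    obtain ⟨m, hm⟩ := r_mem_powers (-p)
    rw [← hm]
    exact pow_mem this m
  simpa [freeForm] using HandleEquiv.slide (sr p) hmem

theorem eq_top_of_mem [NeZero n] {K : Subgroup (DihedralGroup n)} (hs : sr 0 ∈ K) (hr : r 1 ∈ K) :
    K = ⊤ := by
  have h : ∀ i, r i ∈ K := fun i => by
    obtain ⟨m, hm⟩ := r_mem_powers i
    rw [← hm]
    exact pow_mem hr m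
  refine eq_top_iff.2 ?_
  rintro (i | i) -
  · exact h i
  · simpa using K.mul_mem hs (h i)

theorem handleClosure_freeForm [NeZero n] (g : ℕ) :
    handleClosure (freeForm g (sr 0 : DihedralGroup n) (r 1)) = ⊤ :=
  eq_top_of_mem (Subgroup.subset_closure ⟨(sr 0, 1), by simp [freeForm], Or.inl rfl⟩)
    (Subgroup.subset_closure ⟨(r 1, 1), by simp [freeForm], Or.inl rfl⟩)

theorem actsTransitively {g : ℕ} (hg : 2 ≤ g) (hn : Odd n) :
    ActsTransitively g (DihedralGroup n) := by
  have : NeZero n := ⟨hn.pos.ne'⟩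
  refine actsTransitively_of_normalForm (freeForm g (sr 0) (r 1)) (by simp [freeForm]; omega)
    (by simp [freeForm, commProd]) (handleClosure_freeForm g) fun L hL hprod hgen => ?_
  obtain ⟨p, i, k, hi, h1, e⟩ := exists_normalForm hg L hL hprod hgen
  obtain rfl : i = 0 := by
    obtain ⟨m, hm⟩ := hn
    have h0 : ((2 * m + 1 : ℕ) : ZMod n) = 0 := by rw [← hm]; exact ZMod.natCast_self n
    push_cast at h0
    -- Indeed `i = (2 * m + 1) * i - m * (i + i)`.
    linear_combination i * h0 - m * hi
  exact HandleEquiv.conjEquiv (e.trans (equiv_freeForm p k h1))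

/-- The generalised quaternion group is a central double cover. A lift `a j` of the central rotation
satisfies `j ≡ m` modulo `2 * m`, and commuting with a lift of a reflection would require `2 * j =
0` modulo `4 * m`, whereas `2 * j = 2 * m` there. -/
theorem quaternion_noncommuting {m : ℕ} (hm : 0 < m) :
    HasNoncommutingLifts (sr 0 : DihedralGroup (2 * m)) (r (m : ZMod (2 * m))) := by
  have : NeZero (2 * (2 * m)) := ⟨by omega⟩
  let c : ZMod (2 * (2 * m)) →+* ZMod (2 * m) := ZMod.castHom (Dvd.intro_left 2 rfl) _
  have hc : ∀ i, c i = 0 → i + i = 0 := by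
    intro i hi
    obtain ⟨k, rfl⟩ := ZMod.natCast_zmod_surjective i
    rw [map_natCast, ZMod.natCast_eq_zero_iff] at hi
    rw [← Nat.cast_add, ZMod.natCast_eq_zero_iff]
    obtain ⟨l, rfl⟩ := hi
    exact ⟨l, by ring⟩
  let π : QuaternionGroup (2 * m) →* DihedralGroup (2 * m) :=
    { toFun := fun x => match x with
        | .a i => r (c i)
        | .xa i => sr (c i)
      map_one' := congrArg r (map_zero c)
      map_mul' := by
        rintro (i | i) (j | j)
        · simp
        · simp
        · simp
        · have h : ((2 * m : ℕ) : ZMod (2 * m)) = 0 := ZMod.natCast_self _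
          simp only [QuaternionGroup.xa_mul_xa, sr_mul_sr, map_sub, map_add, map_natCast, h,
            zero_add] }
  refine ⟨QuaternionGroup (2 * m), DihedralGroup (2 * m), inferInstance, inferInstance, π,
    MonoidHom.id _, ?_, ?_, ?_⟩
  · rintro (i | i) <;> obtain ⟨j, rfl⟩ := ZMod.castHom_surjective (Dvd.intro_left 2 rfl :
      2 * m ∣ 2 * (2 * m)) i
    · exact ⟨.a j, rfl⟩
    · exact ⟨.xa j, rfl⟩
  · rintro (i | i) hi
    · have h0 : c i = 0 := by
        have : r (c i) = (1 : DihedralGroup (2 * m)) := hi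
        rwa [one_def, r.injEq] at this
      have h2 := hc i h0
      refine Subgroup.mem_center_iff.2 ?_
      rintro (j | j)
      · simp [add_comm]
      · simp only [QuaternionGroup.xa_mul_a, QuaternionGroup.a_mul_xa, QuaternionGroup.xa.injEq]
        linear_combination h2
    · have : sr (c i) = (1 : DihedralGroup (2 * m)) := hi
      rw [one_def] at this
      cases this
  · rintro (i | i) (j | j) hU hV hcomm
    · exact absurd (hU : r (c i) = sr 0) (by simp)
    · exact absurd (hU : r (c i) = sr 0) (by simp)
    · have h1 : c j = m := by
        have : (r (c j) : DihedralGroup (2 * m)) = r m := hV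
        rwa [r.injEq] at this
      simp only [QuaternionGroup.xa_mul_a, QuaternionGroup.a_mul_xa, QuaternionGroup.xa.injEq]
        at hcomm
      have h2 : j + j = 0 := by linear_combination hcomm
      have h3 := hc (j - m) (by rw [map_sub, h1, map_natCast, sub_self])
      have h4 : ((m + m : ℕ) : ZMod (2 * (2 * m))) = 0 := by
        push_cast
        linear_combination h2 - h3
      rw [ZMod.natCast_eq_zero_iff] at h4
      have := Nat.le_of_dvd (by omega) h4
      omega
    · exact absurd (hV : sr (c j) = r (m : ZMod (2 * m))) (by simp)

theorem exists_coprime_shift {m k : ℕ} (h : Nat.Coprime k m) :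
    Nat.Coprime k (2 * m) ∨ Nat.Coprime (k + m) (2 * m) := by
  rcases Nat.even_or_odd k with hk | hk
  · right
    have hm : Odd m := by
      rw [← Nat.not_even_iff_odd]
      intro hm
      have h2 := Nat.dvd_gcd hk.two_dvd hm.two_dvd
      rw [h] at h2
      omega
    exact Nat.Coprime.mul_right (Nat.coprime_two_right.2 (hk.add_odd hm)) (by simpa using h)
  · exact Or.inl (Nat.Coprime.mul_right (Nat.coprime_two_right.2 hk) h)

/-- The exponent `k` is only known to be prime to `m`. Sliding over the entry `r m` replaces it by
`k + m` if necessary, which makes it invertible modulo `2 * m`. The handle containing `sr p` has a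
nontrivial second entry and cannot slide, so `p` is lowered by one at a time with mixing twists. -/
theorem equiv_kleinForm {m : ℕ} (hm : 0 < m) {g : ℕ} (p : ZMod (2 * m)) (k : ℕ)
    (h : 1 ∈ AddSubgroup.closure {(m : ZMod (2 * m)), (k : ZMod (2 * m))}) :
    (sr p, r (m : ZMod (2 * m))) :: ((r 1 : DihedralGroup (2 * m)) ^ k, 1) ::
      List.replicate (g - 2) (1, 1) ∼ₕ kleinForm g (r 1) (sr 0) (r (m : ZMod (2 * m))) := by
  have : NeZero (2 * m) := ⟨by omega⟩
  set T : List (DihedralGroup (2 * m) × DihedralGroup (2 * m)) := List.replicate (g - 2) (1, 1)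
  have hcop : Nat.Coprime k m := by
    obtain ⟨a, b, hab⟩ := AddSubgroup.mem_closure_pair.1 h
    have h1 : ((a * m + b * k - 1 : ℤ) : ZMod (2 * m)) = 0 := by
      push_cast
      rw [sub_eq_zero, ← hab]
      simp
    rw [ZMod.intCast_zmod_eq_zero_iff_dvd] at h1
    obtain ⟨c, hc⟩ := h1
    rw [← Nat.isCoprime_iff_coprime]
    refine ⟨b, a - 2 * c, ?_⟩
    push_cast at hc
    linear_combination hc
  have step : ∃ k', Nat.Coprime k' (2 * m) ∧
      (sr p, r (m : ZMod (2 * m))) :: ((r 1 : DihedralGroup (2 * m)) ^ k, 1) :: T ∼ₕ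
        ((r 1 : DihedralGroup (2 * m)) ^ k', 1) :: (sr p, r (m : ZMod (2 * m))) :: T := by
    rcases exists_coprime_shift hcop with h' | h'
    · exact ⟨k, h', (HandleEquiv.swap _ _ _).symm⟩
    · refine ⟨k + m, h', (HandleEquiv.swap _ _ _).symm.trans ?_⟩
      have hmem : (r (m : ZMod (2 * m))) ∈ handleClosure ((sr p, r (m : ZMod (2 * m))) :: T) :=
        Subgroup.subset_closure ⟨(sr p, r m), by simp, Or.inr rfl⟩
      rw [pow_add, r_one_pow m]
      exact HandleEquiv.slide _ hmem
  obtain ⟨k', hk', e⟩ := step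
  have flip : ∀ q : ZMod (2 * m), ((r 1, 1) : DihedralGroup (2 * m) × _) ::
      (sr q, r (m : ZMod (2 * m))) :: T ∼ₕ (sr q, r (m : ZMod (2 * m))) :: (1, r 1) :: T :=
    fun q => (HandleEquiv.swap _ _ _).trans
      (((HandleEquiv.inv_left _ _).trans (HandleEquiv.one_left _ _).symm).cons _)
  -- Here `Z` has multiplier `r (1 - m)`. The twist `B'` cancels the `m` left in the first handle,
  -- and powers of the entry `r 1` clear the first entry of the second handle.
  have shift : ∀ q : ZMod (2 * m), (sr q, r (m : ZMod (2 * m))) :: (1, r 1) :: T ∼ₕ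
      (sr (q - 1), r (m : ZMod (2 * m))) :: (1, r 1) :: T := by
    intro q
    have e1 := HandleEquiv.of_run [(0, .Z), (0, .B')]
      ((sr q, r (m : ZMod (2 * m))) :: (1, r 1) :: T)
    simp only [runMoves, List.foldl, HandleMove.actAt, HandleMove.act, inv_r, inv_one, one_mul,
      mul_one, r_mul_r, sr_mul_r] at e1
    obtain ⟨l, hl⟩ := r_mem_powers (-(m : ZMod (2 * m)) + 1)
    rw [← hl] at e1
    have e2 := ((HandleEquiv.twistB_pow l 1 (r 1) T).symm.cons
      ((sr (q - 1), r (m : ZMod (2 * m))) : DihedralGroup (2 * m) × DihedralGroup (2 * m)))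
    rw [one_mul] at e2
    refine e1.trans ?_
    convert e2 using 4
    · ring
    · ring
  have shifts : ∀ j : ℕ, (sr (j : ZMod (2 * m)), r (m : ZMod (2 * m))) :: (1, r 1) :: T ∼ₕ
      (sr 0, r (m : ZMod (2 * m))) :: (1, r 1) :: T := by
    intro j
    induction j with
    | zero => simpa using HandleEquiv.refl _
    | succ j ih =>
      have e1 := shift ((j + 1 : ℕ) : ZMod (2 * m))
      push_cast at e1 ⊢
      rw [add_sub_cancel_right] at e1
      exact e1.trans ih
  obtain ⟨j, rfl⟩ := ZMod.natCast_zmod_surjective p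
  exact e.trans ((generator_handle (ZMod.coe_mul_inv_eq_one k' hk') _).trans
    ((flip _).trans ((shifts j).trans (flip 0).symm)))

theorem hasTwoOrbitsByLifting {g : ℕ} (hg : 2 ≤ g) {m : ℕ} (hm : 0 < m) :
    HasTwoOrbitsByLifting g (DihedralGroup (2 * m)) := by
  have : NeZero (2 * m) := ⟨by omega⟩
  have h2m : (m : ZMod (2 * m)) + m = 0 := by
    have := ZMod.natCast_self (2 * m)
    push_cast at this
    linear_combination this
  have hm0 : (m : ZMod (2 * m)) ≠ 0 := by
    rw [Ne, ZMod.natCast_eq_zero_iff]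
    intro h
    have := Nat.le_of_dvd hm h
    omega
  refine hasTwoOrbitsByLifting_of_normalForms hg (sr 0) (r 1) (r 1) (sr 0) (r m) (by simp)
    (by rw [r_mul_r, h2m, r_zero]) ?_ (by simp [one_def, -r_zero]) ?_ (by simp)
    (handleClosure_freeForm g) ?_ (fun L hL hprod hgen => ?_) (quaternion_noncommuting hm)
  · rw [sr_mul_r, r_mul_sr, sr.injEq]
    linear_combination h2m
  · rw [one_def, Ne, r.injEq]
    exact hm0
  · exact eq_top_of_mem
      (Subgroup.subset_closure ⟨(sr 0, r m), by simp [kleinForm], Or.inl rfl⟩)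
      (Subgroup.subset_closure ⟨(r 1, 1), by simp [kleinForm], Or.inl rfl⟩)
  · obtain ⟨p, i, k, hi, h1, e⟩ := exists_normalForm hg L hL hprod hgen
    have hi' : i = 0 ∨ i = m := by
      obtain ⟨j, hj, rfl⟩ : ∃ j < 2 * m, (j : ZMod (2 * m)) = i :=
        ⟨i.val, ZMod.val_lt i, ZMod.natCast_zmod_val i⟩
      rw [← Nat.cast_add, ZMod.natCast_eq_zero_iff] at hi
      obtain ⟨c, hc⟩ := hi
      have hjc : j = m * c := by linarith
      have hc2 : c < 2 := by
        by_contra hc2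
        nlinarith
      interval_cases c
      · left; simp [hjc]
      · right; simp [hjc]
    rcases hi' with rfl | rfl
    · exact Or.inl (HandleEquiv.conjEquiv (e.trans (equiv_freeForm p k h1)))
    · exact Or.inr (HandleEquiv.conjEquiv (e.trans (equiv_kleinForm hm p k h1)))

end DihedralGroup

/-! ### Reduction to finitely many checks in a finite group -/

section conj

variable {G : Type*} [Group G]

/-- Simultaneous conjugation of a list of handles. -/
def conjHandles (c : G) (L : List (G × G)) : List (G × G) :=
  L.map (Prod.map (MulAut.conj c) (MulAut.conj c))

theorem conjHandles_conjHandles (c d : G) (L : List (G × G)) :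
    conjHandles c (conjHandles d L) = conjHandles (c * d) L := by
  simp [conjHandles, Function.comp_def, Prod.map]

theorem conjHandles_one (L : List (G × G)) : conjHandles 1 L = L := by
  simp [conjHandles]

theorem conjHandles_inv (c : G) (L : List (G × G)) : conjHandles c⁻¹ (conjHandles c L) = L := by
  rw [conjHandles_conjHandles, inv_mul_cancel, conjHandles_one]

theorem conjHandles_append (c : G) (L T : List (G × G)) :
    conjHandles c (L ++ T) = conjHandles c L ++ conjHandles c T := List.map_append

theorem conjHandles_cons_one (c a : G) (L : List (G × G)) :
    conjHandles c ((a, 1) :: L) = (c * a * c⁻¹, 1) :: conjHandles c L := by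
  simp [conjHandles]

theorem conjHandles_replicate (c : G) (m : ℕ) :
    conjHandles c (List.replicate m (1, 1)) = List.replicate m (1, 1) := by
  simp [conjHandles]

theorem HandleEquiv.conj {L L' : List (G × G)} (c : G) (h : L ∼ₕ L') :
    conjHandles c L ∼ₕ conjHandles c L' := h.map (MulAut.conj c).toMonoidHom

namespace ConjEquiv

variable {L L' L'' : List (G × G)}

theorem trans (h : L ∼ᶜ L') (h' : L' ∼ᶜ L'') : L ∼ᶜ L'' := by
  obtain ⟨c, h⟩ := h
  obtain ⟨d, h'⟩ := h'
  refine ⟨c * d, h.trans ?_⟩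
  have e := h'.conj c
  rwa [← conjHandles, conjHandles_conjHandles] at e

theorem symm (h : L ∼ᶜ L') : L' ∼ᶜ L := by
  obtain ⟨c, h⟩ := h
  refine ⟨c⁻¹, ?_⟩
  have e := h.symm.conj c⁻¹
  rwa [← conjHandles, conjHandles_inv] at e

theorem append_right (m : ℕ) (h : L ∼ᶜ L') :
    L ++ List.replicate m (1, 1) ∼ᶜ L' ++ List.replicate m (1, 1) := by
  obtain ⟨c, h⟩ := h
  refine ⟨c, ?_⟩
  rw [← conjHandles, conjHandles_append, conjHandles_replicate]
  exact h.append_right _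

theorem exists_cons (h : L ∼ᶜ L') (a : G) : ∃ e, (a, 1) :: L ∼ᶜ (e, 1) :: L' := by
  obtain ⟨c, h⟩ := h
  refine ⟨c⁻¹ * a * c, c, ?_⟩
  rw [← conjHandles, conjHandles_cons_one]
  rw [show c * (c⁻¹ * a * c) * c⁻¹ = a by group]
  exact h.cons (a, 1)

theorem handleClosure_eq_top (h : L ∼ᶜ L') (hL : handleClosure L = ⊤) : handleClosure L' = ⊤ := by
  obtain ⟨c, h⟩ := h.symm
  rw [← h.handleClosure_eq]
  have := handleClosure_map (MulAut.conj c).toMonoidHom L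
  exact this.trans (by
    rw [hL, ← MonoidHom.range_eq_map, MonoidHom.range_eq_top]
    exact (MulAut.conj c).surjective)

theorem commProd_eq_one (h : L ∼ᶜ L') (hL : commProd L = 1) : commProd L' = 1 := by
  obtain ⟨c, h⟩ := h.symm
  rw [← h.commProd_eq]
  have := map_commProd (MulAut.conj c).toMonoidHom L
  exact this.symm.trans (by rw [hL, map_one])

end ConjEquiv

/-- Moves of a single handle, applied to a pair of generators of a free group. -/
theorem HandleEquiv.nielsen {p q : G × G} (h : [p] ∼ₕ [q]) (T : List (G × G)) :
    (p.1, 1) :: (p.2, 1) :: T ∼ₕ (q.1, 1) :: (q.2, 1) :: T := by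
  obtain ⟨w, hw⟩ := h
  induction w generalizing p with
  | nil =>
    obtain rfl : p = q := by simpa [runMoves] using hw
    exact refl _
  | cons m w ih =>
    have key : ∃ p', m.2.actAt m.1 [p] = [p'] ∧
        (p.1, 1) :: (p.2, 1) :: T ∼ₕ (p'.1, 1) :: (p'.2, 1) :: T := by
      obtain ⟨k, m⟩ := m
      obtain ⟨a, b⟩ := p
      rcases k with _ | k
      · cases m
        · exact ⟨_, rfl, nielsenA a b T⟩
        · exact ⟨_, rfl, by simpa using (nielsenA a (b * a⁻¹) T).symm⟩
        · exact ⟨_, rfl, nielsenB a b T⟩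
        · exact ⟨_, rfl, by simpa using (nielsenB (a * b⁻¹) b T).symm⟩
        all_goals exact ⟨_, rfl, refl _⟩
      · refine ⟨(a, b), ?_, refl _⟩
        cases k <;> cases m <;> rfl
    obtain ⟨p', hp', e⟩ := key
    refine e.trans (ih ?_)
    change runMoves w (m.2.actAt m.1 [p]) = [q] at hw
    rwa [hp'] at hw

end conj

/-- The reduction of lists of handles to normal forms, in a group where every handle is equivalent
to some `(x, 1)` or is conjugate to one of finitely many representatives. -/
theorem exists_normalForm_of_representatives {G : Type*} [Group G] (reps : List (G × G))
    (nf : List (List (G × G)))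
    (hrep : ∀ p : G × G, (∃ x, [p] ∼ₕ [(x, 1)]) ∨ ∃ R ∈ reps, [p] ∼ᶜ [R])
    (hpair : ∀ R ∈ reps, ∀ R' ∈ reps,
      (∀ c, ∃ x p, R :: conjHandles c [R'] ∼ₕ [(x, 1), p]) ∨
        ∀ c, ∃ x p, R' :: conjHandles c [R] ∼ₕ [(x, 1), p])
    (hfree : ∀ R ∈ reps, ∃ N ∈ nf, [(R.1, 1), (R.2, 1)] ∼ᶜ N)
    (hklein : ∀ R ∈ reps, R.1 * R.2 = R.2 * R.1 → ∀ a, ∃ N ∈ nf, [(a, 1), R] ∼ᶜ N)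
    (htriv : ∀ N ∈ nf, ∀ e, ∃ p q, (e, 1) :: N ∼ᶜ [(1, 1), p, q])
    (m : ℕ) (L : List (G × G)) (hL : L.length = m + 2) (hprod : commProd L = 1) :
    (∃ x, L ∼ᶜ (x, 1) :: List.replicate (m + 1) (1, 1)) ∨
      ∃ N ∈ nf, L ∼ᶜ N ++ List.replicate m (1, 1) := by
  -- Each handle either reduces by itself or becomes a conjugate of a representative. In the latter
  -- case the only remaining parameter is the relative conjugator, which `hpair` covers.
  have two : ∀ (p q : G × G) (T : List (G × G)), ∃ x r, p :: q :: T ∼ₕ (x, 1) :: r :: T := by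
    intro p q T
    suffices h : ∃ x r, [p, q] ∼ₕ [(x, 1), r] by
      obtain ⟨x, r, h⟩ := h
      exact ⟨x, r, h.append_right T⟩
    rcases hrep p with ⟨x, hx⟩ | ⟨R, hR, c, hc⟩
    · exact ⟨x, q, hx.append_right [q]⟩
    rcases hrep q with ⟨x, hx⟩ | ⟨R', hR', c', hc'⟩
    · exact ⟨x, p, (hx.cons p).trans (HandleEquiv.swap _ _ _).symm⟩
    have ordered : ∀ {R R' : G × G} (a b : G), (∀ c, ∃ x p, R :: conjHandles c [R'] ∼ₕ [(x, 1), p]) →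
        ∃ x r, conjHandles a [R] ++ conjHandles b [R'] ∼ₕ [(x, 1), r] := by
      intro R R' a b h
      obtain ⟨x, r, e⟩ := h (a⁻¹ * b)
      have e' := e.conj a
      refine ⟨a * x * a⁻¹, Prod.map (MulAut.conj a) (MulAut.conj a) r, ?_⟩
      rw [conjHandles_cons_one] at e'
      rw [← List.singleton_append, conjHandles_append, conjHandles_conjHandles,
        mul_inv_cancel_left] at e'
      exact e'
    have e : [p, q] ∼ₕ conjHandles c [R] ++ conjHandles c' [R'] :=
      (hc.append_right [q]).trans (hc'.append_left _)
    rcases hpair R hR R' hR' with h | h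
    · obtain ⟨x, r, h⟩ := ordered c c' h
      exact ⟨x, r, e.trans h⟩
    -- The merging is available only in the opposite order. Exchanging the handles conjugates one of
    -- them by a commutator, which changes just its conjugator.
    · obtain ⟨k, hk⟩ : ∃ k, conjHandles c [R] ++ conjHandles c' [R'] ∼ₕ
          conjHandles c' [R'] ++ conjHandles (k * c) [R] := by
        let C := MulAut.conj c' R'.1 * MulAut.conj c' R'.2 * (MulAut.conj c' R'.1)⁻¹ *
          (MulAut.conj c' R'.2)⁻¹
        have s := HandleEquiv.of_run [(0, .S)] (conjHandles c [R] ++ conjHandles c' [R'])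
        refine ⟨C⁻¹, ?_⟩
        rw [← conjHandles_conjHandles]
        have e : ∀ x, MulAut.conj C⁻¹ x = C⁻¹ * x * C := fun x => by simp
        simp only [conjHandles, List.map_cons, List.map_nil, List.singleton_append, Prod.map, e]
        exact s
      obtain ⟨x, r, h⟩ := ordered c' (k * c) h
      exact ⟨x, r, e.trans (hk.trans h)⟩
  have base : ∀ L : List (G × G), L.length = 2 → commProd L = 1 →
      (∃ x, L ∼ᶜ [(x, 1), (1, 1)]) ∨ ∃ N ∈ nf, L ∼ᶜ N := by
    intro L hL hprod
    obtain ⟨p, q, rfl⟩ := List.length_eq_two.1 hL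
    obtain ⟨a, r, e⟩ := two p q []
    -- Under slides, the first entries of `(a, 1), (y, 1)` undergo the twists of the single handle
    -- `(a, y)`, so `hrep` applies to them.
    have pairCase : ∀ y, [p, q] ∼ᶜ [(a, 1), (y, 1)] →
        (∃ x, [p, q] ∼ᶜ [(x, 1), (1, 1)]) ∨ ∃ N ∈ nf, [p, q] ∼ᶜ N := by
      intro y hy
      rcases hrep (a, y) with ⟨x, hx⟩ | ⟨R, hR, c, hc⟩
      · exact Or.inl ⟨x, hy.trans (hx.nielsen []).conjEquiv⟩
      · obtain ⟨N, hN, h⟩ := hfree R hR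
        refine Or.inr ⟨N, hN, (hy.trans ?_).trans h⟩
        refine ⟨c, ?_⟩
        simpa [conjHandles] using hc.nielsen []
    rcases hrep r with ⟨y, hy⟩ | ⟨R, hR, h⟩
    · exact pairCase y (e.trans (hy.cons _)).conjEquiv
    · have hcomm : R.1 * R.2 = R.2 * R.1 := by
        have h1 : commProd [r] = 1 := by
          have := e.commProd_eq.trans hprod
          simpa [commProd] using this
        have h2 := h.commProd_eq_one h1
        simp only [commProd, List.map_cons, List.map_nil, List.prod_cons, List.prod_nil,
          mul_one] at h2
        exact mul_inv_eq_iff_eq_mul.1 (mul_inv_eq_one.1 h2)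
      obtain ⟨a', ha'⟩ := h.exists_cons a
      obtain ⟨N, hN, hN'⟩ := hklein R hR hcomm a'
      exact Or.inr ⟨N, hN, (e.conjEquiv.trans ha').trans hN'⟩
  induction m generalizing L with
  | zero => simpa using base L hL hprod
  | succ m ih =>
    obtain ⟨p, q, T, rfl⟩ : ∃ p q T, L = p :: q :: T := by
      rcases L with _ | ⟨p, _ | ⟨q, T⟩⟩
      · simp at hL
      · simp at hL
      · exact ⟨p, q, T, rfl⟩
    obtain ⟨x, r, e⟩ := two p q T
    have hprod' : commProd (r :: T) = 1 := by
      have := e.commProd_eq.trans hprod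
      simpa [commProd] using this
    -- It suffices to make all but two handles trivial, for then `base` applies. After induction on
    -- the tail, the extra handle `(x, 1)` either completes a list of two handles or, by `htriv`,
    -- makes a handle trivial that moves to the end.
    suffices h : ∃ L', L'.length = 2 ∧ p :: q :: T ∼ᶜ L' ++ List.replicate (m + 1) (1, 1) by
      obtain ⟨L', hL', h⟩ := h
      have hp' : commProd L' = 1 := by
        have := h.commProd_eq_one hprod
        simpa [commProd] using this
      rcases base L' hL' hp' with ⟨x, hx⟩ | ⟨N, hN, hx⟩
      · exact Or.inl ⟨x, h.trans (hx.append_right _)⟩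
      · exact Or.inr ⟨N, hN, h.trans (hx.append_right _)⟩
    rcases ih (r :: T) (by simpa using hL) hprod' with ⟨y, hy⟩ | ⟨N, hN, hy⟩
    · obtain ⟨e', he'⟩ := hy.exists_cons x
      exact ⟨[(e', 1), (y, 1)], rfl, e.conjEquiv.trans he'⟩
    · obtain ⟨e', he'⟩ := hy.exists_cons x
      obtain ⟨p', q', h⟩ := htriv N hN e'
      refine ⟨[p', q'], rfl, (e.conjEquiv.trans he').trans ?_⟩
      refine (h.append_right m).trans (HandleEquiv.conjEquiv ?_)
      exact HandleEquiv.move_append rfl [p', q'] _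

/-! ### Permutations as numbers -/

/-- A permutation `σ` of `Fin 5`, coded as the natural number whose digits in base 32 are the
`5 * σ i`. Each digit is the position of another one, so that permutations are composed by shifts
and masks. -/
def PermCode : Type := ℕ

namespace PermCode

/-- The code of a composition. -/
def mul (p q : ℕ) : ℕ :=
  Nat.add (Nat.land (Nat.shiftRight p (Nat.land q 31)) 31) (Nat.mul 32
  (Nat.add (Nat.land (Nat.shiftRight p (Nat.land (Nat.shiftRight q 5) 31)) 31) (Nat.mul 32
  (Nat.add (Nat.land (Nat.shiftRight p (Nat.land (Nat.shiftRight q 10) 31)) 31) (Nat.mul 32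
  (Nat.add (Nat.land (Nat.shiftRight p (Nat.land (Nat.shiftRight q 15) 31)) 31) (Nat.mul 32
   (Nat.land (Nat.shiftRight p (Nat.land (Nat.shiftRight q 20) 31)) 31))))))))

/-- The code of an inverse. -/
def inv (p : ℕ) : ℕ :=
  Nat.add (Nat.shiftLeft 5 (Nat.land (Nat.shiftRight p 5) 31))
  (Nat.add (Nat.shiftLeft 10 (Nat.land (Nat.shiftRight p 10) 31))
  (Nat.add (Nat.shiftLeft 15 (Nat.land (Nat.shiftRight p 15) 31))
   (Nat.shiftLeft 20 (Nat.land (Nat.shiftRight p 20) 31))))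

instance : Mul PermCode := ⟨mul⟩

instance : Inv PermCode := ⟨inv⟩

/-- The digits in base 32 are 0, 5, 10, 15, 20: the identity. -/
instance : One PermCode := ⟨(21473440 : ℕ)⟩

instance : BEq PermCode := ⟨Nat.beq⟩

instance : LawfulBEq PermCode where
  eq_of_beq h := Nat.eq_of_beq_eq_true h
  rfl {a} := Nat.beq_refl a

/-- The code of the permutation `i ↦ dᵢ`, where `d₀d₁d₂d₃d₄` are the decimal digits of `n`. -/
def ofDigits (n : ℕ) : PermCode :=
  (n / 10000 % 10 * 5 + 32 * (n / 1000 % 10 * 5 + 32 * (n / 100 % 10 * 5 +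
    32 * (n / 10 % 10 * 5 + 32 * (n % 10 * 5)))) : ℕ)

/-- The code of a permutation, as a number. -/
def number (σ : Equiv.Perm (Fin 5)) : ℕ :=
  5 * σ 0 + 32 * (5 * σ 1 + 32 * (5 * σ 2 + 32 * (5 * σ 3 + 32 * (5 * σ 4))))

/-- The code of a permutation. -/
def ofPerm (σ : Equiv.Perm (Fin 5)) : PermCode := number σ

/-- The digits carry the factor 5 so that a digit, read by shifting and masking five bits, can
itself serve as the next shift distance. -/
theorem digit_number (σ : Equiv.Perm (Fin 5)) (i : Fin 5) :
    Nat.land (Nat.shiftRight (number σ) (5 * i)) 31 = 5 * σ i := by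
  have h : ∀ x k : ℕ, Nat.land (Nat.shiftRight x k) 31 = x / 2 ^ k % 32 := fun x k => by
    change (x >>> k) &&& (2 ^ 5 - 1) = _
    rw [Nat.and_two_pow_sub_one_eq_mod, Nat.shiftRight_eq_div_pow]
  have key : ∀ a b c d e : ℕ, a < 32 → b < 32 → c < 32 → d < 32 → e < 32 →
      (a + 32 * (b + 32 * (c + 32 * (d + 32 * e)))) % 32 = a ∧
      (a + 32 * (b + 32 * (c + 32 * (d + 32 * e)))) / 32 % 32 = b ∧
      (a + 32 * (b + 32 * (c + 32 * (d + 32 * e)))) / 1024 % 32 = c ∧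
      (a + 32 * (b + 32 * (c + 32 * (d + 32 * e)))) / 32768 % 32 = d ∧
      (a + 32 * (b + 32 * (c + 32 * (d + 32 * e)))) / 1048576 % 32 = e := by omega
  have hlt : ∀ i, 5 * (σ i : ℕ) < 32 := fun i => by omega
  obtain ⟨h0, h1, h2, h3, h4⟩ := key _ _ _ _ _ (hlt 0) (hlt 1) (hlt 2) (hlt 3) (hlt 4)
  rw [h]
  fin_cases i
  · exact (congrArg (· % 32) (Nat.div_one _)).trans h0
  · exact h1
  · exact h2
  · exact h3
  · exact h4

theorem ofPerm_mul (σ τ : Equiv.Perm (Fin 5)) : ofPerm (σ * τ) = ofPerm σ * ofPerm τ := by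
  have h0 : Nat.land (number τ) 31 = 5 * τ 0 := digit_number τ 0
  have h1 : Nat.land (Nat.shiftRight (number τ) 5) 31 = 5 * τ 1 := digit_number τ 1
  have h2 : Nat.land (Nat.shiftRight (number τ) 10) 31 = 5 * τ 2 := digit_number τ 2
  have h3 : Nat.land (Nat.shiftRight (number τ) 15) 31 = 5 * τ 3 := digit_number τ 3
  have h4 : Nat.land (Nat.shiftRight (number τ) 20) 31 = 5 * τ 4 := digit_number τ 4
  change number (σ * τ) = mul (number σ) (number τ)
  unfold mul
  rw [h0, h1, h2, h3, h4]
  simp only [digit_number]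
  rfl

theorem ofPerm_inv (σ : Equiv.Perm (Fin 5)) : ofPerm σ⁻¹ = (ofPerm σ)⁻¹ := by
  have h1 : Nat.land (Nat.shiftRight (number σ) 5) 31 = 5 * σ 1 := digit_number σ 1
  have h2 : Nat.land (Nat.shiftRight (number σ) 10) 31 = 5 * σ 2 := digit_number σ 2
  have h3 : Nat.land (Nat.shiftRight (number σ) 15) 31 = 5 * σ 3 := digit_number σ 3
  have h4 : Nat.land (Nat.shiftRight (number σ) 20) 31 = 5 * σ 4 := digit_number σ 4
  have hs : ∀ x k : ℕ, Nat.shiftLeft x (5 * k) = x * 32 ^ k := fun x k => by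
    change x <<< (5 * k) = _
    rw [Nat.shiftLeft_eq, pow_mul]
    norm_num
  change number σ⁻¹ = inv (number σ)
  unfold inv
  rw [h1, h2, h3, h4]
  simp only [hs]
  -- The code of the inverse is the sum of `5 * σ⁻¹ j * 32 ^ j` over `j`. Reindexed by `σ`, it
  -- becomes the sum of `5 * i * 32 ^ σ i`, whose term at `i = 0` vanishes and is absent from `inv`.
  have e := Equiv.sum_comp σ fun j : Fin 5 => 5 * ((σ.symm j : Fin 5) : ℕ) * 32 ^ (j : ℕ)
  simp only [Equiv.symm_apply_apply, Fin.sum_univ_five] at e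
  norm_num at e
  change (_ : ℕ) = 5 * 32 ^ (σ 1 : ℕ) + (10 * 32 ^ (σ 2 : ℕ) + (15 * 32 ^ (σ 3 : ℕ) +
    20 * 32 ^ (σ 4 : ℕ)))
  change 5 * (σ.symm 0 : ℕ) + 32 * (5 * σ.symm 1 + 32 * (5 * σ.symm 2 + 32 * (5 * σ.symm 3 +
    32 * (5 * σ.symm 4)))) = _
  linarith

theorem ofPerm_injective : Function.Injective ofPerm := fun σ τ h => by
  have h : number σ = number τ := h
  ext i
  have h1 := digit_number σ i
  rw [h, digit_number] at h1
  omega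

/-- Add a code to a list of known codes and to a list of codes to be treated, if it is new. -/
def insertNew (y : PermCode) (s : List PermCode × List PermCode) :
    List PermCode × List PermCode :=
  bif s.1.elem y then s else (y :: s.1, y :: s.2)

/-- Breadth-first enumeration of a double coset. -/
def enumerate (gens : List PermCode) : ℕ → List PermCode × List PermCode → List PermCode
  | 0, s => s.1
  | _ + 1, (seen, []) => seen
  | n + 1, (seen, x :: todo) => enumerate gens n
      (gens.foldr (fun g s => insertNew (g * x) (insertNew (x * g) s)) (seen, todo))

/-- Elements of the double coset of `s` by the group generated by `gens`; there are at most 60. -/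
def doubleCoset (gens : List PermCode) (s : PermCode) : List PermCode :=
  enumerate gens 60 ([s], [s])

/-- Only soundness of the enumeration is needed: every listed code belongs to the double coset.
Completeness is never assumed. -/
theorem forall_mem_doubleCoset {gens : List PermCode} {s : PermCode} {Q : PermCode → Prop}
    (hs : Q s) (hQ : ∀ x, Q x → ∀ g ∈ gens, Q (x * g) ∧ Q (g * x)) :
    ∀ y ∈ doubleCoset gens s, Q y := by
  let Good (s : List PermCode × List PermCode) : Prop := (∀ y ∈ s.1, Q y) ∧ ∀ y ∈ s.2, Q y
  have insert : ∀ y s, Q y → Good s → Good (insertNew y s) := by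
    intro y s hy h
    unfold insertNew
    cases s.1.elem y
    · exact ⟨List.forall_mem_cons.2 ⟨hy, h.1⟩, List.forall_mem_cons.2 ⟨hy, h.2⟩⟩
    · exact h
  have step : ∀ (l : List PermCode) (x : PermCode) s, (∀ g ∈ l, g ∈ gens) → Q x → Good s →
      Good (l.foldr (fun g s => insertNew (g * x) (insertNew (x * g) s)) s) := by
    intro l x s hl hx h
    induction l with
    | nil => exact h
    | cons g l ih =>
      have hg := hQ x hx g (hl g (by simp))
      exact insert _ _ hg.2 (insert _ _ hg.1 (ih fun k hk => hl k (by simp [hk])))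
  have enum : ∀ n s, Good s → ∀ y ∈ enumerate gens n s, Q y := by
    intro n
    induction n with
    | zero => exact fun s h => h.1
    | succ n ih =>
      rintro ⟨seen, _ | ⟨x, todo⟩⟩ h
      · exact h.1
      · exact ih _ (step _ _ _ (fun _ h => h) (h.2 x (by simp))
          ⟨h.1, fun y hy => h.2 y (by simp [hy])⟩)
  exact enum _ _ ⟨by simpa using hs, by simpa using hs⟩

/-- `M` is the conjugate of `L` by `g`. -/
def isConj (g : PermCode) : List (PermCode × PermCode) → List (PermCode × PermCode) → Bool
  | [], [] => true
  | p :: L, q :: M => g * p.1 == q.1 * g && g * p.2 == q.2 * g && isConj g L M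
  | _, _ => false

end PermCode

/-! ### Transfer between a group and its codes -/

/-- An identification of a finite group with a set of codes of permutations. -/
structure PermCoding (G : Type*) [Group G] where
  /-- The code of an element. -/
  enc : G → PermCode
  /-- The element with a given code. -/
  dec : PermCode → G
  /-- All codes of elements. -/
  codes : List PermCode
  enc_mul : ∀ x y, enc (x * y) = enc x * enc y
  enc_inv : ∀ x, enc x⁻¹ = (enc x)⁻¹
  enc_one : enc 1 = 1
  dec_enc : ∀ x, dec (enc x) = x
  enc_mem : ∀ x, enc x ∈ codes
  enc_dec : ∀ c ∈ codes, enc (dec c) = c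

namespace PermCoding

variable {G : Type*} [Group G]

/-- The coding given by a faithful action on five points. -/
noncomputable def ofHom (f : G →* Equiv.Perm (Fin 5)) (hf : Function.Injective f)
    (codes : List PermCode) (h : ∀ x, PermCode.ofPerm (f x) ∈ codes)
    (h' : ∀ c ∈ codes, ∃ x, PermCode.ofPerm (f x) = c) : PermCoding G where
  enc x := PermCode.ofPerm (f x)
  dec := Function.invFun fun x => PermCode.ofPerm (f x)
  codes := codes
  enc_mul x y := by rw [map_mul, PermCode.ofPerm_mul]
  enc_inv x := by rw [map_inv, PermCode.ofPerm_inv]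
  enc_one := by rw [map_one]; rfl
  dec_enc := Function.leftInverse_invFun (PermCode.ofPerm_injective.comp hf)
  enc_mem := h
  enc_dec c hc := Function.invFun_eq (h' c hc)

variable (P : PermCoding G)

theorem dec_one : P.dec 1 = 1 := by rw [← P.enc_one, P.dec_enc]

theorem one_mem : 1 ∈ P.codes := P.enc_one ▸ P.enc_mem 1

variable {P} {a b c g : PermCode}

theorem enc_dec_mul (ha : a ∈ P.codes) (hb : b ∈ P.codes) : P.enc (P.dec a * P.dec b) = a * b := by
  rw [P.enc_mul, P.enc_dec a ha, P.enc_dec b hb]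

theorem dec_mul (ha : a ∈ P.codes) (hb : b ∈ P.codes) : P.dec (a * b) = P.dec a * P.dec b := by
  rw [← enc_dec_mul ha hb, P.dec_enc]

theorem mul_mem (ha : a ∈ P.codes) (hb : b ∈ P.codes) : a * b ∈ P.codes :=
  enc_dec_mul ha hb ▸ P.enc_mem _

theorem enc_dec_inv (ha : a ∈ P.codes) : P.enc (P.dec a)⁻¹ = a⁻¹ := by
  rw [P.enc_inv, P.enc_dec a ha]

theorem dec_inv (ha : a ∈ P.codes) : P.dec a⁻¹ = (P.dec a)⁻¹ := by
  rw [← enc_dec_inv ha, P.dec_enc]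

theorem inv_mem (ha : a ∈ P.codes) : a⁻¹ ∈ P.codes := enc_dec_inv ha ▸ P.enc_mem _

theorem dec_conj (hg : g ∈ P.codes) (ha : a ∈ P.codes) (hb : b ∈ P.codes) (h : g * a = b * g) :
    P.dec b = P.dec g * P.dec a * (P.dec g)⁻¹ := by
  rw [← dec_mul hg ha, h, dec_mul hb hg, mul_inv_cancel_right]

theorem mem_of_mem_doubleCoset {gens : List PermCode} (hgens : ∀ g ∈ gens, g ∈ P.codes)
    (K : Subgroup G) (hK : ∀ g ∈ gens, P.dec g ∈ K) (ha : a ∈ P.codes)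
    (hb : b ∈ PermCode.doubleCoset gens a) :
    ∃ h ∈ K, ∃ k ∈ K, P.dec b = h * P.dec a * k := by
  refine (PermCode.forall_mem_doubleCoset
    (Q := fun b => b ∈ P.codes ∧ ∃ h ∈ K, ∃ k ∈ K, P.dec b = h * P.dec a * k)
    ⟨ha, 1, K.one_mem, 1, K.one_mem, by simp⟩ ?_ b hb).2
  rintro x ⟨hx, h, hh, k, hk, e⟩ g hg
  refine ⟨⟨mul_mem hx (hgens g hg), h, hh, k * P.dec g, K.mul_mem hk (hK g hg), ?_⟩,
    ⟨mul_mem (hgens g hg) hx, P.dec g * h, K.mul_mem (hK g hg) hh, k, hk, ?_⟩⟩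
  · rw [dec_mul hx (hgens g hg), e, mul_assoc]
  · rw [dec_mul (hgens g hg) hx, e]
    simp only [mul_assoc]

theorem mem_of_mem_span {gens : List PermCode} (hgens : ∀ g ∈ gens, g ∈ P.codes)
    (K : Subgroup G) (hK : ∀ g ∈ gens, P.dec g ∈ K) (hb : b ∈ PermCode.doubleCoset gens 1) :
    P.dec b ∈ K := by
  obtain ⟨h, hh, k, hk, e⟩ := mem_of_mem_doubleCoset hgens K hK P.one_mem hb
  rw [e, P.dec_one, mul_one]
  exact K.mul_mem hh hk

variable (P)

/-- The list of handles with given codes. -/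
def decode (L : List (PermCode × PermCode)) : List (G × G) := L.map (Prod.map P.dec P.dec)

/-- The entries of a list are codes. -/
def IsCoded (L : List (PermCode × PermCode)) : Prop := ∀ p ∈ L, p.1 ∈ P.codes ∧ p.2 ∈ P.codes

variable {P} {L M : List (PermCode × PermCode)}

theorem isCoded_singleton {p : PermCode × PermCode} :
    P.IsCoded [p] ↔ p.1 ∈ P.codes ∧ p.2 ∈ P.codes := by simp [IsCoded]

theorem isCoded_cons {p : PermCode × PermCode} :
    P.IsCoded (p :: L) ↔ (p.1 ∈ P.codes ∧ p.2 ∈ P.codes) ∧ P.IsCoded L := by simp [IsCoded]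

theorem encode_runMoves (hL : P.IsCoded L) (w : List (ℕ × HandleMove)) :
    (runMoves w (P.decode L)).map (Prod.map P.enc P.enc) = runMoves w L := by
  rw [← runMoves_map P.enc P.enc_mul P.enc_inv, decode, List.map_map]
  congr 1
  conv_rhs => rw [← List.map_id L]
  refine List.map_congr_left fun p hp => ?_
  simp [Prod.map, P.enc_dec _ (hL p hp).1, P.enc_dec _ (hL p hp).2]

/-- Decoding is multiplicative only on the codes of group elements, so this is deduced from the
compatibility of the encoding with moves. -/
theorem decode_runMoves (hL : P.IsCoded L) (w : List (ℕ × HandleMove)) :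
    P.decode (runMoves w L) = runMoves w (P.decode L) := by
  rw [← encode_runMoves hL, decode, List.map_map]
  conv_rhs => rw [← List.map_id (runMoves w (P.decode L))]
  refine List.map_congr_left fun p _ => ?_
  simp [Prod.map, P.dec_enc]

theorem IsCoded.runMoves (hL : P.IsCoded L) (w : List (ℕ × HandleMove)) :
    P.IsCoded (runMoves w L) := by
  rw [← encode_runMoves hL]
  intro p hp
  obtain ⟨q, -, rfl⟩ := List.mem_map.1 hp
  exact ⟨P.enc_mem _, P.enc_mem _⟩

theorem handleEquiv_runMoves (hL : P.IsCoded L) (w : List (ℕ × HandleMove)) :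
    P.decode L ∼ₕ P.decode (_root_.runMoves w L) := ⟨w, (decode_runMoves hL w).symm⟩

theorem decode_isConj (hg : g ∈ P.codes) (hL : P.IsCoded L) (hM : P.IsCoded M)
    (h : PermCode.isConj g L M = true) : P.decode M = conjHandles (P.dec g) (P.decode L) := by
  induction L generalizing M with
  | nil =>
    cases M
    · rfl
    · simp [PermCode.isConj] at h
  | cons p L ih =>
    cases M with
    | nil => simp [PermCode.isConj] at h
    | cons q M =>
      rw [isCoded_cons] at hL hM
      simp only [PermCode.isConj, Bool.and_eq_true, beq_iff_eq] at h
      have e := ih hL.2 hM.2 h.2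
      have e1 := dec_conj hg hL.1.1 hM.1.1 h.1.1
      have e2 := dec_conj hg hL.1.2 hM.1.2 h.1.2
      simp only [decode, conjHandles, List.map_cons] at e ⊢
      rw [e]
      simp [Prod.map, e1, e2]

theorem conjEquiv_of_isConj (hg : g ∈ P.codes) (hL : P.IsCoded L) (hM : P.IsCoded M)
    {w : List (ℕ × HandleMove)} (h : PermCode.isConj g M (_root_.runMoves w L) = true) :
    P.decode L ∼ᶜ P.decode M := by
  refine ⟨P.dec g, (handleEquiv_runMoves hL w).trans ?_⟩
  rw [decode_isConj hg hM (hL.runMoves w) h]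
  exact HandleEquiv.refl _

end PermCoding

/-! ### The finite checks and their soundness -/

/-- The list of handles `(x, 1), p` together with representatives of double cosets. -/
structure CodedForm where
  /-- The entry of the first handle. -/
  x : PermCode
  /-- The second handle. -/
  p : PermCode × PermCode
  /-- Representatives of the nontrivial double cosets of the group that the entries generate. -/
  cosets : List PermCode

/-- The handles of a coded form. -/
def CodedForm.list (F : CodedForm) : List (PermCode × PermCode) := [(F.x, 1), F.p]

/-- Generators of the group that the entries of a coded form generate. -/
def CodedForm.gens (F : CodedForm) : List PermCode := [F.x, F.p.1, F.p.2]

/-- Data for the reduction of lists of handles in a group of permutations. -/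
structure HandleReduction where
  /-- Representatives of the classes of involutions. -/
  involutions : List PermCode
  /-- Moves that make the second entry of a handle an involution. -/
  handleMoves : List (List (ℕ × HandleMove))
  /-- Moves that bring a handle with an involution to a conjugate of a representative. -/
  involutionMoves : List (List (ℕ × HandleMove))
  /-- Elements that conjugate handles to representatives. -/
  conjugators : List PermCode
  /-- Representatives of the handles. -/
  reps : List (PermCode × PermCode)
  /-- Moves that make an entry of a pair of representatives trivial. -/
  pairMoves : List (List (ℕ × HandleMove))
  /-- Moves and conjugations that connect lists of two handles. -/
  links : List (List (ℕ × HandleMove) × PermCode)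
  /-- Representatives of double cosets of the commuting representatives. -/
  commuting : List ((PermCode × PermCode) × List PermCode)
  /-- Normal forms that make every further handle trivial. -/
  forms : List CodedForm
  /-- Normal forms that a further handle may transform into one of `forms`. -/
  linkedForms : List CodedForm

namespace HandleReduction

open PermCode

/-- The handle is `(a, y)` with `y * y = 1`. -/
def sndIsInvolution : List (PermCode × PermCode) → Bool
  | [(_, y)] => y * y == 1
  | _ => false

/-- Some entry is trivial, or the product of the second entries is. -/
def hasTrivialEntry : List (PermCode × PermCode) → Bool
  | [(a, b), (c, d)] => a == 1 || b == 1 || c == 1 || d == 1 || b * d == 1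
  | _ => false

variable (R : HandleReduction) (codes : List PermCode)

/-- All data are codes of group elements. -/
def isCoded : Bool :=
  R.involutions.all codes.elem && R.conjugators.all codes.elem &&
  R.reps.all (fun p => codes.elem p.1 && codes.elem p.2) && R.links.all (fun l => codes.elem l.2) &&
  R.commuting.all (fun k => k.2.all codes.elem) &&
  (R.forms ++ R.linkedForms).all fun F => F.gens.all codes.elem && F.cosets.all codes.elem

/-- Every handle can be moved to one whose second entry is an involution. -/
def reachesInvolution : Bool :=
  codes.all fun a => codes.all fun b => R.handleMoves.any fun w => sndIsInvolution (runMoves w [(a, b)])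

/-- Every involution is conjugate to one of the list. -/
def coversInvolutions : Bool :=
  codes.all fun y => !(y * y == 1) || y == 1 ||
    R.involutions.any fun t => codes.any fun g => g * t == y * g

/-- A single handle has a trivial entry or is conjugate to a representative. -/
def isReduced : List (PermCode × PermCode) → Bool
  | [(a, b)] => a == 1 || b == 1 ||
    R.conjugators.any fun g => R.reps.any fun r => isConj g [r] [(a, b)]
  | _ => false

/-- Every handle with a listed involution can be moved to a representative. -/
def reachesRepresentative : Bool :=
  codes.all fun x => R.involutions.all fun t => R.involutionMoves.any fun w =>
    R.isReduced (runMoves w [(x, t)])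

/-- In the presence of the conjugates of `r'`, the handle `r` can be made trivial. -/
def mergesPair (r r' : PermCode × PermCode) : Bool :=
  codes.all fun g => R.pairMoves.any fun w =>
    hasTrivialEntry (runMoves w [r, (g * r'.1 * g⁻¹, g * r'.2 * g⁻¹)])

/-- The first element of a list of representatives can be merged with all elements. -/
def mergesHead : List (PermCode × PermCode) → Bool
  | [] => true
  | r :: l => (r :: l).all fun s => R.mergesPair codes r s

/-- One of the given moves connects `L` with a conjugate of `M`. -/
def isLinked (L M : List (PermCode × PermCode)) : Bool :=
  R.links.any fun l => isConj l.2 M (runMoves l.1 L)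

/-- The list is connected with a normal form. -/
def hasForm (L : List (PermCode × PermCode)) : Bool :=
  (R.forms ++ R.linkedForms).any fun F => R.isLinked L F.list

/-- The pairs that come from a representative have a normal form. -/
def reducesPairs : Bool := R.reps.all fun r => R.hasForm [(r.1, 1), (r.2, 1)]

/-- The lists `(a, 1), r` with a commuting representative `r` have a normal form. -/
def reducesCommuting : Bool :=
  R.reps.all fun r => !(r.1 * r.2 == r.2 * r.1) || R.commuting.any fun k => k.1 == r &&
    k.2.all (fun b => R.hasForm [(b, 1), r]) &&
    codes.all fun a => k.2.any fun b => (doubleCoset [r.1, r.2] b).elem a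

/-- The double cosets cover the group. -/
def coversCosets (F : CodedForm) : Bool :=
  codes.all fun e => (1 :: F.cosets).any fun b => (doubleCoset F.gens b).elem e

/-- In the presence of the handle `(b, 1)`, another handle can be made trivial. -/
def absorbs (F : CodedForm) (b : PermCode) : Bool :=
  (doubleCoset [b, F.p.1, F.p.2] 1).elem F.x ||
    (F.p.2 == 1 && (doubleCoset [b, F.x] 1).elem F.p.1)

/-- Every further handle makes one of the handles trivial. -/
def absorbsAll : Bool :=
  (R.forms.all fun F => coversCosets codes F && F.cosets.all (absorbs F)) &&
  R.linkedForms.all fun F => coversCosets codes F && F.cosets.all fun b =>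
    absorbs F b || R.forms.any fun F' => R.isLinked [(b, 1), F.p] F'.list

/-- The entries of the form do not generate the group. -/
def isProper (F : CodedForm) : Bool :=
  ((doubleCoset F.gens 1).elem 1 && (doubleCoset F.gens 1).all fun s => F.gens.all fun g =>
    (doubleCoset F.gens 1).elem (s * g) && (doubleCoset F.gens 1).elem (s * g⁻¹)) &&
  codes.any fun c => !(doubleCoset F.gens 1).elem c

/-- Only the two given forms generate the group. -/
def onlyGenerate (x y a u v : PermCode) : Bool :=
  (R.forms ++ R.linkedForms).all fun F => F.x == x && F.p == (y, 1) || F.x == a && F.p == (u, v) ||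
    isProper codes F

/-- The two given forms generate the group, and `u`, `v` generate a Klein four-group. -/
def generates (x y a u v : PermCode) : Bool :=
  [x, y, a, u, v].all codes.elem && codes.all (doubleCoset [x, y] 1).elem &&
  codes.all (doubleCoset [a, u, v] 1).elem && !(x * y == y * x) && u * u == 1 && v * v == 1 &&
  u * v == v * u && !(u == 1) && !(v == 1) && !(u == v)

end HandleReduction

namespace PermCoding

open HandleReduction

variable {G : Type*} [Group G] {P : PermCoding G} {R : HandleReduction}

theorem dec_eq_iff {a b : PermCode} (ha : a ∈ P.codes) (hb : b ∈ P.codes) :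
    P.dec a = P.dec b ↔ a = b :=
  ⟨fun h => by rw [← P.enc_dec a ha, h, P.enc_dec b hb], congrArg _⟩

/-- The parts of `HandleReduction.isCoded`. -/
structure HasCodes (P : PermCoding G) (R : HandleReduction) : Prop where
  involutions : ∀ t ∈ R.involutions, t ∈ P.codes
  conjugators : ∀ g ∈ R.conjugators, g ∈ P.codes
  reps : ∀ r ∈ R.reps, r.1 ∈ P.codes ∧ r.2 ∈ P.codes
  links : ∀ l ∈ R.links, l.2 ∈ P.codes
  commuting : ∀ k ∈ R.commuting, ∀ b ∈ k.2, b ∈ P.codes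
  gens : ∀ F ∈ R.forms ++ R.linkedForms, ∀ g ∈ F.gens, g ∈ P.codes
  cosets : ∀ F ∈ R.forms ++ R.linkedForms, ∀ b ∈ F.cosets, b ∈ P.codes

theorem hasCodes_of_isCoded (h : R.isCoded P.codes = true) : P.HasCodes R := by
  simp only [isCoded, Bool.and_eq_true, List.all_eq_true, List.elem_eq_mem, decide_eq_true_eq] at h
  obtain ⟨⟨⟨⟨⟨h1, h2⟩, h3⟩, h4⟩, h5⟩, h6⟩ := h
  exact ⟨h1, h2, h3, h4, h5, fun F hF => (h6 F hF).1, fun F hF => (h6 F hF).2⟩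

theorem HasCodes.list (hR : P.HasCodes R) {F : CodedForm} (hF : F ∈ R.forms ++ R.linkedForms) :
    P.IsCoded F.list := by
  have h := hR.gens F hF
  rw [CodedForm.list, isCoded_cons, isCoded_singleton]
  exact ⟨⟨h _ (by simp [CodedForm.gens]), P.one_mem⟩, h _ (by simp [CodedForm.gens]),
    h _ (by simp [CodedForm.gens])⟩

/-- Three checks are chained: the second entry becomes an involution or trivial, a conjugation makes
it a listed involution, and further moves reach a representative. -/
theorem exists_representative (hR : P.HasCodes R) (h1 : R.reachesInvolution P.codes = true)
    (h2 : R.coversInvolutions P.codes = true) (h3 : R.reachesRepresentative P.codes = true)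
    (p : G × G) : (∃ x, [p] ∼ₕ [(x, 1)]) ∨ ∃ r ∈ P.decode R.reps, [p] ∼ᶜ [r] := by
  have step : ∀ {p q : G × G}, [p] ∼ᶜ [q] → ((∃ x, [q] ∼ₕ [(x, 1)]) ∨
      ∃ r ∈ P.decode R.reps, [q] ∼ᶜ [r]) → (∃ x, [p] ∼ₕ [(x, 1)]) ∨
      ∃ r ∈ P.decode R.reps, [p] ∼ᶜ [r] := by
    rintro p q h (⟨x, hx⟩ | ⟨r, hr, e⟩)
    · obtain ⟨c, h⟩ := h
      refine Or.inl ⟨c * x * c⁻¹, h.trans ?_⟩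
      simpa [conjHandles] using hx.conj c
    · exact Or.inr ⟨r, hr, h.trans e⟩
  have reduced : ∀ x ∈ P.codes, ∀ t ∈ R.involutions, (∃ y, P.decode [(x, t)] ∼ₕ [(y, 1)]) ∨
      ∃ r ∈ P.decode R.reps, P.decode [(x, t)] ∼ᶜ [r] := by
    intro x hx t ht
    simp only [reachesRepresentative, List.all_eq_true, List.any_eq_true] at h3
    obtain ⟨w, -, hw⟩ := h3 x hx t ht
    have hc : P.IsCoded [(x, t)] := isCoded_singleton.2 ⟨hx, hR.involutions t ht⟩
    have hc' := hc.runMoves w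
    have hrun := handleEquiv_runMoves hc w
    rcases hq : runMoves w [(x, t)] with _ | ⟨⟨a, b⟩, _ | _⟩
    · simp [hq, isReduced] at hw
    · rw [hq] at hw hrun hc'
      refine step hrun.conjEquiv ?_
      simp only [isReduced, Bool.or_eq_true, beq_iff_eq, List.any_eq_true] at hw
      rcases hw with (rfl | rfl) | ⟨g, hg, r, hr, hw⟩
      · refine Or.inl ⟨(P.dec b)⁻¹, ?_⟩
        simpa [Prod.map, P.dec_one] using HandleEquiv.one_left (P.dec b) []
      · refine Or.inl ⟨P.dec a, ?_⟩
        rw [show Prod.map P.dec P.dec (a, 1) = (P.dec a, 1) from by rw [Prod.map, P.dec_one]]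
        exact HandleEquiv.refl _
      · refine Or.inr ⟨Prod.map P.dec P.dec r, List.mem_map_of_mem hr, P.dec g, ?_⟩
        have e := decode_isConj (hR.conjugators g hg) (isCoded_singleton.2 (hR.reps r hr)) hc' hw
        exact ⟨[], e⟩
    · simp [hq, isReduced] at hw
  simp only [reachesInvolution, List.all_eq_true, List.any_eq_true] at h1
  obtain ⟨w, -, hw⟩ := h1 _ (P.enc_mem p.1) _ (P.enc_mem p.2)
  have hc : P.IsCoded [(P.enc p.1, P.enc p.2)] := isCoded_singleton.2 ⟨P.enc_mem _, P.enc_mem _⟩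
  have hc' := hc.runMoves w
  have hrun := handleEquiv_runMoves hc w
  rw [show P.decode [(P.enc p.1, P.enc p.2)] = [p] by simp [decode, Prod.map, P.dec_enc]] at hrun
  rcases hq : runMoves w [(P.enc p.1, P.enc p.2)] with _ | ⟨⟨a, b⟩, _ | _⟩
  · simp [hq, sndIsInvolution] at hw
  · rw [hq] at hw hrun hc'
    refine step hrun.conjEquiv ?_
    have hab := isCoded_singleton.1 hc'
    simp only [coversInvolutions, List.all_eq_true, Bool.or_eq_true, Bool.not_eq_true',
      List.any_eq_true, beq_iff_eq] at h2
    rcases h2 b hab.2 with (h | rfl) | ⟨t, ht, g, hg, h⟩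
    · simp only [sndIsInvolution] at hw
      exact absurd (hw.symm.trans h) (by simp)
    · refine Or.inl ⟨P.dec a, ?_⟩
      rw [show Prod.map P.dec P.dec (a, 1) = (P.dec a, 1) from by rw [Prod.map, P.dec_one]]
      exact HandleEquiv.refl _
    · have hx : g⁻¹ * a * g ∈ P.codes := mul_mem (mul_mem (inv_mem hg) hab.1) hg
      refine step ⟨P.dec g, ?_⟩ (reduced _ hx t ht)
      have e1 := dec_conj hg (hR.involutions t ht) hab.2 h
      have e2 : P.dec a = P.dec g * P.dec (g⁻¹ * a * g) * (P.dec g)⁻¹ := by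
        rw [dec_mul (mul_mem (inv_mem hg) hab.1) hg, dec_mul (inv_mem hg) hab.1, dec_inv hg]
        group
      simp only [List.map_cons, List.map_nil, Prod.map, MulAut.conj_apply, ← e1, ← e2]
      exact HandleEquiv.refl _
  · simp [hq, sndIsInvolution] at hw

theorem exists_trivial_of_mergesPair {r r' : PermCode × PermCode}
    (hr : r.1 ∈ P.codes ∧ r.2 ∈ P.codes) (hr' : r'.1 ∈ P.codes ∧ r'.2 ∈ P.codes)
    (h : R.mergesPair P.codes r r' = true) (c : G) :
    ∃ x p, Prod.map P.dec P.dec r :: conjHandles c [Prod.map P.dec P.dec r'] ∼ₕ [(x, 1), p] := by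
  simp only [mergesPair, List.all_eq_true, List.any_eq_true] at h
  obtain ⟨w, -, hw⟩ := h _ (P.enc_mem c)
  have hg := P.enc_mem c
  have hc : P.IsCoded [r, (P.enc c * r'.1 * (P.enc c)⁻¹, P.enc c * r'.2 * (P.enc c)⁻¹)] :=
    isCoded_cons.2 ⟨hr, isCoded_singleton.2 ⟨mul_mem (mul_mem hg hr'.1) (inv_mem hg),
      mul_mem (mul_mem hg hr'.2) (inv_mem hg)⟩⟩
  have hc' := hc.runMoves w
  have hrun := handleEquiv_runMoves hc w
  have e : P.decode [r, (P.enc c * r'.1 * (P.enc c)⁻¹, P.enc c * r'.2 * (P.enc c)⁻¹)] =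
      Prod.map P.dec P.dec r :: conjHandles c [Prod.map P.dec P.dec r'] := by
    simp only [decode, conjHandles, List.map_cons, List.map_nil, Prod.map, MulAut.conj_apply]
    rw [dec_mul (mul_mem hg hr'.1) (inv_mem hg), dec_mul hg hr'.1, dec_inv hg,
      dec_mul (mul_mem hg hr'.2) (inv_mem hg), dec_mul hg hr'.2, dec_inv hg, P.dec_enc]
  rw [e] at hrun
  generalize runMoves w [r, (P.enc c * r'.1 * (P.enc c)⁻¹, P.enc c * r'.2 * (P.enc c)⁻¹)] = L
    at hw hrun hc'
  rcases L with _ | ⟨⟨a, b⟩, _ | ⟨⟨c, d⟩, _ | _⟩⟩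
  · simp [hasTrivialEntry] at hw
  · simp [hasTrivialEntry] at hw
  · rw [isCoded_cons, isCoded_singleton] at hc'
    simp only [hasTrivialEntry, Bool.or_eq_true, beq_iff_eq] at hw
    have key : P.dec a = 1 ∨ P.dec b = 1 ∨ P.dec c = 1 ∨ P.dec d = 1 ∨ P.dec b * P.dec d = 1 := by
      rw [← dec_mul hc'.1.2 hc'.2.2]
      rcases hw with (((h | h) | h) | h) | h <;> simp [h, P.dec_one]
    obtain ⟨x, p, hx⟩ := HandleEquiv.exists_one_of_entry [] key
    exact ⟨x, p, hrun.trans hx⟩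
  · simp [hasTrivialEntry] at hw

/-- Checking the head of every tail treats each unordered pair once, hence the disjunction. -/
theorem mergesPair_of_mergesHead {codes : List PermCode} {l : List (PermCode × PermCode)}
    (h : ∀ i < l.length, R.mergesHead codes (l.drop i) = true) {r r' : PermCode × PermCode}
    (hr : r ∈ l) (hr' : r' ∈ l) :
    R.mergesPair codes r r' = true ∨ R.mergesPair codes r' r = true := by
  induction l with
  | nil => simp at hr
  | cons s l ih =>
    have h₀ := h 0 (by simp)
    simp only [List.drop_zero, mergesHead, List.all_eq_true] at h₀
    rcases List.mem_cons.1 hr with rfl | hr₁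
    · exact Or.inl (h₀ r' hr')
    rcases List.mem_cons.1 hr' with rfl | hr₂
    · exact Or.inr (h₀ r hr)
    · exact ih (fun i hi => h (i + 1) (by simpa using hi)) hr₁ hr₂

theorem conjEquiv_of_isLinked (hR : P.HasCodes R) {L M : List (PermCode × PermCode)}
    (hL : P.IsCoded L) (hM : P.IsCoded M) (h : R.isLinked L M = true) :
    P.decode L ∼ᶜ P.decode M := by
  simp only [isLinked, List.any_eq_true] at h
  obtain ⟨l, hl, h⟩ := h
  exact conjEquiv_of_isConj (hR.links l hl) hL hM h

theorem exists_form (hR : P.HasCodes R) {L : List (PermCode × PermCode)} (hL : P.IsCoded L)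
    (h : R.hasForm L = true) : ∃ F ∈ R.forms ++ R.linkedForms, P.decode L ∼ᶜ P.decode F.list := by
  simp only [hasForm, List.any_eq_true] at h
  obtain ⟨F, hF, h⟩ := h
  exact ⟨F, hF, conjEquiv_of_isLinked hR hL (hR.list hF) h⟩

theorem decode_pair (x y a b : PermCode) :
    P.decode [(x, y), (a, b)] = [(P.dec x, P.dec y), (P.dec a, P.dec b)] := rfl

/-- Slides multiply `a` on both sides by the group that the entries of `r` generate, so one element
of each double coset suffices. -/
theorem exists_form_of_commuting (hR : P.HasCodes R) (h : R.reducesCommuting P.codes = true)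
    {r : PermCode × PermCode} (hr : r ∈ R.reps)
    (hcomm : P.dec r.1 * P.dec r.2 = P.dec r.2 * P.dec r.1) (a : G) :
    ∃ F ∈ R.forms ++ R.linkedForms, [(a, 1), Prod.map P.dec P.dec r] ∼ᶜ P.decode F.list := by
  simp only [reducesCommuting, List.all_eq_true, Bool.or_eq_true, Bool.not_eq_true',
    List.any_eq_true, Bool.and_eq_true, List.elem_eq_mem, decide_eq_true_eq, beq_iff_eq] at h
  have hrc := hR.reps r hr
  rcases h r hr with h | ⟨k, hk, ⟨hkr, hb⟩, hcov⟩
  · rw [← dec_mul hrc.1 hrc.2, ← dec_mul hrc.2 hrc.1,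
      dec_eq_iff (mul_mem hrc.1 hrc.2) (mul_mem hrc.2 hrc.1)] at hcomm
    simp [hcomm] at h
  · obtain ⟨b, hbk, hab⟩ := hcov _ (P.enc_mem a)
    have hbc := hR.commuting k hk b hbk
    obtain ⟨F, hF, e⟩ := exists_form hR
      (isCoded_cons.2 ⟨⟨hbc, P.one_mem⟩, isCoded_singleton.2 hrc⟩) (hb b hbk)
    refine ⟨F, hF, ConjEquiv.trans (HandleEquiv.conjEquiv ?_) e⟩
    have hK : ∀ g ∈ [r.1, r.2], P.dec g ∈ handleClosure [Prod.map P.dec P.dec r] := by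
      intro g hg
      refine Subgroup.subset_closure ⟨_, List.mem_singleton_self _, ?_⟩
      simp only [List.mem_cons, List.not_mem_nil, or_false] at hg
      rcases hg with rfl | rfl
      · exact Or.inl rfl
      · exact Or.inr rfl
    obtain ⟨s, hs, t, ht, e⟩ := mem_of_mem_doubleCoset
      (by simpa using hrc) _ hK hbc hab
    rw [P.dec_enc] at e
    rw [e, show P.decode [(b, 1), r] = [(P.dec b, 1), Prod.map P.dec P.dec r] by
      simp [decode, Prod.map, P.dec_one]]
    exact ((HandleEquiv.slide_left _ hs).trans (HandleEquiv.slide _ ht)).symm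

theorem mem_handleClosure_of_mem_gens {F : CodedForm} {g : PermCode} (hg : g ∈ F.gens) :
    P.dec g ∈ handleClosure (P.decode F.list) := by
  simp only [CodedForm.gens, List.mem_cons, List.not_mem_nil, or_false] at hg
  rcases hg with rfl | rfl | rfl
  · exact Subgroup.subset_closure ⟨(P.dec F.x, P.dec 1), by simp [decode, CodedForm.list], Or.inl rfl⟩
  · exact Subgroup.subset_closure ⟨Prod.map P.dec P.dec F.p, by simp [decode, CodedForm.list],
      Or.inl rfl⟩
  · exact Subgroup.subset_closure ⟨Prod.map P.dec P.dec F.p, by simp [decode, CodedForm.list],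
      Or.inr rfl⟩

theorem handleEquiv_of_mem_coset (hR : P.HasCodes R) {F : CodedForm}
    (hF : F ∈ R.forms ++ R.linkedForms) (h : coversCosets P.codes F = true) (e : G) :
    ∃ b ∈ 1 :: F.cosets, (e, 1) :: P.decode F.list ∼ₕ (P.dec b, 1) :: P.decode F.list := by
  simp only [coversCosets, List.all_eq_true, List.any_eq_true, List.elem_eq_mem,
    decide_eq_true_eq] at h
  obtain ⟨b, hb, he⟩ := h _ (P.enc_mem e)
  refine ⟨b, hb, ?_⟩
  have hbc : b ∈ P.codes := by
    rcases List.mem_cons.1 hb with rfl | hb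
    · exact P.one_mem
    · exact hR.cosets F hF b hb
  obtain ⟨s, hs, t, ht, e'⟩ := mem_of_mem_doubleCoset (hR.gens F hF) _
    (fun g hg => mem_handleClosure_of_mem_gens hg) hbc he
  rw [P.dec_enc] at e'
  rw [e']
  exact ((HandleEquiv.slide_left _ hs).trans (HandleEquiv.slide _ ht)).symm

/-- In the presence of `(b, 1)`, either `F.x` or, if `F.p` has trivial second entry, `F.p.1` lies in
the group generated by the entries of the other two handles and slides to 1. -/
theorem exists_trivial_of_absorbs {F : CodedForm} {b : PermCode}
    (hF : ∀ g ∈ F.gens, g ∈ P.codes) (hb : b ∈ P.codes) (h : absorbs F b = true) :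
    ∃ p q, (P.dec b, 1) :: P.decode F.list ∼ₕ [(1, 1), p, q] := by
  obtain ⟨x, ⟨u, v⟩, l⟩ := F
  simp only [CodedForm.gens, List.forall_mem_cons] at hF
  obtain ⟨hx, hu, hv, -⟩ := hF
  simp only [absorbs, Bool.or_eq_true, Bool.and_eq_true, List.elem_eq_mem, decide_eq_true_eq,
    beq_iff_eq] at h
  simp only [CodedForm.list, decode_pair, P.dec_one]
  rcases h with h | ⟨rfl, h⟩
  · refine ⟨_, _, (HandleEquiv.swap _ _ _).trans (HandleEquiv.slide_to_one ?_)⟩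
    refine mem_of_mem_span (by simp [hb, hu, hv]) _ ?_ h
    simp only [List.forall_mem_cons]
    exact ⟨Subgroup.subset_closure ⟨(P.dec b, 1), by simp, Or.inl rfl⟩,
      Subgroup.subset_closure ⟨(P.dec u, P.dec v), by simp, Or.inl rfl⟩,
      Subgroup.subset_closure ⟨(P.dec u, P.dec v), by simp, Or.inr rfl⟩, by simp⟩
  · rw [P.dec_one]
    refine ⟨_, _, (((HandleEquiv.swap (P.dec x) _ []).cons (P.dec b, 1)).trans
      (HandleEquiv.swap (P.dec b) _ _)).trans (HandleEquiv.slide_to_one ?_)⟩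
    refine mem_of_mem_span (by simp [hb, hx]) _ ?_ h
    simp only [List.forall_mem_cons]
    exact ⟨Subgroup.subset_closure ⟨(P.dec b, 1), by simp, Or.inl rfl⟩,
      Subgroup.subset_closure ⟨(P.dec x, 1), by simp, Or.inl rfl⟩, by simp⟩

theorem exists_trivial (hR : P.HasCodes R) (h : R.absorbsAll P.codes = true) {F : CodedForm}
    (hF : F ∈ R.forms ++ R.linkedForms) (e : G) :
    ∃ p q, (e, 1) :: P.decode F.list ∼ᶜ [(1, 1), p, q] := by
  simp only [absorbsAll, Bool.and_eq_true, List.all_eq_true, Bool.or_eq_true,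
    List.any_eq_true] at h
  have main : ∀ F ∈ R.forms, ∀ e, ∃ p q, (e, 1) :: P.decode F.list ∼ₕ [(1, 1), p, q] := by
    intro F hF e
    have hF' : F ∈ R.forms ++ R.linkedForms := List.mem_append_left _ hF
    obtain ⟨b, hb, he⟩ := handleEquiv_of_mem_coset hR hF' (h.1 F hF).1 e
    rcases List.mem_cons.1 hb with rfl | hb
    · exact ⟨_, _, P.dec_one ▸ he⟩
    · obtain ⟨p, q, he'⟩ := exists_trivial_of_absorbs (hR.gens F hF') (hR.cosets F hF' b hb)
        ((h.1 F hF).2 b hb)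
      exact ⟨p, q, he.trans he'⟩
  rcases List.mem_append.1 hF with hF₁ | hF₁
  · obtain ⟨p, q, he⟩ := main F hF₁ e
    exact ⟨p, q, he.conjEquiv⟩
  obtain ⟨hc, hcos⟩ := h.2 F hF₁
  obtain ⟨b, hb, he⟩ := handleEquiv_of_mem_coset hR hF hc e
  rcases List.mem_cons.1 hb with rfl | hb
  · exact ⟨_, _, (P.dec_one ▸ he).conjEquiv⟩
  have hbc := hR.cosets F hF b hb
  rcases hcos b hb with h' | ⟨F', hF', hl⟩
  · obtain ⟨p, q, he'⟩ := exists_trivial_of_absorbs (hR.gens F hF) hbc h'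
    exact ⟨p, q, (he.trans he').conjEquiv⟩
  -- The roles change here: `(b, 1)` and `F.p` form the pair to be reduced, and `F.x` becomes the
  -- further handle.
  · have hp := (isCoded_cons.1 (hR.list hF)).2
    have l := conjEquiv_of_isLinked hR (isCoded_cons.2 ⟨⟨hbc, P.one_mem⟩, hp⟩)
      (hR.list (List.mem_append_left _ hF')) hl
    obtain ⟨x, hx⟩ := l.exists_cons (P.dec F.x)
    obtain ⟨p, q, he'⟩ := main F' hF' x
    refine ⟨p, q, ((he.trans ?_).conjEquiv.trans hx).trans he'.conjEquiv⟩
    simp only [decode, CodedForm.list, List.map_cons, List.map_nil, Prod.map, P.dec_one]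
    exact HandleEquiv.swap _ _ _

/-- The enumerated set is verified to contain 1 and to be closed under right multiplication by the
generators and their inverses. It therefore contains the generated group, yet it misses some code.
-/
theorem handleClosure_ne_top_of_isProper {F : CodedForm} (hF : ∀ g ∈ F.gens, g ∈ P.codes)
    (h : isProper P.codes F = true) : handleClosure (P.decode F.list) ≠ ⊤ := by
  simp only [isProper, Bool.and_eq_true, List.all_eq_true, List.any_eq_true, List.elem_eq_mem,
    decide_eq_true_eq, Bool.not_eq_true', decide_eq_false_iff_not] at h
  obtain ⟨⟨h1, hmul⟩, c, hc, hcS⟩ := h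
  intro htop
  refine hcS ?_
  have key : ∀ x ∈ handleClosure (P.decode F.list), P.enc x ∈ PermCode.doubleCoset F.gens 1 := by
    intro x hx
    have gen : ∀ y, (∃ p ∈ P.decode F.list, y = p.1 ∨ y = p.2) → y = 1 ∨ P.enc y ∈ F.gens := by
      have hg := fun g hg => P.enc_dec g (hF g hg)
      simp only [CodedForm.gens, List.forall_mem_cons] at hg
      simp only [decode, CodedForm.list, List.map_cons, List.map_nil, List.mem_cons,
        List.not_mem_nil, or_false, CodedForm.gens]
      rintro y ⟨p, rfl | rfl, rfl | rfl⟩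
      · exact Or.inr (Or.inl hg.1)
      · exact Or.inl P.dec_one
      · exact Or.inr (Or.inr (Or.inl hg.2.1))
      · exact Or.inr (Or.inr (Or.inr hg.2.2.1))
    refine Subgroup.closure_induction_right (p := fun x _ => P.enc x ∈ PermCode.doubleCoset F.gens 1)
      ?_ ?_ ?_ hx
    · rwa [P.enc_one]
    · intro x _ y hy hx
      rcases gen y hy with rfl | hy
      · rwa [mul_one]
      · rw [P.enc_mul]
        exact (hmul _ hx _ hy).1
    · intro x _ y hy hx
      rcases gen y hy with rfl | hy
      · rwa [inv_one, mul_one]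
      · rw [P.enc_mul, P.enc_inv]
        exact (hmul _ hx _ hy).2
  have := key (P.dec c) (htop ▸ Subgroup.mem_top _)
  rwa [P.enc_dec c hc] at this

end PermCoding

theorem handleClosure_append_replicate_le {G : Type*} [Group G] (L : List (G × G)) (m : ℕ) :
    handleClosure (L ++ List.replicate m (1, 1)) ≤ handleClosure L := by
  rw [handleClosure, Subgroup.closure_le]
  rintro x ⟨p, hp, h⟩
  rcases List.mem_append.1 hp with hp | hp
  · exact Subgroup.subset_closure ⟨p, hp, h⟩
  · obtain rfl := List.eq_of_mem_replicate hp
    obtain rfl : x = 1 := by simpa using h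
    exact one_mem _

theorem PermCoding.hasTwoOrbitsByLifting {G : Type} [Group G] (P : PermCoding G)
    (R : HandleReduction) {x y a u v : PermCode} (hcodes : R.isCoded P.codes = true)
    (hinv : R.reachesInvolution P.codes = true) (hcov : R.coversInvolutions P.codes = true)
    (hrep : R.reachesRepresentative P.codes = true)
    (hpair : ∀ i < R.reps.length, R.mergesHead P.codes (R.reps.drop i) = true)
    (hred : R.reducesPairs = true)
    (hcomm : R.reducesCommuting P.codes = true) (habs : R.absorbsAll P.codes = true)
    (honly : R.onlyGenerate P.codes x y a u v = true)
    (hgen : HandleReduction.generates P.codes x y a u v = true)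
    (hspin : HasNoncommutingLifts (P.dec u) (P.dec v)) {g : ℕ} (hg : 2 ≤ g) :
    HasTwoOrbitsByLifting g G := by
  have hR := hasCodes_of_isCoded hcodes
  simp only [HandleReduction.generates, Bool.and_eq_true, List.all_eq_true, List.elem_eq_mem,
    decide_eq_true_eq, beq_iff_eq, Bool.not_eq_true', beq_eq_false_iff_ne, List.forall_mem_cons]
    at hgen
  obtain ⟨⟨⟨⟨⟨⟨⟨⟨⟨⟨hx, hy, ha, hu, hv, -⟩, hxy⟩, hauv⟩, hne⟩, huu⟩, hvv⟩, huv⟩, hu1⟩, hv1⟩, hne'⟩ :=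
    hgen
  have ne_one : ∀ {c}, c ∈ P.codes → c ≠ 1 → P.dec c ≠ 1 := fun hc h e =>
    h ((dec_eq_iff hc P.one_mem).1 (e.trans P.dec_one.symm))
  have top : ∀ (gens : List PermCode) (K : Subgroup G), (∀ c ∈ gens, c ∈ P.codes) →
      (∀ c ∈ P.codes, c ∈ PermCode.doubleCoset gens 1) → (∀ c ∈ gens, P.dec c ∈ K) → K = ⊤ := by
    intro gens K h1 h2 h3
    refine eq_top_iff.2 fun z _ => ?_
    rw [← P.dec_enc z]
    exact mem_of_mem_span h1 K h3 (h2 _ (P.enc_mem z))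
  obtain ⟨m, rfl⟩ := Nat.exists_eq_add_of_le' hg
  refine hasTwoOrbitsByLifting_of_normalForms hg (P.dec x) (P.dec y) (P.dec a) (P.dec u) (P.dec v)
    (by rw [← dec_mul hu hu, huu, P.dec_one]) (by rw [← dec_mul hv hv, hvv, P.dec_one])
    (by rw [← dec_mul hu hv, huv, dec_mul hv hu]) (ne_one hu hu1) (ne_one hv hv1)
    (fun e => hne' ((dec_eq_iff hu hv).1 e)) ?_ ?_ ?_ hspin
  · refine top [x, y] _ (by simp [hx, hy]) hxy ?_
    simp only [List.forall_mem_cons]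
    exact ⟨Subgroup.subset_closure ⟨(P.dec x, 1), by simp [freeForm], Or.inl rfl⟩,
      Subgroup.subset_closure ⟨(P.dec y, 1), by simp [freeForm], Or.inl rfl⟩, by simp⟩
  · refine top [a, u, v] _ (by simp [ha, hu, hv]) hauv ?_
    simp only [List.forall_mem_cons]
    exact ⟨Subgroup.subset_closure ⟨(P.dec a, 1), by simp [kleinForm], Or.inl rfl⟩,
      Subgroup.subset_closure ⟨(P.dec u, P.dec v), by simp [kleinForm], Or.inl rfl⟩,
      Subgroup.subset_closure ⟨(P.dec u, P.dec v), by simp [kleinForm], Or.inr rfl⟩, by simp⟩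
  intro L hL hprod htop
  have reduction := exists_normalForm_of_representatives (P.decode R.reps)
    ((R.forms ++ R.linkedForms).map fun F => P.decode F.list)
    (exists_representative hR hinv hcov hrep)
    (by
      intro r hr r' hr'
      obtain ⟨s, hs, rfl⟩ := List.mem_map.1 hr
      obtain ⟨s', hs', rfl⟩ := List.mem_map.1 hr'
      exact (mergesPair_of_mergesHead hpair hs hs').imp
        (fun h => exists_trivial_of_mergesPair (hR.reps s hs) (hR.reps s' hs') h)
        (fun h => exists_trivial_of_mergesPair (hR.reps s' hs') (hR.reps s hs) h))
    (by
      intro r hr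
      obtain ⟨s, hs, rfl⟩ := List.mem_map.1 hr
      simp only [HandleReduction.reducesPairs, List.all_eq_true] at hred
      have hsc := hR.reps s hs
      have hL : P.IsCoded [(s.1, 1), (s.2, 1)] :=
        isCoded_cons.2 ⟨⟨hsc.1, P.one_mem⟩, isCoded_singleton.2 ⟨hsc.2, P.one_mem⟩⟩
      obtain ⟨F, hF, e⟩ := exists_form hR hL (hred s hs)
      rw [decode_pair, P.dec_one] at e
      exact ⟨_, List.mem_map_of_mem hF, e⟩)
    (by
      intro r hr hc z
      obtain ⟨s, hs, rfl⟩ := List.mem_map.1 hr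
      obtain ⟨F, hF, e⟩ := exists_form_of_commuting hR hcomm hs hc z
      exact ⟨_, List.mem_map_of_mem hF, e⟩)
    (by
      intro N hN e
      obtain ⟨F, hF, rfl⟩ := List.mem_map.1 hN
      exact exists_trivial hR habs hF e)
    m L hL hprod
  rcases reduction with ⟨z, hz⟩ | ⟨N, hN, hLN⟩
  -- This normal form generates a cyclic group, whereas `x` and `y` do not commute.
  · exfalso
    have hcl := hz.handleClosure_eq_top htop
    have hle : handleClosure ((z, (1 : G)) :: List.replicate (m + 1) (1, 1)) ≤
        Subgroup.zpowers z := by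
      refine (handleClosure_append_replicate_le [(z, 1)] (m + 1)).trans ?_
      rw [handleClosure, Subgroup.closure_le]
      rintro w ⟨p, hp, h⟩
      obtain rfl := List.mem_singleton.1 hp
      rcases h with rfl | rfl
      · exact Subgroup.mem_zpowers _
      · exact (Subgroup.zpowers _).one_mem
    rw [hcl, top_le_iff] at hle
    obtain ⟨i, hi⟩ := Subgroup.mem_zpowers_iff.1 (hle ▸ Subgroup.mem_top (P.dec x))
    obtain ⟨j, hj⟩ := Subgroup.mem_zpowers_iff.1 (hle ▸ Subgroup.mem_top (P.dec y))
    refine hne ((dec_eq_iff (mul_mem hx hy) (mul_mem hy hx)).1 ?_)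
    rw [dec_mul hx hy, dec_mul hy hx, ← hi, ← hj, ← zpow_add, ← zpow_add, add_comm]
  · obtain ⟨F, hF, rfl⟩ := List.mem_map.1 hN
    have hcl : handleClosure (P.decode F.list) = ⊤ := top_le_iff.1
      ((hLN.handleClosure_eq_top htop).symm.le.trans (handleClosure_append_replicate_le _ _))
    simp only [HandleReduction.onlyGenerate, List.all_eq_true, Bool.or_eq_true, Bool.and_eq_true,
      beq_iff_eq] at honly
    rcases honly F hF with (⟨h1, h2⟩ | ⟨h1, h2⟩) | h
    · refine Or.inl ?_
      simpa [CodedForm.list, h1, h2, decode_pair, P.dec_one, freeForm] using hLN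
    · refine Or.inr ?_
      simpa [CodedForm.list, h1, h2, decode_pair, P.dec_one, kleinForm] using hLN
    · exact absurd hcl (handleClosure_ne_top_of_isProper (hR.gens F hF) h)

/-! ### Data for the alternating and symmetric groups

The letters `A`, `B`, `C`, `D` stand for the twists of the first and of the second handle, and `Z`
for the twist that mixes them; small letters denote inverses. -/

namespace HandleWord

/-- The first twist of the first handle. -/
def A : ℕ × HandleMove := (0, .A)

/-- The inverse of `A`. -/
def a : ℕ × HandleMove := (0, HandleMove.A.inv)

/-- The second twist of the first handle. -/
def B : ℕ × HandleMove := (0, .B)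

/-- The inverse of `B`. -/
def b : ℕ × HandleMove := (0, HandleMove.B.inv)

/-- The first twist of the second handle. -/
def C : ℕ × HandleMove := (1, .A)

/-- The inverse of `C`. -/
def c : ℕ × HandleMove := (1, HandleMove.A.inv)

/-- The second twist of the second handle. -/
def D : ℕ × HandleMove := (1, .B)

/-- The inverse of `D`. -/
def d : ℕ × HandleMove := (1, HandleMove.B.inv)

/-- The twist that mixes both handles. -/
def Z : ℕ × HandleMove := (0, .Z)

/-- The inverse of `Z`. -/
def z : ℕ × HandleMove := (0, HandleMove.Z.inv)

end HandleWord

namespace HandleReduction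

section data

/-- A numeral with five digits denotes the permutation with these values. -/
local instance (n : ℕ) : OfNat PermCode n := ⟨PermCode.ofDigits n⟩

/-- The codes of the alternating group of degree four. -/
def alternatingFourCodes : List PermCode := [
    01234, 02314, 03124, 10324, 12034, 13204, 20134, 21304, 23014,
    30214, 31024, 32104]

open HandleWord in
/-- The reduction of handles in the alternating group of degree four. -/
def alternatingFour : HandleReduction where
  involutions := [10324]
  handleMoves := [[B, a], [], [A], [a]]
  involutionMoves := [[], [B], [A, B, A]]
  conjugators := [01234, 10324, 03124, 12034, 21304, 30214]
  reps := [(02314, 10324), (23014, 10324)]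
  pairMoves := [[], [Z], [C, D, C], [A, B, A]]
  links := [([], 01234), ([A, B, A], 01234)]
  commuting := [((23014, 10324), [01234, 02314, 03124])]
  forms := [
      ⟨23014, (10324, 01234), [02314, 03124]⟩, ⟨02314, (10324, 01234), []⟩,
      ⟨01234, (23014, 10324), [02314, 03124]⟩, ⟨02314, (23014, 10324), []⟩]
  linkedForms := []

/-- The codes of the symmetric group of degree four. -/
def symmetricFourCodes : List PermCode := [
    01234, 01324, 02134, 02314, 03124, 03214, 10234, 10324, 12034, 12304, 13024, 13204, 20134,
    20314, 21034, 21304, 23014, 23104, 30124, 30214, 31024, 31204, 32014, 32104]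

open HandleWord in
/-- The reduction of handles in the symmetric group of degree four. -/
def symmetricFour : HandleReduction where
  involutions := [01324, 10324]
  handleMoves := [[B, a], [], [A], [B, A], [a], [A, A]]
  involutionMoves := [[], [B], [A, B], [A], [A, B, A]]
  conjugators := [01234, 01324, 10234, 10324, 02314, 03214, 20134, 21034, 23014]
  reps := [
      (02134, 01324), (12034, 01324), (10234, 01324), (02134, 10324), (02314, 10324),
      (23014, 10324)]
  pairMoves := [
      [Z], [c, Z, c], [Z, Z, a, C], [C, D, Z, c], [a, B, z, A], [A, z, C, D], [B, A, z, A, C],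
      [D, C, Z, A], [B, a, Z, c, d], [z, a, z], [], [A, z, c, z, a], [B, a, C, z, C],
      [B, A, c, Z, c], [Z, A, c], [D, z, a, C]]
  links := [
      ([], 01234), ([A, B, A], 01234), ([A, B, C, D, Z, A, B, C, D, z, A], 01234),
      ([A, B, D, Z, A, B, C, D, z, A], 03214), ([A, B, Z, A, B, C, D, z, A], 02314)]
  commuting := [
      ((23014, 10324), [01234, 02314, 03124, 01324, 02134, 03214]),
      ((10234, 01324), [01234, 23014, 02134])]
  forms := [
      ⟨02134, (01324, 01234), [12034]⟩, ⟨10234, (01324, 01234), [02314, 23014]⟩,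
      ⟨02134, (10324, 01234), [12304]⟩, ⟨02314, (10324, 01234), [10234]⟩,
      ⟨23014, (10324, 01234), [01324, 02134, 02314, 03124, 03214]⟩, ⟨12034, (01324, 01234), []⟩,
      ⟨01234, (23014, 10324), [01324, 02134, 02314, 03124, 03214]⟩,
      ⟨01234, (10234, 01324), [02134, 23014]⟩, ⟨23014, (10234, 01324), [02134]⟩,
      ⟨02134, (10234, 01324), []⟩]
  linkedForms := [⟨02314, (23014, 10324), [01324]⟩]

/-- The codes of the alternating group of degree five. -/
def alternatingFiveCodes : List PermCode := [
    01234, 01342, 01423, 02143, 02314, 02431, 03124, 03241, 03412, 04132, 04213, 04321, 10243,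
    10324, 10432, 12034, 12340, 12403, 13042, 13204, 13420, 14023, 14230, 14302, 20134, 20341,
    20413, 21043, 21304, 21430, 23014, 23140, 23401, 24031, 24103, 24310, 30142, 30214, 30421,
    31024, 31240, 31402, 32041, 32104, 32410, 34012, 34120, 34201, 40123, 40231, 40312, 41032,
    41203, 41320, 42013, 42130, 42301, 43021, 43102, 43210]

open HandleWord in
/-- The reduction of handles in the alternating group of degree five. -/
def alternatingFive : HandleReduction where
  involutions := [02143]
  handleMoves := [[B, a], [], [A], [a], [A, A], [a, a], [B, A], [b, a], [A, B, A]]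
  involutionMoves := [[], [B], [A, B, A]]
  conjugators := [01234, 02143, 03412, 04321, 01423, 02314, 03241, 04132]
  reps := [
      (01342, 02143), (03412, 02143), (10243, 02143), (10324, 02143), (10432, 02143),
      (12340, 02143), (12403, 02143), (13420, 02143)]
  pairMoves := [
      [], [z], [a, Z], [B, Z], [Z, A, b, Z, a, C], [z, z, a, B, B, z], [a, b, a], [z, z],
      [a, b, a, D, z], [B, a], [A, B, A, D, Z], [B, a, z], [Z, a, B, B, a, Z], [c, Z, A, Z, C],
      [C, Z], [A, C, z, c, z, A], [z, A, b, b, A], [a, D, C, Z, a, b], [a, c, z],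
      [z, a, B, B, a, z], [a, B, C, Z, C], [B, A, C, D, C, Z], [A, A, B, a, a, z],
      [z, A, b, b, A, Z], [a, a, b, a, a], [A, b, b, A, z, z], [A, C], [Z, A, b, b, A, z],
      [A, Z, a, b], [a, z, A, A], [B, a, a, Z], [A, c, d, Z, Z, a], [z, A], [a, D, Z, Z, a],
      [B, A, c, z, a], [C, Z, A], [Z, A, Z, a, b, a], [z, c, d, c, z, A], [B, a, C, D, C, Z],
      [B, D, Z, A, C, Z], [C, D, C, z, z, a], [a, C], [D, Z, C, Z, A], [A, b, z, A],
      [C, d, d, C, Z, a], [A, b, Z, Z, A, Z], [A, C, C, z, A, B], [A, z, z, c, z, A],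
      [a, B, A, Z, A, A], [B, a, c, z], [A, Z, A, B, A], [a, b, b, Z, a], [C, z, a, c, z],
      [A, C, Z, C, Z, a], [A, z, A, C, Z, C], [B, C, z, a, z, C], [B, A, c, z], [B, a, C, C],
      [B, Z, A, C], [A, B, z, A, A], [B, a, z, A, C]]
  links := [
      ([], 01234), ([A, A, Z, C, D, C, C, Z, Z, a], 23140), ([A, A, B, A], 02143),
      ([A, B, A], 01234), ([C, D], 01423), ([D, C], 01342)]
  commuting := [((03412, 02143), [01234, 01342, 01423, 10243, 10324, 10432])]
  forms := [
      ⟨01342, (02143, 01234), [12034]⟩,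
      ⟨03412, (02143, 01234), [01342, 01423, 12034, 12340, 12403]⟩,
      ⟨10243, (02143, 01234), [02314, 13420]⟩, ⟨10324, (02143, 01234), [02431]⟩,
      ⟨10432, (02143, 01234), [02314]⟩, ⟨12340, (02143, 01234), []⟩,
      ⟨01234, (03412, 02143), [01342, 01423, 10243, 10324, 10432]⟩,
      ⟨01342, (03412, 02143), [10243]⟩, ⟨10243, (03412, 02143), []⟩]
  linkedForms := []

end data

end HandleReduction

/-! ### The projective representation of the symmetric group of degree five -/

section projective

open Matrix Equiv

/-- Invertible matrices over the field with five elements. -/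
abbrev GLTwoFive : Type := (Matrix (Fin 2) (Fin 2) (ZMod 5))ˣ

/-- The matrices that represent the adjacent transpositions. -/
def transpositionMatrix : ℕ → GLTwoFive
  | 0 => ⟨!![0, 1; 2, 0], !![0, 3; 1, 0], by decide, by decide⟩
  | 1 => ⟨!![1, 1; 1, 4], !![3, 3; 3, 2], by decide, by decide⟩
  | 2 => ⟨!![0, 1; 3, 0], !![0, 2; 1, 0], by decide, by decide⟩
  | _ => ⟨!![1, 2; 1, 4], !![2, 4; 2, 3], by decide, by decide⟩

/-- Insert `x` into a sorted list at position `i`, with the indices of the adjacent transpositions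
that are used. -/
def insertWord : ℕ → ℕ → List ℕ → List ℕ × List ℕ
  | _, x, [] => ([x], [])
  | i, x, y :: t =>
    bif Nat.ble x y then (x :: y :: t, []) else
      ((y :: (insertWord (i + 1) x t).1), (insertWord (i + 1) x t).2 ++ [i])

/-- Sort a list that starts at position `i`, with the indices of the adjacent transpositions that
are used. -/
def sortWord : ℕ → List ℕ → List ℕ × List ℕ
  | _, [] => ([], [])
  | i, x :: t => ((insertWord i x (sortWord (i + 1) t).1).1,
      (insertWord i x (sortWord (i + 1) t).1).2 ++ (sortWord (i + 1) t).2)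

/-- A matrix that represents the permutation with given values. -/
def matrixLift (l : List ℕ) : GLTwoFive := ((sortWord 0 l).2.map transpositionMatrix).prod

/-- Multiplication of matrices over the field with five elements, on representatives of the
entries. -/
def natMatrixMul (x y : ℕ × ℕ × ℕ × ℕ) : ℕ × ℕ × ℕ × ℕ :=
  ((x.1 * y.1 + x.2.1 * y.2.2.1) % 5, (x.1 * y.2.1 + x.2.1 * y.2.2.2) % 5,
    (x.2.2.1 * y.1 + x.2.2.2 * y.2.2.1) % 5, (x.2.2.1 * y.2.1 + x.2.2.2 * y.2.2.2) % 5)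

/-- The matrix with given representatives of the entries. -/
def ofNatMatrix (x : ℕ × ℕ × ℕ × ℕ) : Matrix (Fin 2) (Fin 2) (ZMod 5) :=
  !![(x.1 : ZMod 5), x.2.1; x.2.2.1, x.2.2.2]

theorem ofNatMatrix_mul (x y : ℕ × ℕ × ℕ × ℕ) :
    ofNatMatrix (natMatrixMul x y) = ofNatMatrix x * ofNatMatrix y := by
  have h : ∀ n : ℕ, ((n % 5 : ℕ) : ZMod 5) = n := fun n => ZMod.natCast_mod n 5
  simp [ofNatMatrix, natMatrixMul, h]

/-- Representatives of the entries of `transpositionMatrix`. -/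
def transpositionEntries : ℕ → ℕ × ℕ × ℕ × ℕ
  | 0 => (0, 1, 2, 0)
  | 1 => (1, 1, 1, 4)
  | 2 => (0, 1, 3, 0)
  | _ => (1, 2, 1, 4)

/-- Representatives of the entries of `matrixLift`. -/
def entriesLift (l : List ℕ) : ℕ × ℕ × ℕ × ℕ :=
  (sortWord 0 l).2.foldr (fun i => natMatrixMul (transpositionEntries i)) (1, 0, 0, 1)

theorem ofNatMatrix_transpositionEntries (i : ℕ) :
    ofNatMatrix (transpositionEntries i) = (transpositionMatrix i).1 := by
  rcases i with _ | _ | _ | i <;> simp [ofNatMatrix, transpositionEntries, transpositionMatrix]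

theorem ofNatMatrix_entriesLift (l : List ℕ) : ofNatMatrix (entriesLift l) = (matrixLift l).1 := by
  unfold entriesLift matrixLift
  induction (sortWord 0 l).2 with
  | nil => simp [ofNatMatrix, Matrix.one_fin_two]
  | cons i w ih =>
    rw [List.foldr_cons, ofNatMatrix_mul, ih, ofNatMatrix_transpositionEntries]
    rfl

/-- Matrices are proportional, on representatives of the entries. -/
def isProportional (x y : ℕ × ℕ × ℕ × ℕ) : Bool :=
  [1, 2, 3, 4].any fun k => x == (k * y.1 % 5, k * y.2.1 % 5, k * y.2.2.1 % 5, k * y.2.2.2 % 5)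

theorem exists_smul_of_isProportional {l m : List ℕ} {i : ℕ}
    (h : isProportional (entriesLift l)
      (natMatrixMul (entriesLift m) (transpositionEntries i)) = true) :
    ∃ c : ZMod 5, (matrixLift l).1 = c • ((matrixLift m).1 * (transpositionMatrix i).1) := by
  have hmod : ∀ n : ℕ, ((n % 5 : ℕ) : ZMod 5) = n := fun n => ZMod.natCast_mod n 5
  simp only [isProportional, List.any_eq_true, beq_iff_eq] at h
  obtain ⟨k, -, h⟩ := h
  refine ⟨k, ?_⟩
  rw [← ofNatMatrix_entriesLift, ← ofNatMatrix_entriesLift,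
    ← ofNatMatrix_transpositionEntries, ← ofNatMatrix_mul, h]
  simp [ofNatMatrix, hmod]

/-- Multiplicativity up to scalars is checked only for right multiplication by adjacent
transpositions. This suffices because they generate the symmetric group. -/
theorem isProportional_entriesLift : ∀ a b c d e : Fin 5, [a, b, c, d, e].Nodup →
    (isProportional (entriesLift [b, a, c, d, e])
      (natMatrixMul (entriesLift [a, b, c, d, e]) (transpositionEntries 0)) &&
    isProportional (entriesLift [a, c, b, d, e])
      (natMatrixMul (entriesLift [a, b, c, d, e]) (transpositionEntries 1)) &&
    isProportional (entriesLift [a, b, d, c, e])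
      (natMatrixMul (entriesLift [a, b, c, d, e]) (transpositionEntries 2)) &&
    isProportional (entriesLift [a, b, c, e, d])
      (natMatrixMul (entriesLift [a, b, c, d, e]) (transpositionEntries 3))) = true := by
  decide +kernel

/-- The values of a permutation. -/
def permValues (σ : Perm (Fin 5)) : List ℕ := [σ 0, σ 1, σ 2, σ 3, σ 4]

/-- A matrix that represents a permutation. -/
def permMatrixLift (σ : Perm (Fin 5)) : GLTwoFive := matrixLift (permValues σ)

theorem permMatrixLift_mul_swap (σ : Perm (Fin 5)) (i : Fin 4) :
    ∃ c : ZMod 5, (permMatrixLift (σ * swap i.castSucc i.succ)).1 =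
      c • ((permMatrixLift σ).1 * (permMatrixLift (swap i.castSucc i.succ)).1) := by
  have hσ : [σ 0, σ 1, σ 2, σ 3, σ 4].Nodup := (List.nodup_finRange 5).map σ.injective
  have hswap : permMatrixLift (swap i.castSucc i.succ) = transpositionMatrix i := by
    have h : (sortWord 0 (permValues (swap i.castSucc i.succ))).2 = [(i : ℕ)] := by
      revert i
      decide
    rw [permMatrixLift, matrixLift, h]
    simp
  have h := isProportional_entriesLift _ _ _ _ _ hσ
  simp only [Bool.and_eq_true] at h
  obtain ⟨⟨⟨h0, h1⟩, h2⟩, h3⟩ := h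
  rw [hswap]
  refine exists_smul_of_isProportional ?_
  fin_cases i
  · exact h0
  · exact h1
  · exact h2
  · exact h3

/-- The projective general linear group. -/
abbrev PGLTwoFive : Type := GLTwoFive ⧸ Subgroup.center GLTwoFive

theorem mk_eq_mk_of_smul {x y : GLTwoFive} {c : ZMod 5} (h : x.1 = c • y.1) :
    (x : PGLTwoFive) = y := by
  rw [eq_comm, QuotientGroup.eq, Subgroup.mem_center_iff]
  have e : (y⁻¹ * x).1 = c • 1 := by
    rw [Units.val_mul, h, mul_smul_comm, Units.inv_mul]
  intro z
  ext1
  rw [Units.val_mul z, Units.val_mul (y⁻¹ * x), e]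
  simp

/-- The projective representation. -/
def permToPGL : Perm (Fin 5) →* PGLTwoFive :=
  MonoidHom.mk' (fun σ => (permMatrixLift σ : PGLTwoFive)) (by
    intro σ τ
    have h : τ ∈ Submonoid.closure (Set.range fun i : Fin 4 => swap i.castSucc i.succ) := by
      rw [Perm.mclosure_swap_castSucc_succ]
      trivial
    induction h using Submonoid.closure_induction generalizing σ with
    | mem x hx =>
      obtain ⟨i, rfl⟩ := hx
      obtain ⟨c, hc⟩ := permMatrixLift_mul_swap σ i
      exact mk_eq_mk_of_smul hc
    | one =>
      rw [mul_one]
      exact (mul_one (permMatrixLift σ : PGLTwoFive)).symm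
    | mul x y _ _ hx hy => rw [← mul_assoc, hy, hx, hy x, mul_assoc])

/-- Two lifts of an element differ by a central factor, so whether lifts of `u` and `v` commute does
not depend on the choice. One explicit pair of matrices decides it. -/
theorem hasNoncommutingLifts_of_permMatrixLift {G : Type} [Group G] (f : G →* Perm (Fin 5))
    {u v : G} (h : permMatrixLift (f u) * permMatrixLift (f v) ≠
      permMatrixLift (f v) * permMatrixLift (f u)) : HasNoncommutingLifts u v := by
  refine ⟨GLTwoFive, PGLTwoFive, inferInstance, inferInstance,
    QuotientGroup.mk' (Subgroup.center GLTwoFive), permToPGL.comp f,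
    QuotientGroup.mk'_surjective _, by rw [QuotientGroup.ker_mk'], fun U V hU hV e => h ?_⟩
  have key : ∀ {X Y : GLTwoFive}, (X : PGLTwoFive) = Y → ∃ z ∈ Subgroup.center GLTwoFive,
      Y = X * z := fun {X Y} hXY => ⟨X⁻¹ * Y, QuotientGroup.eq.1 hXY, by group⟩
  obtain ⟨z, hz, hz'⟩ := key (show (U : PGLTwoFive) = permMatrixLift (f u) from hU)
  obtain ⟨w, hw, hw'⟩ := key (show (V : PGLTwoFive) = permMatrixLift (f v) from hV)
  rw [Subgroup.mem_center_iff] at hz hw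
  rw [hz', hw']
  calc U * z * (V * w) = U * (z * V) * w := by group
    _ = V * U * z * w := by rw [← hz, ← mul_assoc, e]
    _ = V * (U * z * w) := by group
    _ = V * (w * (U * z)) := by rw [hw]
    _ = V * w * (U * z) := by group

end projective

/-! ### Verification for the alternating and symmetric groups, and conclusion -/

namespace HandleReduction

open PermCode Equiv

/-- The action of the permutations of four points on five points. -/
def extendPerm : Perm (Fin 4) →* Perm (Fin 5) :=
  Perm.extendDomainHom (finSuccAboveEquiv (Fin.last 4))

theorem extendPerm_injective : Function.Injective extendPerm := Perm.extendDomainHom_injective _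

theorem mem_symmetricFourCodes (σ : Perm (Fin 4)) :
    symmetricFourCodes.elem (ofPerm (extendPerm σ)) = true := by
  revert σ
  decide +kernel

theorem exists_of_mem_symmetricFourCodes :
    (symmetricFourCodes.all fun c => decide (∃ σ, (ofPerm (extendPerm σ) == c) = true)) = true := by
  decide +kernel

theorem mem_alternatingFourCodes (σ : Perm (Fin 4)) :
    Perm.sign σ = 1 → alternatingFourCodes.elem (ofPerm (extendPerm σ)) = true := by
  revert σ
  decide +kernel

theorem exists_of_mem_alternatingFourCodes :
    (alternatingFourCodes.all fun c => decide (∃ σ : Perm (Fin 4), Perm.sign σ = 1 ∧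
      (ofPerm (extendPerm σ) == c) = true)) = true := by
  decide +kernel

theorem mem_alternatingFiveCodes (σ : Perm (Fin 5)) :
    Perm.sign σ = 1 → alternatingFiveCodes.elem (ofPerm σ) = true := by
  revert σ
  decide +kernel

theorem exists_of_mem_alternatingFiveCodes :
    (alternatingFiveCodes.all fun c => decide (∃ σ : Perm (Fin 5), Perm.sign σ = 1 ∧
      (ofPerm σ == c) = true)) = true := by
  decide +kernel

/-- The coding of the symmetric group of degree four. -/
noncomputable def symmetricFourCoding : PermCoding (Perm (Fin 4)) :=
  PermCoding.ofHom extendPerm extendPerm_injective symmetricFourCodes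
    (fun σ => List.elem_iff.1 (mem_symmetricFourCodes σ))
    (fun c hc => by
      simpa using List.all_eq_true.1 exists_of_mem_symmetricFourCodes c hc)

/-- The coding of the alternating group of degree four. -/
noncomputable def alternatingFourCoding : PermCoding (alternatingGroup (Fin 4)) :=
  PermCoding.ofHom (extendPerm.comp (alternatingGroup (Fin 4)).subtype)
    (extendPerm_injective.comp Subtype.val_injective) alternatingFourCodes
    (fun σ => List.elem_iff.1 (mem_alternatingFourCodes σ.1 σ.2))
    (fun c hc => by
      have h := List.all_eq_true.1 exists_of_mem_alternatingFourCodes c hc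
      simp only [decide_eq_true_eq, beq_iff_eq] at h
      obtain ⟨σ, hσ, e⟩ := h
      exact ⟨⟨σ, hσ⟩, e⟩)

/-- The coding of the alternating group of degree five. -/
noncomputable def alternatingFiveCoding : PermCoding (alternatingGroup (Fin 5)) :=
  PermCoding.ofHom (alternatingGroup (Fin 5)).subtype Subtype.val_injective alternatingFiveCodes
    (fun σ => List.elem_iff.1 (mem_alternatingFiveCodes σ.1 σ.2))
    (fun c hc => by
      have h := List.all_eq_true.1 exists_of_mem_alternatingFiveCodes c hc
      simp only [decide_eq_true_eq, beq_iff_eq] at h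
      obtain ⟨σ, hσ, e⟩ := h
      exact ⟨⟨σ, hσ⟩, e⟩)

theorem hasNoncommutingLifts_dec {G : Type} [Group G] (P : PermCoding G) (f : G →* Perm (Fin 5))
    (hf : ∀ x, P.enc x = ofPerm (f x)) {σ τ : Perm (Fin 5)} {u v : PermCode} (hu : u ∈ P.codes)
    (hv : v ∈ P.codes) (hσ : (ofPerm σ == u) = true)
    (hτ : (ofPerm τ == v) = true)
    (h : permMatrixLift σ * permMatrixLift τ ≠ permMatrixLift τ * permMatrixLift σ) :
    HasNoncommutingLifts (P.dec u) (P.dec v) := by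
  have key : ∀ {c ρ}, c ∈ P.codes → ofPerm ρ = c → f (P.dec c) = ρ := fun hc e =>
    ofPerm_injective (by rw [← hf, P.enc_dec _ hc, e])
  refine hasNoncommutingLifts_of_permMatrixLift f ?_
  rwa [key hu (eq_of_beq hσ), key hv (eq_of_beq hτ)]

theorem alternatingFour_isCoded :
    alternatingFour.isCoded alternatingFourCodes = true := by decide +kernel

theorem alternatingFour_reachesInvolution :
    alternatingFour.reachesInvolution alternatingFourCodes = true := by
  decide +kernel

theorem alternatingFour_coversInvolutions :
    alternatingFour.coversInvolutions alternatingFourCodes = true := by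
  decide +kernel

theorem alternatingFour_reachesRepresentative :
    alternatingFour.reachesRepresentative alternatingFourCodes = true := by decide +kernel

theorem alternatingFour_mergesHead : ∀ i < alternatingFour.reps.length,
    alternatingFour.mergesHead alternatingFourCodes (alternatingFour.reps.drop i) = true := by
  intro i hi
  change i < 2 at hi
  interval_cases i <;> decide +kernel

theorem alternatingFour_reducesPairs : alternatingFour.reducesPairs = true := by decide +kernel

theorem alternatingFour_reducesCommuting :
    alternatingFour.reducesCommuting alternatingFourCodes = true := by
  decide +kernel

theorem alternatingFour_absorbsAll :
    alternatingFour.absorbsAll alternatingFourCodes = true := by decide +kernel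

theorem alternatingFour_onlyGenerate :
    alternatingFour.onlyGenerate alternatingFourCodes (ofDigits 02314) (ofDigits 10324)
    (ofDigits 02314) (ofDigits 23014) (ofDigits 10324) = true := by decide +kernel

theorem alternatingFour_generates : generates alternatingFourCodes (ofDigits 02314) (ofDigits 10324)
    (ofDigits 02314) (ofDigits 23014) (ofDigits 10324) = true := by decide +kernel

theorem alternatingFour_hasTwoOrbitsByLifting {g : ℕ} (hg : 2 ≤ g) :
    HasTwoOrbitsByLifting g (alternatingGroup (Fin 4)) :=
  alternatingFourCoding.hasTwoOrbitsByLifting alternatingFour alternatingFour_isCoded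
    alternatingFour_reachesInvolution alternatingFour_coversInvolutions
    alternatingFour_reachesRepresentative alternatingFour_mergesHead alternatingFour_reducesPairs
    alternatingFour_reducesCommuting alternatingFour_absorbsAll alternatingFour_onlyGenerate
    alternatingFour_generates
    (hasNoncommutingLifts_dec alternatingFourCoding
      (extendPerm.comp (alternatingGroup (Fin 4)).subtype) (fun _ => rfl)
      (σ := swap 0 2 * swap 1 3) (τ := swap 0 1 * swap 2 3)
      (List.elem_iff.1 (show alternatingFourCodes.elem (ofDigits 23014) = true by decide +kernel))
      (List.elem_iff.1 (show alternatingFourCodes.elem (ofDigits 10324) = true by decide +kernel))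
      (by decide +kernel) (by decide +kernel) (by decide +kernel)) hg

theorem symmetricFour_isCoded : symmetricFour.isCoded symmetricFourCodes = true := by decide +kernel

theorem symmetricFour_reachesInvolution :
    symmetricFour.reachesInvolution symmetricFourCodes = true := by
  decide +kernel

theorem symmetricFour_coversInvolutions :
    symmetricFour.coversInvolutions symmetricFourCodes = true := by
  decide +kernel

theorem symmetricFour_reachesRepresentative :
    symmetricFour.reachesRepresentative symmetricFourCodes = true := by decide +kernel

theorem symmetricFour_mergesHead : ∀ i < symmetricFour.reps.length,
    symmetricFour.mergesHead symmetricFourCodes (symmetricFour.reps.drop i) = true := by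
  intro i hi
  change i < 6 at hi
  interval_cases i <;> decide +kernel

theorem symmetricFour_reducesPairs : symmetricFour.reducesPairs = true := by decide +kernel

theorem symmetricFour_reducesCommuting :
    symmetricFour.reducesCommuting symmetricFourCodes = true := by
  decide +kernel

theorem symmetricFour_absorbsAll :
    symmetricFour.absorbsAll symmetricFourCodes = true := by decide +kernel

theorem symmetricFour_onlyGenerate :
    symmetricFour.onlyGenerate symmetricFourCodes (ofDigits 12034) (ofDigits 01324)
    (ofDigits 02134) (ofDigits 10234) (ofDigits 01324) = true := by decide +kernel

theorem symmetricFour_generates : generates symmetricFourCodes (ofDigits 12034) (ofDigits 01324)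
    (ofDigits 02134) (ofDigits 10234) (ofDigits 01324) = true := by decide +kernel

theorem symmetricFour_hasTwoOrbitsByLifting {g : ℕ} (hg : 2 ≤ g) :
    HasTwoOrbitsByLifting g (Perm (Fin 4)) :=
  symmetricFourCoding.hasTwoOrbitsByLifting symmetricFour symmetricFour_isCoded
    symmetricFour_reachesInvolution symmetricFour_coversInvolutions
    symmetricFour_reachesRepresentative symmetricFour_mergesHead symmetricFour_reducesPairs
    symmetricFour_reducesCommuting symmetricFour_absorbsAll symmetricFour_onlyGenerate
    symmetricFour_generates
    (hasNoncommutingLifts_dec symmetricFourCoding (extendPerm) (fun _ => rfl)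
      (σ := swap 0 1) (τ := swap 2 3)
      (List.elem_iff.1 (show symmetricFourCodes.elem (ofDigits 10234) = true by decide +kernel))
      (List.elem_iff.1 (show symmetricFourCodes.elem (ofDigits 01324) = true by decide +kernel))
      (by decide +kernel) (by decide +kernel) (by decide +kernel)) hg

theorem alternatingFive_isCoded :
    alternatingFive.isCoded alternatingFiveCodes = true := by decide +kernel

theorem alternatingFive_reachesInvolution :
    alternatingFive.reachesInvolution alternatingFiveCodes = true := by
  decide +kernel

theorem alternatingFive_coversInvolutions :
    alternatingFive.coversInvolutions alternatingFiveCodes = true := by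
  decide +kernel

theorem alternatingFive_reachesRepresentative :
    alternatingFive.reachesRepresentative alternatingFiveCodes = true := by decide +kernel

theorem alternatingFive_mergesHead : ∀ i < alternatingFive.reps.length,
    alternatingFive.mergesHead alternatingFiveCodes (alternatingFive.reps.drop i) = true := by
  intro i hi
  change i < 8 at hi
  interval_cases i <;> decide +kernel

theorem alternatingFive_reducesPairs : alternatingFive.reducesPairs = true := by decide +kernel

theorem alternatingFive_reducesCommuting :
    alternatingFive.reducesCommuting alternatingFiveCodes = true := by
  decide +kernel

theorem alternatingFive_absorbsAll :
    alternatingFive.absorbsAll alternatingFiveCodes = true := by decide +kernel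

theorem alternatingFive_onlyGenerate :
    alternatingFive.onlyGenerate alternatingFiveCodes (ofDigits 12340) (ofDigits 02143)
    (ofDigits 10243) (ofDigits 03412) (ofDigits 02143) = true := by decide +kernel

theorem alternatingFive_generates : generates alternatingFiveCodes (ofDigits 12340) (ofDigits 02143)
    (ofDigits 10243) (ofDigits 03412) (ofDigits 02143) = true := by decide +kernel

theorem alternatingFive_hasTwoOrbitsByLifting {g : ℕ} (hg : 2 ≤ g) :
    HasTwoOrbitsByLifting g (alternatingGroup (Fin 5)) :=
  alternatingFiveCoding.hasTwoOrbitsByLifting alternatingFive alternatingFive_isCoded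
    alternatingFive_reachesInvolution alternatingFive_coversInvolutions
    alternatingFive_reachesRepresentative alternatingFive_mergesHead alternatingFive_reducesPairs
    alternatingFive_reducesCommuting alternatingFive_absorbsAll alternatingFive_onlyGenerate
    alternatingFive_generates
    (hasNoncommutingLifts_dec alternatingFiveCoding
      ((alternatingGroup (Fin 5)).subtype) (fun _ => rfl)
      (σ := swap 1 3 * swap 2 4) (τ := swap 1 2 * swap 3 4)
      (List.elem_iff.1 (show alternatingFiveCodes.elem (ofDigits 03412) = true by decide +kernel))
      (List.elem_iff.1 (show alternatingFiveCodes.elem (ofDigits 02143) = true by decide +kernel))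
      (by decide +kernel) (by decide +kernel) (by decide +kernel)) hg

end HandleReduction

theorem mainTheorem8 (g : ℕ) (hg : 2 ≤ g) :
    (∀ n : ℕ, 1 ≤ n → ActsTransitively g (Multiplicative (ZMod n))) ∧
    (∀ n : ℕ, Odd n → ActsTransitively g (DihedralGroup n)) ∧
    HasTwoOrbitsByLifting g (alternatingGroup (Fin 4)) ∧
    HasTwoOrbitsByLifting g (Equiv.Perm (Fin 4)) ∧
    HasTwoOrbitsByLifting g (alternatingGroup (Fin 5)) ∧
    (∀ n : ℕ, 2 ≤ n → Even n → HasTwoOrbitsByLifting g (DihedralGroup n)) := by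
  refine ⟨fun n hn => actsTransitively_zmod (by omega) n hn,
    fun n hn => DihedralGroup.actsTransitively hg hn,
    HandleReduction.alternatingFour_hasTwoOrbitsByLifting hg,
    HandleReduction.symmetricFour_hasTwoOrbitsByLifting hg,
    HandleReduction.alternatingFive_hasTwoOrbitsByLifting hg, ?_⟩
  rintro n hn ⟨m, rfl⟩
  rw [← two_mul]
  exact DihedralGroup.hasTwoOrbitsByLifting hg (by omega)
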